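/- Let $1\le k\le n$ be integers and let $\mathrm{Gr}(k,n)$ be the complex Grassmannian, with Plücker coordinates $\Delta_I$. On the affine chart $\Delta_{12\cdots k}\neq 0$ represent a point by the $k\times n$ matrix $X$ with the identity matrix in columns $1,\dots,k$ and with the coordinates $x_{a,b}$ ($1\le a\le k<b\le n$) in the remaining columns, and define the rational top form $$\omega=\frac{d^{k\times n}C/\mathrm{GL}(k)}{\Delta_{12\cdots k}\Delta_{23\cdots k+1}\cdots\Delta_{n1\cdots k-1}}=\frac{\bigwedge_{a,b}dx_{a,b}}{\Delta_{12\cdots k}(X)\,\Delta_{23\cdots k+1}(X)\cdots\Delta_{n1\cdots k-1}(X)} ,$$ where the denominator is the product of the $n$ minors of $X$ in cyclically consecutive columns. Let $G$ be a planar bipartite graph in a disk with boundary vertices $1,\dots,n$ (of degree one) in clockwise order. An almost perfect matching of $G$ is a set of edges that uses every interior vertex exactly once; its boundary subset consists of the black boundary vertices that it uses and the white boundary vertices that it does not use. For edge weights on $G$ and $I\in\binom{[n]}{k}$, the boundary measurement $\Delta_I$ is the sum, over the almost perfect matchings with boundary subset $I$, of the product of the weights of the edges of the matching. A disconnected grove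 is a spanning subforest in which every component contains exactly one boundary vertex. If $G$ is reduced with bounded affine permutation $f$ and $E'$ is a set of edges whose complement is a disconnected grove, let $\phi_{E'}$ send $(t_e)_{e\in E'}$ to the point whose Plücker coordinates are the boundary measurements for the weights $t_e$ on $E'$ and $1$ on all other edges. The form $\omega_G=\pm\bigwedge_{e\in E'}dt_e/t_e$, transported along the birational map $\phi_{E'}$, is the canonical form $\omega_f$, taken up to sign. Let $\mathrm{id}(i)=i+k$ be the bounded affine permutation of the top cell, and represent it by the $k\times(n-k)$ rectangular grid $G$: every crossing of a row and a column is a black vertex (incident to the edges going east and north, if any) joined to a white vertex south-west of it (incident to the edges going west and south, if any); the boundary vertices $1,\dots,k$ are at the right ends of the rows from top to bottom and $k+1,\dots,n$ at the lower ends of the columns from right to left; on each row a further white vertex is placed next to the boundary vertex. Then $G$ is a reduced planar bipartite graph with bounded affine permutation $\mathrm{id}$, so that $\omega_{\mathrm{id}}=\pm\omega_G$. Subsets $E'$ whose complement is a disconnected grove exist, for each of them $\phi_{E'}$ is a birational map from $(\mathbb C^*)^{E'}$ to $\mathrm{Gr}(k,n)$, and $$\omega_{\mathrm{id}}=\pm\,\omega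 .$$ -/

import Mathlib

open scoped KaehlerDifferential

noncomputable section

/-- The two vertex colours of a bipartite graph. -/
inductive Color where
  | black
  | white
  deriving DecidableEq

instance : Fintype Color := ⟨{Color.black, Color.white}, fun c => by cases c <;> simp⟩

/-- The opposite colour. -/
def Color.other : Color → Color
  | .black => .white
  | .white => .black

/-- A finite bipartite graph drawn in a disk with boundary vertices `0, …, n-1` placed clockwise on
the boundary circle (they stand for the labels `1, …, n`), given by its rotation system.
Every edge `e` has one black and one white end (a boundary vertex carries the colour
opposite to that of its neighbour).  `rot c e` is the next edge, clockwise, around the `c`-coloured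
end of `e`; thus the `c`-coloured vertices are the cycles of `rot c`, there are no isolated vertices,
and multiple edges are allowed.  The boundary vertex `i` is the end of colour `bdryColor i` of the
edge `bdryEdge i`.  Boundary vertices have degree one, and no edge joins two boundary vertices.
Planarity is the separate condition `IsPlanar`. -/
structure DiskGraph (n : ℕ) where
  Edge : Type
  [fintypeEdge : Fintype Edge]
  [decEqEdge : DecidableEq Edge]
  rot : Color → Equiv.Perm Edge
  bdryEdge : Fin n → Edge
  bdryColor : Fin n → Color
  bdryEdge_injective : Function.Injective bdryEdge
  rot_bdryEdge : ∀ i, rot (bdryColor i) (bdryEdge i) = bdryEdge i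

namespace DiskGraph

attribute [instance] DiskGraph.fintypeEdge DiskGraph.decEqEdge

variable {n : ℕ} (G : DiskGraph n)

/-! ### Vertices, matchings, boundary measurements -/

/-- All vertices, interior or boundary: classes of half-edges `(c, e)` (the `c`-coloured half of `e`)
under rotation around the common vertex. -/
def Vertex : Type :=
  Quot (fun x y : Color × G.Edge => y = (x.1, G.rot x.1 x.2))

/-- The `c`-coloured end of the edge `e`. -/
def endpt (c : Color) (e : G.Edge) : G.Vertex := Quot.mk _ (c, e)

/-- The `i`-th boundary vertex. -/
def bdryVertex (i : Fin n) : G.Vertex := G.endpt (G.bdryColor i) (G.bdryEdge i)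

def IsInterior (v : G.Vertex) : Prop := ∀ i, v ≠ G.bdryVertex i

def Incident (v : G.Vertex) (e : G.Edge) : Prop := ∃ c, G.endpt c e = v

/-- Almost perfect matchings: every interior vertex is used exactly once. -/
def IsAlmostPerfectMatching (M : Finset G.Edge) : Prop :=
  ∀ v, G.IsInterior v → ∃! e, e ∈ M ∧ G.Incident v e

/-- The boundary subset of an almost perfect matching: the black boundary vertices that are used
together with the white boundary vertices that are not used. -/
def bdrySubset (M : Finset G.Edge) : Finset (Fin n) :=
  Finset.univ.filter fun i =>
    (G.bdryColor i = .black ∧ G.bdryEdge i ∈ M) ∨ (G.bdryColor i = .white ∧ G.bdryEdge i ∉ M)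

open Classical in
/-- The boundary measurement `Δ_I` of the network with edge weights `wt`: the sum of the weights of
the almost perfect matchings with boundary subset `I`. -/
def boundaryMeasurement {R : Type*} [CommRing R] (wt : G.Edge → R) (I : Finset (Fin n)) : R :=
  ∑ M : Finset G.Edge with G.IsAlmostPerfectMatching M ∧ G.bdrySubset M = I, ∏ e ∈ M, wt e

/-! ### Planarity -/

/-- The directed edge `(c, e)` is `e` traversed towards its `c`-coloured end.  This is the directed
edge that leaves the boundary vertex `i`. -/
def inDart (i : Fin n) : Color × G.Edge := ((G.bdryColor i).other, G.bdryEdge i)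

/-- The directed edge that arrives at the boundary vertex `i`. -/
def outDart (i : Fin n) : Color × G.Edge := (G.bdryColor i, G.bdryEdge i)

/-- Two successive directed edges along a face that is kept on the right-hand side: at an
interior vertex one takes the next edge counterclockwise, at the boundary vertex `i` one follows the
boundary circle clockwise to the boundary vertex `i + 1` (modulo `n`). -/
def FaceStep (d d' : Color × G.Edge) : Prop :=
  (G.IsInterior (G.endpt d.1 d.2) ∧ d' = (d.1.other, (G.rot d.1).symm d.2)) ∨
    ∃ i, d = G.outDart i ∧ d' = G.inDart (finRotate n i)

/-- The faces of the graph in the disk. -/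
def Face : Type := Quot G.FaceStep

/-- The simple graph on the vertices with the edges from `F`. -/
def edgeGraph (F : Finset G.Edge) : SimpleGraph G.Vertex :=
  SimpleGraph.fromRel fun v w => ∃ e ∈ F, G.endpt .black e = v ∧ G.endpt .white e = w

/-- The rotation system is that of a graph embedded in the disk with the boundary vertices in
clockwise order: every component meets the boundary, and Euler's formula `V - E + F = 2`
holds on the sphere that is obtained by collapsing the boundary circle to one vertex. -/
def IsPlanar : Prop :=
  (∀ v, ∃ i, (G.edgeGraph Finset.univ).Reachable v (G.bdryVertex i)) ∧
    (Nat.card {v // G.IsInterior v} + 1) + Nat.card G.Face = Fintype.card G.Edge + 2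

/-! ### Trips and reduced graphs -/

/-- Trips turn maximally right at black vertices and maximally left at white vertices. -/
def tripNext (d : Color × G.Edge) : Color × G.Edge :=
  match d.1 with
  | .black => (.white, (G.rot .black).symm d.2)
  | .white => (.black, G.rot .white d.2)

/-- `d` and `d'` lie on the same trip, and `d'` is equal to `d` or comes after it.  Trips stop on
arrival at a boundary vertex. -/
def TripReaches (d d' : Color × G.Edge) : Prop :=
  ∃ r : ℕ, G.tripNext^[r] d = d' ∧ ∀ s < r, ∀ i, G.tripNext^[s] d ≠ G.outDart i

/-- The end `v = endpt c e` has degree one. -/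
def IsLeafEnd (c : Color) (e : G.Edge) : Prop := G.rot c e = e

/-- `e` joins a boundary vertex to an interior vertex of degree one. -/
def IsBoundaryLeafEdge (e : G.Edge) : Prop :=
  ∃ i, e = G.bdryEdge i ∧ G.IsLeafEnd (G.bdryColor i).other e

structure IsReduced : Prop where
  /-- Interior vertices of degree one are adjacent to the boundary. -/
  leafless : ∀ c e, G.IsInterior (G.endpt c e) → G.IsLeafEnd c e → G.IsBoundaryLeafEdge e
  /-- No trip is a cycle. -/
  no_cycle : ∀ d, ∃ i, G.TripReaches d (G.outDart i)
  /-- No trip uses an edge twice, once in each direction, except at a boundary leaf. -/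
  no_self_crossing : ∀ c e, G.TripReaches (c, e) (c.other, e) → G.IsBoundaryLeafEdge e
  /-- No two trips share two edges that appear in the same order in both.  (Two different trips
  traverse a common edge in opposite directions.) -/
  no_double_crossing : ∀ c₁ e₁ c₂ e₂, e₁ ≠ e₂ → G.TripReaches (c₁, e₁) (c₂, e₂) →
    ¬ G.TripReaches (c₁.other, e₁) (c₂.other, e₂)

/-- `f` is the bounded affine permutation of `G`: it is congruent modulo `n` to the trip permutation;
if the trip that starts at `i` ends at `i`, then `f i = i` when the boundary vertex `i` is joined to
a black vertex and `f i = i + n` when it is joined to a white vertex. -/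
structure HasBoundedAffinePerm (f : ℤ → ℤ) : Prop where
  bijective : Function.Bijective f
  periodic : ∀ a, f (a + n) = f a + n
  bounded : ∀ a, a ≤ f a ∧ f a ≤ a + n
  trip : ∀ i : Fin n, ∃ j : Fin n, G.TripReaches (G.inDart i) (G.outDart j) ∧
    f ((i : ℤ) + 1) ≡ (j : ℤ) + 1 [ZMOD n]
  black_leaf : ∀ i : Fin n, f ((i : ℤ) + 1) = (i : ℤ) + 1 → (G.bdryColor i).other = .black
  white_leaf : ∀ i : Fin n, f ((i : ℤ) + 1) = (i : ℤ) + 1 + n → (G.bdryColor i).other = .white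

/-- Disconnected groves: spanning subforests in which every component contains exactly one boundary
vertex.  (Parallel edges form a cycle, hence the second condition.) -/
structure IsDisconnectedGrove (F : Finset G.Edge) : Prop where
  acyclic : (G.edgeGraph F).IsAcyclic
  no_parallel : ∀ e ∈ F, ∀ e' ∈ F, (∀ c, G.endpt c e = G.endpt c e') → e = e'
  component : ∀ v, ∃! i, (G.edgeGraph F).Reachable v (G.bdryVertex i)

end DiskGraph

/-! ### The Grassmannian and rational differential forms -/

/-- The field of rational functions over `ℂ` in variables indexed by `σ`. -/
abbrev RatFun (σ : Type) : Type := FractionRing (MvPolynomial σ ℂ)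

/-- A variable, as a rational function. -/
def RatFun.var {σ : Type} (s : σ) : RatFun σ := algebraMap (MvPolynomial σ ℂ) (RatFun σ) (.X s)

/-- The function field of `Gr(k,n)`: rational functions in the coordinates `x_{a,b}` of the affine
chart `Δ_{12⋯k} ≠ 0`. -/
abbrev GrField (k n : ℕ) : Type := RatFun (Fin k × Fin (n - k))

/-- The `k × n` matrix with the identity matrix in the first `k` columns and the matrix `x` in the
remaining columns. -/
def chartMatrix {k n : ℕ} {R : Type*} [CommRing R] (x : Fin k × Fin (n - k) → R) :
    Matrix (Fin k) (Fin n) R :=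
  Matrix.of fun a j =>
    if h : (j : ℕ) < k then (if (j : ℕ) = a then 1 else 0)
    else x (a, ⟨j - k, by have := j.isLt; omega⟩)

/-- The minor of `M` in the columns `J 0, J 1, …, J (k-1)`, in this order. -/
def pluckerTuple {k n : ℕ} {R : Type*} [CommRing R] (M : Matrix (Fin k) (Fin n) R)
    (J : Fin k → Fin n) : R :=
  (M.submatrix id J).det

/-- The cyclically consecutive columns `i, i + 1, …, i + k - 1` modulo `n`. -/
def cyclicColumns (k : ℕ) {n : ℕ} (i : Fin n) : Fin k → Fin n :=
  fun a => ⟨(i + a) % n, Nat.mod_lt _ (by have := i.isLt; omega)⟩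

/-- The rows of `M` span the point with homogeneous Plücker coordinates `p`. -/
def HasPluckerCoords {k n : ℕ} {L : Type*} [Field L] (M : Matrix (Fin k) (Fin n) L)
    (p : Finset (Fin n) → L) : Prop :=
  ∃ c : L, c ≠ 0 ∧ ∀ (I : Finset (Fin n)) (hI : I.card = k),
    pluckerTuple M (I.orderEmbOfFin hI) = c * p I

/-- Rational differential forms on a variety over `ℂ` with function field `K`. -/
abbrev RatForm (K : Type) [Field K] [Algebra ℂ K] : Type := ExteriorAlgebra K (Ω[K⁄ℂ])

/-- The wedge product of the differentials `v i` in some order; it is only meaningful up to sign. -/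
def wedgeProd {K : Type} [Field K] [Algebra ℂ K] {ι : Type} [Fintype ι] (v : ι → Ω[K⁄ℂ]) :
    RatForm K :=
  ((Finset.univ : Finset ι).toList.map fun i => ExteriorAlgebra.ι K (v i)).prod

/-- The logarithmic differential `du / u`. -/
def dlog {K : Type} [Field K] [Algebra ℂ K] (u : K) : Ω[K⁄ℂ] := u⁻¹ • KaehlerDifferential.D ℂ K u

/-- The form `d^{k×n}C / GL(k)` divided by `Δ_{12⋯k} Δ_{23⋯k+1} ⋯ Δ_{n1⋯k-1}`, in the chart
`Δ_{12⋯k} ≠ 0`. -/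
def grassmannianForm (k n : ℕ) : RatForm (GrField k n) :=
  (∏ i : Fin n, pluckerTuple (chartMatrix (RatFun.var : _ → GrField k n)) (cyclicColumns k i))⁻¹ •
    wedgeProd fun ab : Fin k × Fin (n - k) =>
      KaehlerDifferential.D ℂ (GrField k n) (RatFun.var ab)

namespace DiskGraph

variable {n : ℕ} (G : DiskGraph n)

/-- The generic weights that are independent variables `t_e` on the edges of `E'`, and `1` on all
other edges. -/
def genericWeight (E' : Finset G.Edge) (e : G.Edge) : RatFun {e // e ∈ E'} :=
  if h : e ∈ E' then RatFun.var ⟨e, h⟩ else 1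

/-- The pullback of rational functions along `φ_{E'}`, which sends edge weights `(t_e)_{e ∈ E'}` to
the point of `Gr(k,n)` whose Plücker coordinates are the boundary measurements, when this map is
birational: the isomorphism `ψ` of function fields under which the generic point of `Gr(k,n)`
becomes the image of the generic network. -/
def IsPullback (k : ℕ) (E' : Finset G.Edge) (ψ : GrField k n ≃ₐ[ℂ] RatFun {e // e ∈ E'}) : Prop :=
  HasPluckerCoords (chartMatrix fun ab => ψ (RatFun.var ab))
    (G.boundaryMeasurement (G.genericWeight E'))

/-- `ω = ± ω_G`: for every `E'` whose complement is a disconnected grove (and such `E'` exist),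
`φ_{E'}` is a birational map to `Gr(k,n)`, and it identifies `ω`, up to sign, with the
product of the forms `dt_e / t_e` over `e ∈ E'`. -/
def HasCanonicalForm (k : ℕ) (ω : RatForm (GrField k n)) : Prop :=
  (∃ E' : Finset G.Edge, G.IsDisconnectedGrove E'ᶜ) ∧
    ∀ E' : Finset G.Edge, G.IsDisconnectedGrove E'ᶜ →
      ∃ ψ : GrField k n ≃ₐ[ℂ] RatFun {e // e ∈ E'}, G.IsPullback k E' ψ ∧
        (ω = wedgeProd (fun e : {e // e ∈ E'} => dlog (ψ.symm (RatFun.var e))) ∨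
          ω = -wedgeProd (fun e : {e // e ∈ E'} => dlog (ψ.symm (RatFun.var e))))

end DiskGraph

/-! ### The rectangular grid -/

/-- The edges of the rectangular grid with `k` rows (numbered from top to bottom) and `m` columns
(numbered from right to left).  At the crossing `(i, j)` there is a black vertex with, to the
south-west of it, a white vertex.
* `diag i j` joins the black to the white vertex of the crossing `(i, j)`;
* `vert i j` goes south from the white vertex of `(i, j)` to the black vertex of `(i+1, j)`, or, when
  `i` is the last row, to a boundary vertex;
* `horiz i j` goes east from the black vertex of `(i, j)` to the white vertex of `(i, j-1)`, or, when
  `j = 0`, to an additional white vertex at the right end of row `i`;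
* `source i` joins this additional white vertex to a boundary vertex.
The additional white vertices have degree two, unless `m = 0`, when they are boundary leaves. -/
inductive GridEdge (k m : ℕ) where
  | source (i : Fin k)
  | horiz (i : Fin k) (j : Fin m)
  | vert (i : Fin k) (j : Fin m)
  | diag (i : Fin k) (j : Fin m)
  deriving DecidableEq

namespace GridEdge

variable {k m : ℕ}

def equivSum : GridEdge k m ≃ Fin k ⊕ (Fin k × Fin m) ⊕ (Fin k × Fin m) ⊕ (Fin k × Fin m) where
  toFun
    | source i => .inl i
    | horiz i j => .inr (.inl (i, j))
    | vert i j => .inr (.inr (.inl (i, j)))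
    | diag i j => .inr (.inr (.inr (i, j)))
  invFun
    | .inl i => source i
    | .inr (.inl (i, j)) => horiz i j
    | .inr (.inr (.inl (i, j))) => vert i j
    | .inr (.inr (.inr (i, j))) => diag i j
  left_inv e := by cases e <;> rfl
  right_inv x := by rcases x with i | ⟨i, j⟩ | ⟨i, j⟩ | ⟨i, j⟩ <;> rfl

instance : Fintype (GridEdge k m) := Fintype.ofEquiv _ equivSum.symm

/-- Clockwise rotation around black ends: north, east, south-west. -/
def rotBlack : Equiv.Perm (GridEdge k m) where
  toFun
    | source i => source i
    | vert i j => if h : (i : ℕ) + 1 < k then horiz ⟨i + 1, h⟩ j else vert i j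
    | horiz i j => diag i j
    | diag i j => if (i : ℕ) = 0 then horiz i j else vert ⟨i - 1, by omega⟩ j
  invFun
    | source i => source i
    | vert i j => if h : (i : ℕ) + 1 < k then diag ⟨i + 1, h⟩ j else vert i j
    | horiz i j => if (i : ℕ) = 0 then diag i j else vert ⟨i - 1, by omega⟩ j
    | diag i j => horiz i j
  left_inv e := by
    rcases e with i | ⟨i, j⟩ | ⟨i, j⟩ | ⟨i, j⟩
    · rfl
    · rfl
    · by_cases h : (i : ℕ) + 1 < k <;> simp [h]
    · by_cases h : (i : ℕ) = 0
      · simp [h]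
      · have h' : (i : ℕ) - 1 + 1 = i := by omega
        simp [h, h']
  right_inv e := by
    rcases e with i | ⟨i, j⟩ | ⟨i, j⟩ | ⟨i, j⟩
    · rfl
    · by_cases h : (i : ℕ) = 0
      · simp [h]
      · have h' : (i : ℕ) - 1 + 1 = i := by omega
        simp [h, h']
    · by_cases h : (i : ℕ) + 1 < k <;> simp [h]
    · rfl

/-- Clockwise rotation around white ends: north-east, south, west at a crossing; east, west at
the additional vertices. -/
def rotWhite : Equiv.Perm (GridEdge k m) where
  toFun
    | source i => if h : 0 < m then horiz i ⟨0, h⟩ else source i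
    | horiz i j => if (j : ℕ) = 0 then source i else diag i ⟨j - 1, by omega⟩
    | vert i j => if h : (j : ℕ) + 1 < m then horiz i ⟨j + 1, h⟩ else diag i j
    | diag i j => vert i j
  invFun
    | source i => if h : 0 < m then horiz i ⟨0, h⟩ else source i
    | horiz i j => if (j : ℕ) = 0 then source i else vert i ⟨j - 1, by omega⟩
    | vert i j => diag i j
    | diag i j => if h : (j : ℕ) + 1 < m then horiz i ⟨j + 1, h⟩ else vert i j
  left_inv e := by
    rcases e with i | ⟨i, j⟩ | ⟨i, j⟩ | ⟨i, j⟩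
    · by_cases h : 0 < m <;> simp [h]
    · have hm : 0 < m := by have := j.isLt; omega
      by_cases h : (j : ℕ) = 0
      · simp [h, hm, Fin.ext_iff]
      · have h' : (j : ℕ) - 1 + 1 = j := by omega
        simp [h, h']
    · by_cases h : (j : ℕ) + 1 < m <;> simp [h]
    · rfl
  right_inv e := by
    rcases e with i | ⟨i, j⟩ | ⟨i, j⟩ | ⟨i, j⟩
    · by_cases h : 0 < m <;> simp [h]
    · have hm : 0 < m := by have := j.isLt; omega
      by_cases h : (j : ℕ) = 0
      · simp [h, hm, Fin.ext_iff]
      · have h' : (j : ℕ) - 1 + 1 = j := by omega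
        simp [h, h']
    · rfl
    · by_cases h : (j : ℕ) + 1 < m <;> simp [h]

end GridEdge

/-- The rectangular grid as a graph in the disk, for `Gr(k,n)`.  The boundary vertices `1, …, k` are
at the right ends of the rows, from top to bottom, and `k+1, …, n` at the lower ends of the columns,
from right to left. -/
def gridGraph (k n : ℕ) (hk : 0 < k) : DiskGraph n where
  Edge := GridEdge k (n - k)
  rot
    | .black => GridEdge.rotBlack
    | .white => GridEdge.rotWhite
  bdryEdge t :=
    if h : (t : ℕ) < k then .source ⟨t, h⟩
    else .vert ⟨k - 1, by omega⟩ ⟨t - k, by have := t.isLt; omega⟩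
  bdryColor _ := .black
  bdryEdge_injective s t h := by
    by_cases hs : (s : ℕ) < k <;> by_cases ht : (t : ℕ) < k <;>
      simp [hs, ht, Fin.ext_iff] at h ⊢ <;> omega
  rot_bdryEdge t := by
    have hk' : k - 1 + 1 = k := by omega
    by_cases ht : (t : ℕ) < k <;> simp [ht, GridEdge.rotBlack, hk']

end

/-! Put m = n - k. The combinatorial claims are settled by explicit labels. Faces are labelled by
the km crossings together with one outer region at the top and left, which gives Euler's formula.
Trips climb a staircase to the north-west until the first row or the last column and then run
straight down or to the right. Hence the end of a trip and a strictly decreasing height can be read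
off from each directed edge, and reducedness becomes arithmetic.

For the form, use first the weights v i b on the vertical edges and 1 elsewhere; the remaining edges
are the rows, which form a disconnected grove. An almost perfect matching of the grid is the same as
a family of disjoint paths from row ends to column ends: horizontal and vertical edges of the
matching are traversed, diagonal edges mark the crossings that are not visited. The network matrix
is built row by row, the new column b being v i b times the i-th unit vector minus the sum of the
old columns up to b. Its maximal minors are the boundary measurements (`det_gridColumn`,
`grid_boundaryMeasurement`). In the exterior algebra the partial sums square to zero, which leaves
only disjoint families, and the minus sign in the recursion absorbs all reordering signs, so no
sign-reversing involution is needed.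

Any other disconnected grove is reached by a gauge transformation. Gauge fixing is a monomial
substitution whose inverse is gauge fixing for the first grove (`sum_gaugeFix_mul`). It multiplies
all boundary measurements by one factor, and since its exponent matrix is invertible over the
integers, it changes the wedge of logarithmic differentials by at most a sign
(`wedgeProd_unimodular`).

The same recursion does the rest. Read backwards, it recovers the weights rationally from the matrix
entries (`mem_of_gridEntry_mem`), so these generate the function field and, by their number, are
independent: the map is birational. Read forwards, it shows that dx differs from the wedge of the
dlog v by ± the product of v i b to the power i + 1 (`exists_wedgeProd_rowForm`). The product of the
n cyclic minors is ± the same monomial (`prod_pluckerTuple_cyclicColumns_sq`), so the quotient is ±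
the wedge of the dlog v. Signs are never tracked: the two monomials are compared through their
squares. -/

/-! ### Vertices of the grid -/

/-- Names for the vertices of the rectangular grid: the black and the white vertex of a crossing, the
additional white vertex of a row, and the boundary vertices at the rows and the columns. -/
inductive GridVertex (k m : ℕ) where
  | black (i : Fin k) (j : Fin m)
  | white (i : Fin k) (j : Fin m)
  | extra (i : Fin k)
  | rowEnd (i : Fin k)
  | colEnd (j : Fin m)

namespace GridVertex

variable {k m : ℕ}

/-- The vertices that do not lie on the boundary circle. -/
def Inner : GridVertex k m → Prop
  | black _ _ => True
  | white _ _ => True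
  | extra _ => True
  | rowEnd _ => False
  | colEnd _ => False

def innerEquivSum : {v : GridVertex k m // v.Inner} ≃ (Fin k × Fin m) ⊕ (Fin k × Fin m) ⊕ Fin k where
  toFun
    | ⟨black i j, _⟩ => .inl (i, j)
    | ⟨white i j, _⟩ => .inr (.inl (i, j))
    | ⟨extra i, _⟩ => .inr (.inr i)
  invFun
    | .inl (i, j) => ⟨black i j, trivial⟩
    | .inr (.inl (i, j)) => ⟨white i j, trivial⟩
    | .inr (.inr i) => ⟨extra i, trivial⟩
  left_inv v := by
    rcases v with ⟨v, hv⟩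
    cases v <;> first | rfl | exact hv.elim
  right_inv x := by rcases x with ⟨i, j⟩ | ⟨i, j⟩ | i <;> rfl

end GridVertex

namespace GridEdge

variable {k m : ℕ}

/-- The end of the given colour of an edge of the grid. -/
def vertexAt : Color → GridEdge k m → GridVertex k m
  | .black, source i => .rowEnd i
  | .black, horiz i j => .black i j
  | .black, vert i j => if h : (i : ℕ) + 1 < k then .black ⟨i + 1, h⟩ j else .colEnd j
  | .black, diag i j => .black i j
  | .white, source i => .extra i
  | .white, horiz i j => if (j : ℕ) = 0 then .extra i else .white i ⟨j - 1, by omega⟩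
  | .white, vert i j => .white i j
  | .white, diag i j => .white i j

end GridEdge

/-- An edge of the given colour at a vertex. -/
def GridVertex.halfEdge {k m : ℕ} (hk : 0 < k) : GridVertex k m → Color × GridEdge k m
  | .black i j => (.black, .diag i j)
  | .white i j => (.white, .diag i j)
  | .extra i => (.white, .source i)
  | .rowEnd i => (.black, .source i)
  | .colEnd j => (.black, .vert ⟨k - 1, by omega⟩ j)

section Grid

variable {k n : ℕ} (hk : 0 < k)

theorem vertexAt_rot (c : Color) (e : GridEdge k (n - k)) :
    GridEdge.vertexAt c ((gridGraph k n hk).rot c e) = GridEdge.vertexAt c e := by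
  rcases c with _ | _
  · change GridEdge.vertexAt .black (GridEdge.rotBlack e) = _
    rcases e with i | ⟨i, j⟩ | ⟨i, j⟩ | ⟨i, j⟩
    · rfl
    · rfl
    · by_cases h : (i : ℕ) + 1 < k <;> simp [GridEdge.rotBlack, GridEdge.vertexAt, h]
    · by_cases h : (i : ℕ) = 0
      · simp [GridEdge.rotBlack, GridEdge.vertexAt, h]
      · have h' : (i : ℕ) - 1 + 1 = i := by omega
        simp [GridEdge.rotBlack, GridEdge.vertexAt, h, h']
  · change GridEdge.vertexAt .white (GridEdge.rotWhite e) = _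
    rcases e with i | ⟨i, j⟩ | ⟨i, j⟩ | ⟨i, j⟩
    · by_cases h : 0 < n - k <;> simp only [GridEdge.rotWhite, Equiv.coe_fn_mk, h, dite_true,
        dite_false, GridEdge.vertexAt, if_true]
    · by_cases h : (j : ℕ) = 0 <;> simp [GridEdge.rotWhite, GridEdge.vertexAt, h]
    · by_cases h : (j : ℕ) + 1 < n - k <;>
        simp only [GridEdge.rotWhite, Equiv.coe_fn_mk, h, dite_true, dite_false, GridEdge.vertexAt]
      simp
    · rfl

theorem endpt_eq_of_rot {n : ℕ} (G : DiskGraph n) (c : Color) (e : G.Edge) :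
    G.endpt c (G.rot c e) = G.endpt c e :=
  (Quot.sound (r := fun x y : Color × G.Edge => y = (x.1, G.rot x.1 x.2)) (a := (c, e)) rfl).symm

/-- At most one rotation leads from any half-edge to the chosen representative at its vertex or to a
half-edge with the same next rotation. -/
theorem endpt_halfEdge_vertexAt (c : Color) (e : GridEdge k (n - k)) :
    (gridGraph k n hk).endpt ((GridEdge.vertexAt c e).halfEdge hk).1
      ((GridEdge.vertexAt c e).halfEdge hk).2 = (gridGraph k n hk).endpt c e := by
  have key := endpt_eq_of_rot (gridGraph k n hk)
  rcases c with _ | _ <;> rcases e with i | ⟨i, j⟩ | ⟨i, j⟩ | ⟨i, j⟩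
  · rfl
  · exact key .black (.horiz i j)
  · by_cases h : (i : ℕ) + 1 < k
    · have h1 : (gridGraph k n hk).rot .black (.vert i j) = .horiz ⟨i + 1, h⟩ j := by
        change GridEdge.rotBlack _ = _
        simp [GridEdge.rotBlack, h]
      rw [← key .black (.vert i j), h1, ← key .black (.horiz _ j)]
      simp [GridEdge.vertexAt, h, GridVertex.halfEdge]
      rfl
    · have : i = ⟨k - 1, by omega⟩ := Fin.ext (by simp; omega)
      simp only [GridEdge.vertexAt, h, dite_false, GridVertex.halfEdge]
      rw [this]
  · rfl
  · rfl
  · by_cases h : (j : ℕ) = 0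
    · have h1 : (gridGraph k n hk).rot .white (.horiz i j) = .source i := by
        change GridEdge.rotWhite _ = _
        simp [GridEdge.rotWhite, h]
      rw [← key .white (.horiz i j), h1]
      simp [GridEdge.vertexAt, h, GridVertex.halfEdge]
    · have h1 : (gridGraph k n hk).rot .white (.horiz i j) = .diag i ⟨j - 1, by omega⟩ := by
        change GridEdge.rotWhite _ = _
        simp [GridEdge.rotWhite, h]
      rw [← key .white (.horiz i j), h1]
      simp [GridEdge.vertexAt, h, GridVertex.halfEdge]
  · exact (key .white (.diag i j)).symm
  · rfl

/-- The vertices of the grid are the classes of half-edges. -/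
def gridVertexEquiv : (gridGraph k n hk).Vertex ≃ GridVertex k (n - k) where
  toFun := Quot.lift (fun x => GridEdge.vertexAt x.1 x.2) (by
    rintro ⟨c, e⟩ _ rfl
    exact (vertexAt_rot hk c e).symm)
  invFun v := (gridGraph k n hk).endpt (v.halfEdge hk).1 (v.halfEdge hk).2
  left_inv v := by
    induction v using Quot.ind with
    | mk x => exact endpt_halfEdge_vertexAt hk x.1 x.2
  right_inv v := by
    have hk' : k - 1 + 1 = k := by omega
    cases v <;>
      simp [DiskGraph.endpt, GridVertex.halfEdge, GridEdge.vertexAt, hk']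

@[simp] theorem gridVertexEquiv_endpt (c : Color) (e : GridEdge k (n - k)) :
    gridVertexEquiv hk ((gridGraph k n hk).endpt c e) = GridEdge.vertexAt c e := rfl

theorem grid_endpt_eq_iff {c c' : Color} {e e' : GridEdge k (n - k)} :
    (gridGraph k n hk).endpt c e = (gridGraph k n hk).endpt c' e' ↔
      GridEdge.vertexAt c e = GridEdge.vertexAt c' e' := by
  rw [← (gridVertexEquiv hk).injective.eq_iff]
  rfl

theorem gridVertexEquiv_bdryVertex (t : Fin n) :
    gridVertexEquiv hk ((gridGraph k n hk).bdryVertex t) =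
      if h : (t : ℕ) < k then .rowEnd ⟨t, h⟩ else .colEnd ⟨t - k, by omega⟩ := by
  have hk' : k - 1 + 1 = k := by omega
  change GridEdge.vertexAt .black (if h : (t : ℕ) < k then GridEdge.source ⟨t, h⟩
    else .vert ⟨k - 1, by omega⟩ ⟨t - k, by have := t.isLt; omega⟩) = _
  by_cases h : (t : ℕ) < k <;> simp [h, GridEdge.vertexAt, hk']

theorem grid_isInterior_iff (hkn : k ≤ n) (v : (gridGraph k n hk).Vertex) :
    (gridGraph k n hk).IsInterior v ↔ (gridVertexEquiv hk v).Inner := by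
  have h1 : (gridGraph k n hk).IsInterior v ↔
      ∀ t, gridVertexEquiv hk v ≠ gridVertexEquiv hk ((gridGraph k n hk).bdryVertex t) := by
    simp [DiskGraph.IsInterior]
  rw [h1]
  generalize gridVertexEquiv hk v = w
  simp only [gridVertexEquiv_bdryVertex]
  rcases w with ⟨i, j⟩ | ⟨i, j⟩ | i | i | j <;> simp only [GridVertex.Inner, iff_true, iff_false]
  · intro t; split_ifs <;> simp
  · intro t; split_ifs <;> simp
  · intro t; split_ifs <;> simp
  · push Not
    exact ⟨⟨i, by omega⟩, by simp⟩
  · push Not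
    exact ⟨⟨k + j, by omega⟩, by simp⟩

end Grid

/-! ### Faces of the grid and planarity -/

namespace DiskGraph

variable {n : ℕ} (G : DiskGraph n)

theorem edgeGraph_reachable {F : Finset G.Edge} {e : G.Edge} (he : e ∈ F) :
    (G.edgeGraph F).Reachable (G.endpt .black e) (G.endpt .white e) := by
  by_cases h : G.endpt .black e = G.endpt .white e
  · rw [h]
  · exact SimpleGraph.Adj.reachable
      ((SimpleGraph.fromRel_adj _ _ _).2 ⟨h, .inl ⟨e, he, rfl, rfl⟩⟩)

theorem face_eq_of_isInterior {c : Color} {e e' : G.Edge} (h : G.IsInterior (G.endpt c e))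
    (he : G.rot c e' = e) :
    (Quot.mk _ (c, e) : G.Face) = Quot.mk _ (c.other, e') :=
  Quot.sound (.inl ⟨h, by rw [← he]; simp⟩)

theorem face_outDart (t : Fin n) :
    (Quot.mk _ (G.outDart t) : G.Face) = Quot.mk _ (G.inDart (finRotate n t)) :=
  Quot.sound (.inr ⟨t, rfl, rfl⟩)

end DiskGraph

theorem finRotate_eq_dite {n : ℕ} (t : Fin n) :
    finRotate n t = if h : (t : ℕ) + 1 = n then ⟨0, by omega⟩ else ⟨(t : ℕ) + 1, by omega⟩ := by
  rcases n with _ | n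
  · exact t.elim0
  · refine Fin.ext ?_
    rw [coe_finRotate]
    by_cases h : (t : ℕ) = n <;> simp [Fin.ext_iff, h]

/-- The region on the right-hand side of a directed edge of the grid, given by a row and a column
number; the regions above the first row or to the left of the last column are identified. -/
def gridRegion {k m : ℕ} : Color × GridEdge k m → ℕ × ℕ
  | (.black, .source i) => (i + 1, 0)
  | (.white, .source i) => (i, 0)
  | (.black, .horiz i j) => (i, j)
  | (.white, .horiz i j) => (i + 1, j)
  | (.black, .vert i j) => (i + 1, j + 1)
  | (.white, .vert i j) => (i + 1, j)
  | (.black, .diag i j) => (i + 1, j)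
  | (.white, .diag i j) => (i, j + 1)

/-- The label of a region of the grid. -/
def gridFaceLabel (k m : ℕ) (p : ℕ × ℕ) : Option (Fin k × Fin m) :=
  if h : 0 < p.1 ∧ p.1 ≤ k ∧ p.2 < m then some (⟨p.1 - 1, by omega⟩, ⟨p.2, h.2.2⟩) else none

theorem gridFaceLabel_eq_none {k m : ℕ} {p : ℕ × ℕ} (h : p.1 = 0 ∨ m ≤ p.2) :
    gridFaceLabel k m p = none :=
  dif_neg (by omega)

theorem gridFaceLabel_eq_some {k m : ℕ} (i : Fin k) (j : Fin m) :
    gridFaceLabel k m (i + 1, j) = some (i, j) := by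
  simp [gridFaceLabel]

section Grid

variable {k n : ℕ} (hk : 0 < k)

theorem grid_reachable_edge {F : Finset (GridEdge k (n - k))} {e : GridEdge k (n - k)}
    (he : e ∈ F) : ((gridGraph k n hk).edgeGraph F).Reachable
      ((gridVertexEquiv hk).symm (GridEdge.vertexAt .black e))
      ((gridVertexEquiv hk).symm (GridEdge.vertexAt .white e)) := by
  rw [← gridVertexEquiv_endpt hk, ← gridVertexEquiv_endpt hk, Equiv.symm_apply_apply,
    Equiv.symm_apply_apply]
  exact (gridGraph k n hk).edgeGraph_reachable he

theorem grid_reachable_colEnd (j : Fin (n - k)) : ∀ (d : ℕ) (i : Fin k), (i : ℕ) + 1 + d = k →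
    ((gridGraph k n hk).edgeGraph Finset.univ).Reachable
      ((gridVertexEquiv hk).symm (.white i j)) ((gridVertexEquiv hk).symm (.colEnd j)) := by
  intro d
  induction d with
  | zero =>
    intro i hi
    have := (grid_reachable_edge hk (Finset.mem_univ <| GridEdge.vert i j)).symm
    rwa [show GridEdge.vertexAt .black (.vert i j) = .colEnd j by
      rw [GridEdge.vertexAt, dif_neg (by omega)]] at this
  | succ d ih =>
    intro i hi
    have h := (grid_reachable_edge hk (Finset.mem_univ <| GridEdge.vert i j)).symm
    rw [show GridEdge.vertexAt .black (.vert i j) = .black ⟨i + 1, by omega⟩ j by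
      rw [GridEdge.vertexAt, dif_pos (by omega)]] at h
    exact h.trans ((grid_reachable_edge hk (Finset.mem_univ <| GridEdge.diag ⟨i + 1, by omega⟩ j)).trans (ih ⟨i + 1, by omega⟩ (by simp; omega)))

theorem grid_reachable_bdry (hkn : k ≤ n) (v : (gridGraph k n hk).Vertex) : ∃ t,
    ((gridGraph k n hk).edgeGraph Finset.univ).Reachable v ((gridGraph k n hk).bdryVertex t) := by
  have hcol : ∀ j : Fin (n - k), (gridVertexEquiv hk).symm (.colEnd j) =
      (gridGraph k n hk).bdryVertex ⟨k + j, by omega⟩ := by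
    intro j
    rw [Equiv.symm_apply_eq, gridVertexEquiv_bdryVertex]
    simp
  have hrow : ∀ i : Fin k, (gridVertexEquiv hk).symm (.rowEnd i) =
      (gridGraph k n hk).bdryVertex ⟨i, by omega⟩ := by
    intro i
    rw [Equiv.symm_apply_eq, gridVertexEquiv_bdryVertex]
    simp
  obtain ⟨w, rfl⟩ := (gridVertexEquiv hk).symm.surjective v
  rcases w with ⟨i, j⟩ | ⟨i, j⟩ | i | i | j
  · exact ⟨_, hcol j ▸ (grid_reachable_edge hk (Finset.mem_univ <| GridEdge.diag i j)).trans
      (grid_reachable_colEnd hk j (k - (i + 1)) i (by omega))⟩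
  · exact ⟨_, hcol j ▸ grid_reachable_colEnd hk j (k - (i + 1)) i (by omega)⟩
  · exact ⟨_, hrow i ▸ (grid_reachable_edge hk (Finset.mem_univ <| GridEdge.source i)).symm⟩
  · exact ⟨⟨i, by omega⟩, by rw [hrow i]⟩
  · exact ⟨⟨k + j, by omega⟩, by rw [hcol j]⟩

theorem grid_outDart_row {i : ℕ} (hi : i < k) (h : i < n) :
    @Eq (Color × GridEdge k (n - k)) ((gridGraph k n hk).outDart ⟨i, h⟩)
      (.black, .source ⟨i, hi⟩) :=
  Prod.ext rfl (dif_pos hi)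

theorem grid_inDart_row {i : ℕ} (hi : i < k) (h : i < n) :
    @Eq (Color × GridEdge k (n - k)) ((gridGraph k n hk).inDart ⟨i, h⟩)
      (.white, .source ⟨i, hi⟩) :=
  Prod.ext rfl (dif_pos hi)

theorem grid_outDart_col {j : ℕ} (hj : j < n - k) (h : k + j < n) :
    @Eq (Color × GridEdge k (n - k)) ((gridGraph k n hk).outDart ⟨k + j, h⟩)
      (.black, .vert ⟨k - 1, by omega⟩ ⟨j, hj⟩) := by
  refine Prod.ext rfl ((dif_neg (by simp)).trans ?_)
  simp only [Nat.add_sub_cancel_left]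
  rfl

theorem grid_inDart_col {j : ℕ} (hj : j < n - k) (h : k + j < n) :
    @Eq (Color × GridEdge k (n - k)) ((gridGraph k n hk).inDart ⟨k + j, h⟩)
      (.white, .vert ⟨k - 1, by omega⟩ ⟨j, hj⟩) := by
  refine Prod.ext rfl ((dif_neg (by simp)).trans ?_)
  simp only [Nat.add_sub_cancel_left]
  rfl

/-- Every boundary label belongs to a row or to a column. -/
theorem bdryLabel_cases {P : Fin n → Prop} (hkn : k ≤ n)
    (hrow : ∀ (i : ℕ) (hi : i < k), P ⟨i, by omega⟩)
    (hcol : ∀ (j : ℕ) (hj : j < n - k), P ⟨k + j, by omega⟩) (t : Fin n) : P t := by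
  by_cases h : (t : ℕ) < k
  · exact hrow t h
  · have := hcol (t - k) (by omega)
    have ht : (⟨k + (t - k), by omega⟩ : Fin n) = t := Fin.ext (by simp; omega)
    rwa [ht] at this

variable (hkn : k ≤ n)

include hkn in
-- A face step keeps the pair of region coordinates, except along the outer region, where both
-- labels are `none`. Following the boundary circle from the last column end to the first row end
-- stays in the outer region.
theorem gridFaceLabel_eq_of_faceStep {d d' : Color × GridEdge k (n - k)}
    (h : (gridGraph k n hk).FaceStep d d') :
    gridFaceLabel k (n - k) (gridRegion d) = gridFaceLabel k (n - k) (gridRegion d') := by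
  rcases h with ⟨hint, rfl⟩ | ⟨t, rfl, rfl⟩
  · rw [grid_isInterior_iff hk hkn, gridVertexEquiv_endpt] at hint
    rcases d with ⟨_ | _, i | ⟨i, j⟩ | ⟨i, j⟩ | ⟨i, j⟩⟩
    · exact hint.elim
    · change _ = gridFaceLabel _ _ (gridRegion (.white, GridEdge.rotBlack.symm _))
      by_cases h : (i : ℕ) = 0
      · simp only [GridEdge.rotBlack, Equiv.coe_fn_symm_mk, h, if_true]
        rw [gridFaceLabel_eq_none, gridFaceLabel_eq_none] <;> simp [gridRegion, h]
      · simp only [GridEdge.rotBlack, Equiv.coe_fn_symm_mk, h, if_false]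
        have h' : (i : ℕ) - 1 + 1 = i := by omega
        simp [gridRegion, h']
    · change _ = gridFaceLabel _ _ (gridRegion (.white, GridEdge.rotBlack.symm _))
      by_cases h : (i : ℕ) + 1 < k
      · simp [GridEdge.rotBlack, h, gridRegion]
      · simp only [GridEdge.vertexAt, h, dite_false] at hint
        exact hint.elim
    · rfl
    · change _ = gridFaceLabel _ _ (gridRegion (.black, GridEdge.rotWhite.symm _))
      by_cases h : 0 < n - k
      · simp only [GridEdge.rotWhite, Equiv.coe_fn_symm_mk, h, dite_true]
        rfl
      · simp only [GridEdge.rotWhite, Equiv.coe_fn_symm_mk, h, dite_false]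
        rw [gridFaceLabel_eq_none, gridFaceLabel_eq_none] <;> simp only [gridRegion] <;> omega
    · change _ = gridFaceLabel _ _ (gridRegion (.black, GridEdge.rotWhite.symm _))
      by_cases h : (j : ℕ) = 0
      · simp [GridEdge.rotWhite, h, gridRegion]
      · have h' : (j : ℕ) - 1 + 1 = j := by omega
        simp [GridEdge.rotWhite, h, h', gridRegion]
    · rfl
    · change _ = gridFaceLabel _ _ (gridRegion (.black, GridEdge.rotWhite.symm _))
      by_cases h : (j : ℕ) + 1 < n - k
      · simp [GridEdge.rotWhite, h, gridRegion]
      · simp only [GridEdge.rotWhite, Equiv.coe_fn_symm_mk, h, dite_false]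
        rw [gridFaceLabel_eq_none, gridFaceLabel_eq_none] <;> simp only [gridRegion] <;> omega
  · rw [finRotate_eq_dite]
    induction t using bdryLabel_cases hkn with
    | hrow i hi =>
      erw [grid_outDart_row hk hi]
      by_cases h1 : i + 1 = n
      · erw [dif_pos h1, grid_inDart_row hk hk]
        rw [gridFaceLabel_eq_none, gridFaceLabel_eq_none] <;> simp only [gridRegion] <;> omega
      · erw [dif_neg h1]
        by_cases h2 : i + 1 < k
        · erw [grid_inDart_row hk h2]
          rfl
        · have h3 : k = i + 1 := by omega
          have := grid_inDart_col (n := n) hk (j := 0) (by omega) (by omega)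
          simp only [Nat.add_zero] at this
          simp only [← h3]
          erw [this]
          simp only [gridRegion]
          congr 2
          omega
    | hcol j hj =>
      erw [grid_outDart_col hk hj]
      by_cases h1 : k + j + 1 = n
      · erw [dif_pos h1, grid_inDart_row hk hk]
        rw [gridFaceLabel_eq_none (by simp only [gridRegion]; omega),
          gridFaceLabel_eq_none (by simp [gridRegion])]
      · have h2 : j + 1 < n - k := by omega
        have h3 : k + (j + 1) < n := by omega
        erw [dif_neg h1, grid_inDart_col hk h2 h3]
        rfl

include hkn in
-- These are the face steps needed to connect every directed edge with the representative of its
-- face; together with label invariance they determine the faces exactly.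
theorem gridFace_steps :
    let mk : Color × GridEdge k (n - k) → (gridGraph k n hk).Face := Quot.mk _
    (∀ i j, mk (.black, .diag i j) = mk (.white, .horiz i j)) ∧
    (∀ i j, mk (.white, .vert i j) = mk (.black, .diag i j)) ∧
    (∀ (i : Fin k) (j), (i : ℕ) = 0 → mk (.black, .horiz i j) = mk (.white, .diag i j)) ∧
    (∀ (i : Fin k) (hi : (i : ℕ) + 1 < k) (j),
      mk (.black, .horiz ⟨i + 1, hi⟩ j) = mk (.white, .vert i j)) ∧
    (∀ i (j : Fin (n - k)), (j : ℕ) = 0 → mk (.white, .horiz i j) = mk (.black, .source i)) ∧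
    (∀ i (j : Fin (n - k)) (hj : (j : ℕ) + 1 < n - k),
      mk (.white, .horiz i ⟨j + 1, hj⟩) = mk (.black, .vert i j)) ∧
    (∀ i (j : Fin (n - k)) (hj : (j : ℕ) + 1 < n - k),
      mk (.white, .diag i j) = mk (.black, .horiz i ⟨j + 1, hj⟩)) ∧
    (∀ i (j : Fin (n - k)), ¬ (j : ℕ) + 1 < n - k →
      mk (.white, .diag i j) = mk (.black, .vert i j)) ∧
    (∀ i (h : 0 < n - k), mk (.white, .source i) = mk (.black, .horiz i ⟨0, h⟩)) ∧
    (∀ i, ¬ 0 < n - k → mk (.white, .source i) = mk (.black, .source i)) ∧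
    (∀ (i : Fin k) (hi : (i : ℕ) + 1 < k) (j),
      mk (.black, .vert i j) = mk (.white, .diag ⟨i + 1, hi⟩ j)) ∧
    (∀ (i : Fin k) (j : Fin (n - k)), ¬ (i : ℕ) + 1 < k → ¬ (j : ℕ) + 1 < n - k →
      mk (.black, .vert i j) = mk (.white, .source ⟨0, hk⟩)) ∧
    (∀ (i : Fin k) (hi : (i : ℕ) + 1 < k), mk (.black, .source i) =
      mk (.white, .source ⟨i + 1, hi⟩)) := by
  intro mk
  have key : ∀ (c : Color) (e e' : GridEdge k (n - k)), (GridEdge.vertexAt c e).Inner →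
      (gridGraph k n hk).rot c e' = e → mk (c, e) = mk (c.other, e') := fun c e e' h he =>
    (gridGraph k n hk).face_eq_of_isInterior ((grid_isInterior_iff hk hkn _).2 h) he
  have keyB : ∀ (e e' : GridEdge k (n - k)), (GridEdge.vertexAt .black e).Inner →
      GridEdge.rotBlack e' = e → mk (.black, e) = mk (.white, e') := key .black
  have keyW : ∀ (e e' : GridEdge k (n - k)), 
      GridEdge.rotWhite e' = e → mk (.white, e) = mk (.black, e') := fun e e' =>
    key .white e e' (by
      rcases e with i | ⟨i, j⟩ | ⟨i, j⟩ | ⟨i, j⟩ <;> simp [GridEdge.vertexAt, GridVertex.Inner]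
      split_ifs <;> trivial)
  refine ⟨fun i j => keyB _ _ trivial rfl, fun i j => keyW _ _ rfl,
    fun i j hi => keyB _ _ trivial (by simp [GridEdge.rotBlack, hi]),
    fun i hi j => keyB _ _ trivial (by simp [GridEdge.rotBlack, hi]),
    fun i j hj => keyW _ _ ?_, fun i j hj => keyW _ _ (by simp [GridEdge.rotWhite, hj]),
    fun i j hj => keyW _ _ (by simp [GridEdge.rotWhite]),
    fun i j hj => keyW _ _ (by simp [GridEdge.rotWhite, hj]),
    fun i h => keyW _ _ (by simp [GridEdge.rotWhite]),
    fun i h => keyW _ _ (by simp only [GridEdge.rotWhite, Equiv.coe_fn_mk, h, dite_false]),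
    fun i hi j => keyB _ _ (by simp [GridEdge.vertexAt, hi, GridVertex.Inner])
      (by simp [GridEdge.rotBlack]), fun i j hi hj => ?_, fun i hi => ?_⟩
  · have : 0 < n - k := by omega
    have hj' : j = ⟨0, this⟩ := Fin.ext hj
    simp only [GridEdge.rotWhite, Equiv.coe_fn_mk, this, dite_true, hj']
  · have ht : k + (j : ℕ) < n := by omega
    have := (gridGraph k n hk).face_outDart ⟨k + j, ht⟩
    rw [finRotate_eq_dite, dif_pos (by simp; omega)] at this
    have hi' : i = ⟨k - 1, by omega⟩ := Fin.ext (by simp; omega)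
    rw [hi']
    exact (congrArg mk (grid_outDart_col hk j.2 ht)).symm.trans
      (this.trans (congrArg mk (grid_inDart_row hk hk (by omega))))
  · have := (gridGraph k n hk).face_outDart ⟨i, by omega⟩
    rw [finRotate_eq_dite, dif_neg (by simp; omega)] at this
    exact (congrArg mk (grid_outDart_row hk i.2 (by omega))).symm.trans
      (this.trans (congrArg mk (grid_inDart_row hk hi (by omega))))

/-- A directed edge on the boundary of a face with a given label. -/
def gridFaceDart {m : ℕ} (hk : 0 < k) : Option (Fin k × Fin m) → Color × GridEdge k m
  | none => (.white, .source ⟨0, hk⟩)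
  | some (i, j) => (.white, .vert i j)

include hkn in
theorem gridFace_mk_faceDart (d : Color × GridEdge k (n - k)) :
    (Quot.mk _ (gridFaceDart hk (gridFaceLabel k (n - k) (gridRegion d))) :
      (gridGraph k n hk).Face) = Quot.mk _ d := by
  obtain ⟨h1, h2, h3, h4, h5, h6, h7, h8, h9, h10, h11, h12, h13⟩ := gridFace_steps hk hkn
  set mk : Color × GridEdge k (n - k) → (gridGraph k n hk).Face := Quot.mk _ with hmk
  change mk _ = mk d
  -- Only for m = 0, when every row is a single boundary leaf edge: the one face runs around all of
  -- them.
  have hsrc : ∀ i (hi : i < k), ¬ 0 < n - k →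
      mk (.white, .source ⟨i, hi⟩) = mk (.white, .source ⟨0, hk⟩) := by
    intro i hi hm
    induction i with
    | zero => rfl
    | succ i ih => rw [← ih (by omega), h10 ⟨i, by omega⟩ hm, h13 ⟨i, by omega⟩ hi]
  -- The outer region is followed up its left side, along the last column, and then along its upper
  -- side, the first row. The number `a` counts the steps left to the lower end, respectively the
  -- left end.
  have hvert : ∀ (a : ℕ) (i : Fin k) (j : Fin (n - k)), (i : ℕ) + 1 + a = k →
      ¬ (j : ℕ) + 1 < n - k → mk (.black, .vert i j) = mk (.white, .source ⟨0, hk⟩) := by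
    intro a
    induction a with
    | zero => exact fun i j hi hj => h12 i j (by omega) hj
    | succ a ih =>
      intro i j hi hj
      rw [h11 i (by omega) j, h8 _ j hj]
      exact ih _ j (by simp; omega) hj
  have hdiag : ∀ (i : Fin k) (j : Fin (n - k)), ¬ (j : ℕ) + 1 < n - k →
      mk (.white, .diag i j) = mk (.white, .source ⟨0, hk⟩) := fun i j hj => by
    rw [h8 i j hj, hvert (k - (i + 1)) i j (by omega) hj]
  have hhoriz : ∀ (a : ℕ) (i : Fin k) (j : Fin (n - k)), (j : ℕ) + 1 + a = n - k →
      (i : ℕ) = 0 → mk (.black, .horiz i j) = mk (.white, .source ⟨0, hk⟩) := by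
    intro a
    induction a with
    | zero => exact fun i j hj hi => by rw [h3 i j hi, hdiag i j (by omega)]
    | succ a ih =>
      intro i j hj hi
      rw [h3 i j hi, h7 i j (by omega)]
      exact ih i _ (by simp; omega) hi
  rcases d with ⟨_ | _, i | ⟨i, j⟩ | ⟨i, j⟩ | ⟨i, j⟩⟩
  · simp only [gridRegion]
    by_cases hm : 0 < n - k
    · rw [show ((i : ℕ) + 1, 0) = ((i : ℕ) + 1, ((⟨0, hm⟩ : Fin (n - k)) : ℕ)) from rfl,
        gridFaceLabel_eq_some]
      simp only [gridFaceDart]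
      rw [h2, h1, h5 _ _ rfl]
    · rw [gridFaceLabel_eq_none (by simp; omega)]
      simp only [gridFaceDart]
      rw [← h10 i hm, hsrc i i.2 hm]
  · simp only [gridRegion]
    obtain ⟨i, hi⟩ := i
    rcases i with _ | i
    · rw [gridFaceLabel_eq_none (by simp)]
      exact (hhoriz (n - k - (j + 1)) _ j (by omega) rfl).symm
    · rw [show ((i + 1 : ℕ), (j : ℕ)) = (((⟨i, by omega⟩ : Fin k) : ℕ) + 1, (j : ℕ)) from rfl,
        gridFaceLabel_eq_some]
      exact (h4 ⟨i, by omega⟩ hi j).symm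
  · simp only [gridRegion]
    by_cases hj : (j : ℕ) + 1 < n - k
    · rw [show ((i + 1 : ℕ), (j : ℕ) + 1) = ((i : ℕ) + 1, ((⟨j + 1, hj⟩ : Fin (n - k)) : ℕ)) from rfl,
        gridFaceLabel_eq_some]
      simp only [gridFaceDart]
      rw [h2, h1, h6 i j hj]
    · rw [gridFaceLabel_eq_none (by simp; omega)]
      exact (hvert (k - (i + 1)) i j (by omega) hj).symm
  · simp only [gridRegion]
    rw [gridFaceLabel_eq_some]
    exact h2 i j
  · simp only [gridRegion]
    obtain ⟨i, hi⟩ := i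
    rcases i with _ | i
    · rw [gridFaceLabel_eq_none (by simp)]
      rfl
    · by_cases hm : 0 < n - k
      · rw [show ((i + 1 : ℕ), 0) = (((⟨i, by omega⟩ : Fin k) : ℕ) + 1,
          ((⟨0, hm⟩ : Fin (n - k)) : ℕ)) from rfl, gridFaceLabel_eq_some]
        simp only [gridFaceDart]
        rw [h9 _ hm, h4 ⟨i, by omega⟩ hi]
      · rw [gridFaceLabel_eq_none (by simp; omega)]
        exact (hsrc _ hi hm).symm
  · simp only [gridRegion]
    rw [gridFaceLabel_eq_some]
    simp only [gridFaceDart]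
    rw [h2, h1]
  · simp only [gridRegion]
    rw [gridFaceLabel_eq_some]
    rfl
  · simp only [gridRegion]
    obtain ⟨i, hi⟩ := i
    by_cases hj : (j : ℕ) + 1 < n - k
    · rcases i with _ | i
      · rw [gridFaceLabel_eq_none (by simp), h7 _ _ hj]
        exact (hhoriz (n - k - (j + 1 + 1)) _ _ (by simp; omega) rfl).symm
      · rw [show ((i + 1 : ℕ), (j : ℕ) + 1) = (((⟨i, by omega⟩ : Fin k) : ℕ) + 1,
          ((⟨j + 1, hj⟩ : Fin (n - k)) : ℕ)) from rfl, gridFaceLabel_eq_some]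
        simp only [gridFaceDart]
        rw [h7 _ _ hj, h4 ⟨i, by omega⟩ hi]
    · rw [gridFaceLabel_eq_none (by simp; omega)]
      exact (hdiag _ j hj).symm

/-- The faces of the grid. -/
def gridFaceEquiv : (gridGraph k n hk).Face ≃ Option (Fin k × Fin (n - k)) where
  toFun := Quot.lift (fun d => gridFaceLabel k (n - k) (gridRegion d))
    fun _ _ => gridFaceLabel_eq_of_faceStep hk hkn
  invFun o := Quot.mk _ (gridFaceDart hk o)
  left_inv f := by
    induction f using Quot.ind with
    | mk d => exact gridFace_mk_faceDart hk hkn d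
  right_inv o := by
    rcases o with _ | ⟨i, j⟩
    · exact gridFaceLabel_eq_none (by simp [gridFaceDart, gridRegion])
    · exact gridFaceLabel_eq_some i j

include hkn in
theorem grid_isPlanar : (gridGraph k n hk).IsPlanar := by
  refine ⟨grid_reachable_bdry hk hkn, ?_⟩
  have e1 : {v // (gridGraph k n hk).IsInterior v} ≃
      (Fin k × Fin (n - k)) ⊕ (Fin k × Fin (n - k)) ⊕ Fin k :=
    ((gridVertexEquiv hk).subtypeEquiv (grid_isInterior_iff hk hkn)).trans
      GridVertex.innerEquivSum
  have e2 : Fintype.card (gridGraph k n hk).Edge =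
      Fintype.card (Fin k ⊕ (Fin k × Fin (n - k)) ⊕ (Fin k × Fin (n - k)) ⊕ (Fin k × Fin (n - k))) :=
    Fintype.card_congr GridEdge.equivSum
  -- With m = n - k there are 2km + k interior vertices, km + 1 faces and 3km + k edges.
  rw [Nat.card_congr e1, Nat.card_congr (gridFaceEquiv hk hkn), e2]
  simp
  ring

end Grid

/-! ### Trips and reducedness -/

/-- The boundary label (counted from zero) where the trip through a directed edge of the grid ends.
Trips run in steps to the north-west until they reach the first row or the last column, and then
straight down or to the right. -/
def gridTripEnd {k m : ℕ} : Color × GridEdge k m → ℕ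
  | (.black, .source i) => i
  | (.white, .source i) => if (i : ℕ) < m then k + i else i - m
  | (.black, .horiz i j) => if (i + j : ℕ) < m then k + (i + j) else i + j - m
  | (.white, .horiz i _) => i
  | (.black, .vert _ j) => k + j
  | (.white, .vert i j) => if (i + j + 1 : ℕ) < m then k + (i + j + 1) else i + j + 1 - m
  | (.black, .diag i _) => i
  | (.white, .diag _ j) => k + j

/-- A quantity that decreases along the trips of the grid. -/
def gridTripHeight {k m : ℕ} : Color × GridEdge k m → ℕ
  | (.black, .source _) => 0
  | (.white, .source i) => 2 * k + 2 * m + 2 + (2 * i + 1)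
  | (.black, .horiz i _) => 2 * k + 2 * m + 2 + 2 * i
  | (.white, .horiz _ j) => 2 * j + 1
  | (.black, .vert i _) => 2 * (k - i) - 1
  | (.white, .vert i _) => 2 * k + 2 * m + 2 + (2 * i + 1)
  | (.black, .diag _ j) => 2 * j + 2
  | (.white, .diag i _) => 2 * (k - i)

/-- The next directed edge of a trip in the grid. -/
def gridTripNext {k m : ℕ} : Color × GridEdge k m → Color × GridEdge k m
  | (.black, e) => (.white, GridEdge.rotBlack.symm e)
  | (.white, e) => (.black, GridEdge.rotWhite e)

section Grid

variable {k n : ℕ} (hk : 0 < k)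

theorem gridTripEnd_lt (hkn : k ≤ n) (d : Color × GridEdge k (n - k)) : gridTripEnd d < n := by
  rcases d with ⟨_ | _, i | ⟨i, j⟩ | ⟨i, j⟩ | ⟨i, j⟩⟩ <;> simp only [gridTripEnd] <;>
    first
    | omega
    | split_ifs <;> omega

theorem gridTripEnd_outDart (hkn : k ≤ n) (t : Fin n) :
    gridTripEnd (k := k) (m := n - k) ((gridGraph k n hk).outDart t) = t := by
  induction t using bdryLabel_cases hkn with
  | hrow i hi => erw [grid_outDart_row hk hi]; rfl
  | hcol j hj => erw [grid_outDart_col hk hj]; rfl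

theorem grid_tripNext (d : Color × GridEdge k (n - k)) :
    @Eq (Color × GridEdge k (n - k)) ((gridGraph k n hk).tripNext d) (gridTripNext d) := by
  rcases d with ⟨_ | _, e⟩ <;> rfl

/-- On the staircase part of a trip the sum of the row and column numbers, taken at the horizontal
edges, is constant and decides where the staircase stops. The height falls with the row number
there; the summand 2k + 2m + 2 places the staircase above both straight parts, whose heights count
the remaining steps. -/
theorem grid_tripNext_cases (hkn : k ≤ n) (d : Color × GridEdge k (n - k)) :
    (∃ t, d = (gridGraph k n hk).outDart t) ∨
      (gridTripEnd (gridTripNext d) = gridTripEnd d ∧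
        gridTripHeight (gridTripNext d) < gridTripHeight d) := by
  have hB : ∀ e : GridEdge k (n - k),
      gridTripNext (.black, e) = (.white, GridEdge.rotBlack.symm e) := fun _ => rfl
  have hW : ∀ e : GridEdge k (n - k),
      gridTripNext (.white, e) = (.black, GridEdge.rotWhite e) := fun _ => rfl
  rcases d with ⟨_ | _, i | ⟨i, j⟩ | ⟨i, j⟩ | ⟨i, j⟩⟩
  · exact .inl ⟨⟨i, by omega⟩, (grid_outDart_row hk i.2 (by omega)).symm⟩
  · right
    rw [hB]
    by_cases h : (i : ℕ) = 0
    · have : (GridEdge.rotBlack.symm (.horiz i j) : GridEdge k (n - k)) = .diag i j := by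
        simp [GridEdge.rotBlack, h]
      rw [this]
      simp only [gridTripEnd, gridTripHeight]
      refine ⟨?_, ?_⟩
      · rw [if_pos (by omega)]; omega
      · omega
    · have : (GridEdge.rotBlack.symm (.horiz i j) : GridEdge k (n - k)) =
          .vert ⟨i - 1, by omega⟩ j := by
        simp [GridEdge.rotBlack, h]
      rw [this]
      simp only [gridTripEnd, gridTripHeight]
      refine ⟨?_, by omega⟩
      split_ifs <;> omega
  · by_cases h : (i : ℕ) + 1 < k
    · right
      rw [hB]
      have : (GridEdge.rotBlack.symm (.vert i j) : GridEdge k (n - k)) =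
          .diag ⟨i + 1, h⟩ j := by
        simp [GridEdge.rotBlack, h]
      rw [this]
      simp only [gridTripEnd, gridTripHeight, true_and]
      omega
    · refine .inl ⟨⟨k + j, by omega⟩, ?_⟩
      have hi : i = ⟨k - 1, by omega⟩ := Fin.ext (by simp; omega)
      have := (grid_outDart_col hk j.2 (by omega)).symm
      rwa [← hi] at this
  · right
    rw [hB]
    change gridTripEnd (Color.white, GridEdge.horiz i j) = _ ∧
      gridTripHeight (Color.white, GridEdge.horiz i j) < _
    simp only [gridTripEnd, gridTripHeight, true_and]
    omega
  · right
    rw [hW]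
    by_cases h : 0 < n - k
    · have : (GridEdge.rotWhite (.source i) : GridEdge k (n - k)) = .horiz i ⟨0, h⟩ := by
        simp only [GridEdge.rotWhite, Equiv.coe_fn_mk, h, dite_true]
      rw [this]
      simp only [gridTripEnd, gridTripHeight, Nat.add_zero, true_and]
      omega
    · have : (GridEdge.rotWhite (.source i) : GridEdge k (n - k)) = .source i := by
        simp only [GridEdge.rotWhite, Equiv.coe_fn_mk, h, dite_false]
      rw [this]
      simp only [gridTripEnd, gridTripHeight]
      refine ⟨?_, by omega⟩
      split_ifs <;> omega
  · right
    rw [hW]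
    by_cases h : (j : ℕ) = 0
    · have : (GridEdge.rotWhite (.horiz i j) : GridEdge k (n - k)) = .source i := by
        simp [GridEdge.rotWhite, h]
      rw [this]
      simp only [gridTripEnd, gridTripHeight, true_and]
      omega
    · have : (GridEdge.rotWhite (.horiz i j) : GridEdge k (n - k)) =
          .diag i ⟨j - 1, by omega⟩ := by
        simp [GridEdge.rotWhite, h]
      rw [this]
      simp only [gridTripEnd, gridTripHeight, true_and]
      omega
  · right
    rw [hW]
    by_cases h : (j : ℕ) + 1 < n - k
    · have : (GridEdge.rotWhite (.vert i j) : GridEdge k (n - k)) = .horiz i ⟨j + 1, h⟩ := by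
        simp only [GridEdge.rotWhite, Equiv.coe_fn_mk, h, dite_true]
      rw [this]
      simp only [gridTripEnd, gridTripHeight]
      refine ⟨?_, by omega⟩
      split_ifs <;> omega
    · have : (GridEdge.rotWhite (.vert i j) : GridEdge k (n - k)) = .diag i j := by
        simp only [GridEdge.rotWhite, Equiv.coe_fn_mk, h, dite_false]
      rw [this]
      simp only [gridTripEnd, gridTripHeight]
      refine ⟨?_, by omega⟩
      split_ifs <;> omega
  · right
    rw [hW]
    change gridTripEnd (Color.black, GridEdge.vert i j) = _ ∧
      gridTripHeight (Color.black, GridEdge.vert i j) < _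
    simp only [gridTripEnd, gridTripHeight, true_and]
    omega

theorem grid_tripReaches_end (hkn : k ≤ n) : ∀ (N : ℕ) (d : Color × GridEdge k (n - k)),
    gridTripHeight d ≤ N → (gridGraph k n hk).TripReaches d
      ((gridGraph k n hk).outDart ⟨gridTripEnd d, gridTripEnd_lt hkn d⟩) := by
  intro N
  induction N with
  | zero =>
    intro d hd
    rcases grid_tripNext_cases hk hkn d with ⟨t, rfl⟩ | h
    · refine ⟨0, ?_, by simp⟩
      simp only [Function.iterate_zero, id]
      congr 1
      exact Fin.ext (gridTripEnd_outDart hk hkn t).symm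
    · omega
  | succ N ih =>
    intro d hd
    by_cases hout : ∃ t, d = (gridGraph k n hk).outDart t
    · obtain ⟨t, rfl⟩ := hout
      refine ⟨0, ?_, by simp⟩
      simp only [Function.iterate_zero, id]
      congr 1
      exact Fin.ext (gridTripEnd_outDart hk hkn t).symm
    · obtain ⟨h1, h2⟩ := (grid_tripNext_cases hk hkn d).resolve_left hout
      obtain ⟨r, hr, hr'⟩ := ih (gridTripNext d) (by omega)
      refine ⟨r + 1, ?_, ?_⟩
      · erw [Function.iterate_succ_apply, grid_tripNext hk d, hr]
        congr 1
        exact Fin.ext h1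
      · rintro (_ | s) hs
        · exact fun t ht => hout ⟨t, ht⟩
        · erw [Function.iterate_succ_apply, grid_tripNext hk d]
          exact hr' s (by omega)

/-- Only this necessary condition is used to exclude forbidden crossings: two directed edges of one
trip have the same end, and the later one is strictly lower. -/
theorem grid_tripReaches_imp (hkn : k ≤ n) {d d' : Color × GridEdge k (n - k)}
    (h : (gridGraph k n hk).TripReaches d d') :
    gridTripEnd d' = gridTripEnd d ∧ (d' = d ∨ gridTripHeight d' < gridTripHeight d) := by
  obtain ⟨r, hr, hr'⟩ := h
  induction r generalizing d with
  | zero =>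
    obtain rfl : d = d' := hr
    exact ⟨rfl, .inl rfl⟩
  | succ r ih =>
    obtain ⟨h1, h2⟩ := (grid_tripNext_cases hk hkn d).resolve_left
      fun ⟨t, ht⟩ => hr' 0 (by omega) t ht
    erw [Function.iterate_succ_apply, grid_tripNext hk d] at hr
    obtain ⟨h3, h4⟩ := ih (d := gridTripNext d) hr (fun s hs t => by
        have := hr' (s + 1) (by omega) t
        erw [Function.iterate_succ_apply, grid_tripNext hk d] at this
        exact this)
    refine ⟨h3.trans h1, .inr ?_⟩
    rcases h4 with h4 | h4
    · rw [h4]; exact h2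
    · exact h4.trans h2

theorem grid_isBoundaryLeafEdge_source (hkn : n - k = 0) (i : Fin k) (hi : (i : ℕ) < n) :
    (gridGraph k n hk).IsBoundaryLeafEdge (GridEdge.source i) := by
  refine ⟨⟨i, hi⟩, (Prod.ext_iff.1 (grid_outDart_row hk i.2 hi)).2.symm, ?_⟩
  change GridEdge.rotWhite (.source i) = _
  simp only [GridEdge.rotWhite, Equiv.coe_fn_mk, hkn, lt_irrefl, dite_false]

/-- Ends and heights are explicit, so a double crossing is a system of linear inequalities for each
pair of edge types, and every such system is inconsistent. -/
theorem gridTripEnd_no_double_crossing {m : ℕ} {c₁ c₂ : Color} {e₁ e₂ : GridEdge k m}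
    (h1 : gridTripEnd (c₂, e₂) = gridTripEnd (c₁, e₁))
    (h2 : gridTripHeight (c₂, e₂) < gridTripHeight (c₁, e₁))
    (h3 : gridTripEnd (c₂.other, e₂) = gridTripEnd (c₁.other, e₁)) 
    (h4 : gridTripHeight (c₂.other, e₂) < gridTripHeight (c₁.other, e₁)) : False := by
  rcases c₁ with _ | _ <;> rcases c₂ with _ | _ <;>
    rcases e₁ with i | ⟨i, j⟩ | ⟨i, j⟩ | ⟨i, j⟩ <;>
    rcases e₂ with i' | ⟨i', j'⟩ | ⟨i', j'⟩ | ⟨i', j'⟩ <;>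
    simp only [gridTripEnd, gridTripHeight, Color.other] at h1 h2 h3 h4 <;>
    first
    | omega
    | (split_ifs at h1 h3 <;> omega)

theorem grid_isReduced (hkn : k ≤ n) : (gridGraph k n hk).IsReduced where
  leafless c e hint hleaf := by
    rw [grid_isInterior_iff hk hkn] at hint
    change (GridEdge.vertexAt c e).Inner at hint
    rcases c with _ | _
    · change GridEdge.rotBlack e = e at hleaf
      rcases e with i | ⟨i, j⟩ | ⟨i, j⟩ | ⟨i, j⟩
      · exact hint.elim
      · simp [GridEdge.rotBlack] at hleaf
      · by_cases h : (i : ℕ) + 1 < k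
        · simp [GridEdge.rotBlack, h] at hleaf
        · simp [GridEdge.vertexAt, h, GridVertex.Inner] at hint
      · by_cases h : (i : ℕ) = 0 <;> simp [GridEdge.rotBlack, h] at hleaf
    · change GridEdge.rotWhite e = e at hleaf
      rcases e with i | ⟨i, j⟩ | ⟨i, j⟩ | ⟨i, j⟩
      · by_cases h : 0 < n - k
        · simp only [GridEdge.rotWhite, Equiv.coe_fn_mk, h, dite_true, reduceCtorEq] at hleaf
        · exact grid_isBoundaryLeafEdge_source hk (by omega) i (by omega)
      · by_cases h : (j : ℕ) = 0 <;> simp [GridEdge.rotWhite, h] at hleaf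
      · by_cases h : (j : ℕ) + 1 < n - k <;> simp [GridEdge.rotWhite, h] at hleaf
      · simp [GridEdge.rotWhite] at hleaf
  no_cycle d := ⟨_, grid_tripReaches_end hk hkn _ d le_rfl⟩
  no_self_crossing c e h := by
    -- The two directions of an edge have different ends, except for a source edge when m = 0; that
    -- edge is a boundary leaf, which is the allowed exception.
    have h1 := (grid_tripReaches_imp hk hkn h).1
    rcases c with _ | _ <;> rcases e with i | ⟨i, j⟩ | ⟨i, j⟩ | ⟨i, j⟩ <;>
      simp only [gridTripEnd, Color.other] at h1 <;>
      first
      | omega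
      | (exfalso; split_ifs at h1 <;> omega)
      | exact grid_isBoundaryLeafEdge_source hk (by split_ifs at h1 <;> omega) i (by omega)
  no_double_crossing c₁ e₁ c₂ e₂ he h h' := by
    obtain ⟨h1, h2⟩ := grid_tripReaches_imp hk hkn h
    obtain ⟨h3, h4⟩ := grid_tripReaches_imp hk hkn h'
    have hne : ∀ c c' : Color, ((c, e₂) : Color × GridEdge k (n - k)) ≠ (c', e₁) :=
      fun c c' hc => he (Prod.ext_iff.1 hc).2.symm
    exact gridTripEnd_no_double_crossing h1 (h2.resolve_left (hne _ _)) h3 (h4.resolve_left (hne _ _))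

theorem grid_hasBoundedAffinePerm (hkn : k ≤ n) :
    (gridGraph k n hk).HasBoundedAffinePerm (fun a => a + k) where
  bijective := (Equiv.addRight (k : ℤ)).bijective
  periodic a := by ring
  bounded a := by omega
  trip t := by
    refine ⟨_, grid_tripReaches_end hk hkn _ _ le_rfl, ?_⟩
    rw [Int.modEq_iff_dvd]
    induction t using bdryLabel_cases hkn with
    | hrow i hi =>
      have : gridTripEnd (k := k) (m := n - k) ((gridGraph k n hk).inDart ⟨i, by omega⟩) =
          if i < n - k then k + i else i - (n - k) := by
        erw [grid_inDart_row hk hi]; rfl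
      simp only [this]
      split_ifs
      · exact ⟨0, by push_cast; ring⟩
      -- The staircase meets the last column and the trip ends in the row t - m, which is t + k - n:
      -- one subtraction of n.
      · exact ⟨-1, by push_cast [show n - k ≤ i by omega, hkn]; ring⟩
    | hcol j hj =>
      have : gridTripEnd (k := k) (m := n - k) ((gridGraph k n hk).inDart ⟨k + j, by omega⟩) =
          if k - 1 + j + 1 < n - k then k + (k - 1 + j + 1) else k - 1 + j + 1 - (n - k) := by
        erw [grid_inDart_col hk hj]; rfl
      simp only [this]
      rw [show k - 1 + j + 1 = k + j by omega]
      split_ifs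
      · exact ⟨0, by push_cast; ring⟩
      · exact ⟨-1, by push_cast [show n - k ≤ k + j by omega, hkn]; ring⟩
  black_leaf t h := by omega
  white_leaf _ _ := rfl

end Grid

/-! ### Almost perfect matchings as local conditions -/

theorem existsUnique_mem_and_eq_or {α : Type*} [DecidableEq α] {M : Finset α} {a b : α}
    {P : α → Prop} (hP : ∀ e, P e ↔ e = a ∨ e = b) (hab : a ≠ b) :
    (∃! e, e ∈ M ∧ P e) ↔ (if a ∈ M then 1 else 0 : ℤ) + (if b ∈ M then 1 else 0) = 1 := by
  simp only [hP]
  by_cases ha : a ∈ M <;> by_cases hb : b ∈ M <;> simp only [ha, hb, if_true, if_false]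
  · norm_num
    rintro ⟨e, -, h⟩
    exact hab ((h a ⟨ha, .inl rfl⟩).trans (h b ⟨hb, .inr rfl⟩).symm)
  · norm_num
    refine ⟨a, ⟨ha, .inl rfl⟩, ?_⟩
    rintro e ⟨he, rfl | rfl⟩
    · rfl
    · exact absurd he hb
  · norm_num
    refine ⟨b, ⟨hb, .inr rfl⟩, ?_⟩
    rintro e ⟨he, rfl | rfl⟩
    · exact absurd he ha
    · rfl
  · norm_num
    rintro ⟨e, ⟨he, rfl | rfl⟩, -⟩
    · exact ha he
    · exact hb he

theorem existsUnique_mem_and_eq_or_or {α : Type*} [DecidableEq α] {M : Finset α} {a b c : α}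
    {P : α → Prop} (hP : ∀ e, P e ↔ e = a ∨ e = b ∨ e = c) (hab : a ≠ b) (hac : a ≠ c)
    (hbc : b ≠ c) :
    (∃! e, e ∈ M ∧ P e) ↔ (if a ∈ M then 1 else 0 : ℤ) + (if b ∈ M then 1 else 0) +
      (if c ∈ M then 1 else 0) = 1 := by
  by_cases hc : c ∈ M
  · simp only [hc, if_true]
    constructor
    · rintro ⟨e, -, h⟩
      have h1 := h c ⟨hc, (hP c).2 (.inr (.inr rfl))⟩
      have ha : a ∉ M := fun ha => hac ((h a ⟨ha, (hP a).2 (.inl rfl)⟩).trans h1.symm)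
      have hb : b ∉ M := fun hb => hbc ((h b ⟨hb, (hP b).2 (.inr (.inl rfl))⟩).trans h1.symm)
      simp [ha, hb]
    · intro h
      have ha : a ∉ M := fun ha => by simp [ha] at h; split_ifs at h <;> omega
      have hb : b ∉ M := fun hb => by simp [hb] at h; split_ifs at h <;> omega
      refine ⟨c, ⟨hc, (hP c).2 (.inr (.inr rfl))⟩, ?_⟩
      rintro e ⟨he, he'⟩
      rcases (hP e).1 he' with rfl | rfl | rfl
      · exact absurd he ha
      · exact absurd he hb
      · rfl
  · simp only [hc, if_false, add_zero]
    rw [← existsUnique_mem_and_eq_or (P := fun e => e = a ∨ e = b) (fun e => Iff.rfl) hab]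
    refine existsUnique_congr fun e => ?_
    rw [hP]
    constructor
    · rintro ⟨h, h1 | h1 | h1⟩
      · exact ⟨h, .inl h1⟩
      · exact ⟨h, .inr h1⟩
      · exact absurd (h1 ▸ h) hc
    · rintro ⟨h, h1 | h1⟩
      · exact ⟨h, .inl h1⟩
      · exact ⟨h, .inr (.inl h1)⟩

theorem DiskGraph.mem_bdrySubset_of_black {n : ℕ} (G : DiskGraph n) {t : Fin n}
    (ht : G.bdryColor t = .black) (M : Finset G.Edge) :
    t ∈ G.bdrySubset M ↔ G.bdryEdge t ∈ M := by
  simp [bdrySubset, ht]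

namespace GridEdge

variable {k m : ℕ} (M : Finset (GridEdge k m))

/-- The indicator of the horizontal edges of a set. -/
def horizBit (i : Fin k) (j : ℕ) : ℤ :=
  if h : j < m then (if horiz i ⟨j, h⟩ ∈ M then 1 else 0) else 0

/-- The indicator of the vertical edges of a set, counted by the row below the edge. -/
def vertBit (i : ℕ) (j : Fin m) : ℤ :=
  if h : 0 < i ∧ i ≤ k then (if vert ⟨i - 1, by omega⟩ j ∈ M then 1 else 0) else 0

/-- The conditions for an almost perfect matching of the grid, vertex by vertex. -/
structure IsLocalMatching : Prop where
  black : ∀ i j, (if diag i j ∈ M then 1 else 0) + horizBit M i j + vertBit M i j = 1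
  white : ∀ i j, (if diag i j ∈ M then 1 else 0) + vertBit M (i + 1) j + horizBit M i (j + 1) = 1
  extra : ∀ i, (if source i ∈ M then 1 else 0) + horizBit M i 0 = 1

end GridEdge

section Grid

open GridEdge

variable {k n : ℕ} (hk : 0 < k)

theorem grid_existsUnique_black {m : ℕ} (M : Finset (GridEdge k m)) (i : Fin k) (j : Fin m) :
    (∃! e, e ∈ M ∧ ∃ c, vertexAt c e = .black i j) ↔
      (if diag i j ∈ M then 1 else 0) + horizBit M i j + vertBit M i j = 1 := by
  have h2 : horizBit M i j = if horiz i j ∈ M then 1 else 0 := by simp [horizBit]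
  rw [h2]
  by_cases hi : (i : ℕ) = 0
  · have h1 : vertBit M i j = 0 := dif_neg (by omega)
    rw [h1, add_zero]
    refine existsUnique_mem_and_eq_or (fun e => ?_) (by simp)
    constructor
    · rintro ⟨c, hc⟩
      rcases c with _ | _ <;> rcases e with i' | ⟨i', j'⟩ | ⟨i', j'⟩ | ⟨i', j'⟩ <;>
        simp [vertexAt] at hc ⊢
      · exact hc
      · split_ifs at hc
        simp [Fin.ext_iff] at hc
        omega
      · exact hc
      · split_ifs at hc
    · rintro (rfl | rfl) <;> exact ⟨.black, rfl⟩
  · have h1 : vertBit M i j = if vert ⟨i - 1, by omega⟩ j ∈ M then 1 else 0 :=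
      dif_pos (by omega)
    rw [h1]
    refine existsUnique_mem_and_eq_or_or (fun e => ?_) (by simp) (by simp) (by simp)
    constructor
    · rintro ⟨c, hc⟩
      rcases c with _ | _ <;> rcases e with i' | ⟨i', j'⟩ | ⟨i', j'⟩ | ⟨i', j'⟩ <;>
        simp [vertexAt] at hc ⊢
      · exact hc
      · split_ifs at hc
        simp [Fin.ext_iff] at hc ⊢
        omega
      · exact hc
      · split_ifs at hc
    · rintro (rfl | rfl | rfl)
      · exact ⟨.black, rfl⟩
      · exact ⟨.black, rfl⟩
      · refine ⟨.black, ?_⟩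
        have : (i : ℕ) - 1 + 1 = i := by omega
        simp [vertexAt, this]

theorem grid_existsUnique_white {m : ℕ} (M : Finset (GridEdge k m)) (i : Fin k) (j : Fin m) :
    (∃! e, e ∈ M ∧ ∃ c, vertexAt c e = .white i j) ↔
      (if diag i j ∈ M then 1 else 0) + vertBit M (i + 1) j + horizBit M i (j + 1) = 1 := by
  have h2 : vertBit M (i + 1) j = if vert i j ∈ M then 1 else 0 := by
    rw [vertBit, dif_pos (by omega)]
    simp
  rw [h2]
  by_cases hj : (j : ℕ) + 1 < m
  · have h1 : horizBit M i (j + 1) = if horiz i ⟨j + 1, hj⟩ ∈ M then 1 else 0 := dif_pos hj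
    rw [h1]
    refine existsUnique_mem_and_eq_or_or (fun e => ?_) (by simp) (by simp) (by simp)
    constructor
    · rintro ⟨c, hc⟩
      rcases c with _ | _ <;> rcases e with i' | ⟨i', j'⟩ | ⟨i', j'⟩ | ⟨i', j'⟩ <;>
        simp [vertexAt] at hc ⊢
      · split_ifs at hc
      · split_ifs at hc
        simp [Fin.ext_iff] at hc ⊢
        omega
      · exact hc
      · exact hc
    · rintro (rfl | rfl | rfl)
      · exact ⟨.white, rfl⟩
      · exact ⟨.white, rfl⟩
      · exact ⟨.white, by simp [vertexAt]⟩
  · have h1 : horizBit M i (j + 1) = 0 := dif_neg hj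
    rw [h1, add_zero]
    refine existsUnique_mem_and_eq_or (fun e => ?_) (by simp)
    constructor
    · rintro ⟨c, hc⟩
      rcases c with _ | _ <;> rcases e with i' | ⟨i', j'⟩ | ⟨i', j'⟩ | ⟨i', j'⟩ <;>
        simp [vertexAt] at hc ⊢
      · split_ifs at hc
      · split_ifs at hc
        simp [Fin.ext_iff] at hc
        omega
      · exact hc
      · exact hc
    · rintro (rfl | rfl) <;> exact ⟨.white, rfl⟩

theorem grid_existsUnique_extra {m : ℕ} (M : Finset (GridEdge k m)) (i : Fin k) :
    (∃! e, e ∈ M ∧ ∃ c, vertexAt c e = .extra i) ↔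
      (if source i ∈ M then 1 else 0) + horizBit M i 0 = 1 := by
  by_cases hm : 0 < m
  · have h1 : horizBit M i 0 = if horiz i ⟨0, hm⟩ ∈ M then 1 else 0 := dif_pos hm
    rw [h1]
    refine existsUnique_mem_and_eq_or (fun e => ?_) (by simp)
    constructor
    · rintro ⟨c, hc⟩
      rcases c with _ | _ <;> rcases e with i' | ⟨i', j'⟩ | ⟨i', j'⟩ | ⟨i', j'⟩ <;>
        simp [vertexAt] at hc ⊢
      · split_ifs at hc
      · exact hc
      · split_ifs at hc
        simp [Fin.ext_iff] at hc ⊢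
        omega
    · rintro (rfl | rfl)
      · exact ⟨.white, rfl⟩
      · exact ⟨.white, by simp [vertexAt]⟩
  · have h1 : horizBit M i 0 = 0 := dif_neg hm
    have hP : ∀ e : GridEdge k m, (∃ c, vertexAt c e = .extra i) ↔ e = source i := by
      intro e
      constructor
      · rintro ⟨c, hc⟩
        rcases c with _ | _ <;> rcases e with i' | ⟨i', j'⟩ | ⟨i', j'⟩ | ⟨i', j'⟩ <;>
          simp [vertexAt] at hc ⊢
        · split_ifs at hc
        · exact hc
        · exact absurd j'.2 (by omega)
      · rintro rfl
        exact ⟨.white, rfl⟩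
    simp only [hP, h1, add_zero]
    constructor
    · rintro ⟨e, ⟨he, rfl⟩, -⟩
      simp [he]
    · intro h
      have : source i ∈ M := by
        by_contra h'
        simp [h'] at h
      exact ⟨_, ⟨this, rfl⟩, fun e he => he.2⟩

theorem grid_isAlmostPerfectMatching_iff (hkn : k ≤ n) (M : Finset (GridEdge k (n - k))) :
    (gridGraph k n hk).IsAlmostPerfectMatching M ↔ IsLocalMatching M := by
  have h0 : (gridGraph k n hk).IsAlmostPerfectMatching M ↔ ∀ w : GridVertex k (n - k), w.Inner →
      ∃! e, e ∈ M ∧ ∃ c, vertexAt c e = w := by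
    rw [← (gridVertexEquiv hk).forall_congr_right]
    refine forall_congr' fun v => ?_
    rw [grid_isInterior_iff hk hkn]
    refine imp_congr_right fun _ => existsUnique_congr fun e => ?_
    refine and_congr_right fun _ => exists_congr fun c => ?_
    rw [← (gridVertexEquiv hk).injective.eq_iff]
    rfl
  rw [h0]
  constructor
  · exact fun h => ⟨fun i j => (grid_existsUnique_black M i j).1 (h _ trivial),
      fun i j => (grid_existsUnique_white M i j).1 (h _ trivial),
      fun i => (grid_existsUnique_extra M i).1 (h _ trivial)⟩
  · rintro ⟨h1, h2, h3⟩ (⟨i, j⟩ | ⟨i, j⟩ | i | i | j) hw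
    · exact (grid_existsUnique_black M i j).2 (h1 i j)
    · exact (grid_existsUnique_white M i j).2 (h2 i j)
    · exact (grid_existsUnique_extra M i).2 (h3 i)
    · exact hw.elim
    · exact hw.elim

theorem mem_grid_bdrySubset_row (M : Finset (GridEdge k (n - k))) {i : ℕ} (hi : i < k)
    (h : i < n) : (⟨i, h⟩ : Fin n) ∈ (gridGraph k n hk).bdrySubset M ↔ source ⟨i, hi⟩ ∈ M := by
  have h1 : @Eq (GridEdge k (n - k)) ((gridGraph k n hk).bdryEdge ⟨i, h⟩) (source ⟨i, hi⟩) :=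
    (Prod.ext_iff.1 (grid_outDart_row hk hi h)).2
  have h2 : (gridGraph k n hk).bdryColor ⟨i, h⟩ = .black := rfl
  exact ((gridGraph k n hk).mem_bdrySubset_of_black h2 M).trans (Iff.of_eq (congrArg (· ∈ M) h1))

theorem mem_grid_bdrySubset_col (M : Finset (GridEdge k (n - k))) {j : ℕ} (hj : j < n - k)
    (h : k + j < n) : (⟨k + j, h⟩ : Fin n) ∈ (gridGraph k n hk).bdrySubset M ↔
      vert ⟨k - 1, by omega⟩ ⟨j, hj⟩ ∈ M := by
  have h1 : @Eq (GridEdge k (n - k)) ((gridGraph k n hk).bdryEdge ⟨k + j, h⟩)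
      (vert ⟨k - 1, by omega⟩ ⟨j, hj⟩) :=
    (Prod.ext_iff.1 (grid_outDart_col hk hj h)).2
  have h2 : (gridGraph k n hk).bdryColor ⟨k + j, h⟩ = .black := rfl
  exact ((gridGraph k n hk).mem_bdrySubset_of_black h2 M).trans (Iff.of_eq (congrArg (· ∈ M) h1))

end Grid

/-! ### Disjoint paths in one row -/

/-- The number of paths on the horizontal edge before position `j` of a row with source `s`, when
paths enter the row from above at `J` and leave it below at `J'`. -/
def rowFlow (s : ℤ) (J J' : Finset ℕ) : ℕ → ℤ
  | 0 => s
  | j + 1 => rowFlow s J J' j + (if j ∈ J then 1 else 0) - (if j ∈ J' then 1 else 0)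

/-- The first `j` positions of a row carry disjoint paths, `a` of which go on to the position `j`. -/
def RowOK (s : ℤ) (J J' : Finset ℕ) (j : ℕ) (a : ℤ) : Prop :=
  (∀ i < j, 0 ≤ rowFlow s J J' i ∧ rowFlow s J J' i + (if i ∈ J then 1 else 0) ≤ 1) ∧
    rowFlow s J J' j = a

theorem rowFlow_congr {s : ℤ} {J₁ J₂ J' : Finset ℕ} {j : ℕ} (h : ∀ i < j, (i ∈ J₁ ↔ i ∈ J₂)) :
    rowFlow s J₁ J' j = rowFlow s J₂ J' j := by
  induction j with
  | zero => rfl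
  | succ j ih =>
    simp only [rowFlow, ih fun i hi => h i (by omega), h j (by omega)]

theorem rowOK_congr {s : ℤ} {J₁ J₂ J' : Finset ℕ} {j : ℕ} {a : ℤ}
    (h : ∀ i < j, (i ∈ J₁ ↔ i ∈ J₂)) : RowOK s J₁ J' j a ↔ RowOK s J₂ J' j a := by
  unfold RowOK
  rw [rowFlow_congr h]
  refine and_congr_left fun _ => forall₂_congr fun i hi => ?_
  rw [rowFlow_congr fun i' hi' => h i' (by omega), if_congr (h i hi) rfl rfl]

theorem rowOK_succ {s : ℤ} {J J' : Finset ℕ} {j : ℕ} {a : ℤ} :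
    RowOK s J J' (j + 1) a ↔
      ∃ b, RowOK s J J' j b ∧ 0 ≤ b ∧ b + (if j ∈ J then 1 else 0) ≤ 1 ∧
        b + (if j ∈ J then 1 else 0) - (if j ∈ J' then 1 else 0) = a := by
  constructor
  · rintro ⟨h, ha⟩
    exact ⟨_, ⟨fun i hi => h i (by omega), rfl⟩, (h j (by omega)).1, (h j (by omega)).2, ha⟩
  · rintro ⟨b, ⟨h, rfl⟩, h1, h2, h3⟩
    refine ⟨fun i hi => ?_, h3⟩
    rcases Nat.lt_succ_iff_lt_or_eq.1 hi with hi | rfl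
    · exact h i hi
    · exact ⟨h1, h2⟩

/-- Flow conservation along the row: what starts in it or enters it from above leaves it below. -/
theorem rowOK_card {s : ℤ} {J J' : Finset ℕ} {m : ℕ} (hJ : J ⊆ Finset.range m)
    (hJ' : J' ⊆ Finset.range m) (h : RowOK s J J' m 0) : s + J.card = J'.card := by
  have key : ∀ j, rowFlow s J J' j =
      s + (J ∩ Finset.range j).card - (J' ∩ Finset.range j).card := by
    intro j
    induction j with
    | zero => simp [rowFlow]
    | succ j ih =>
      have : ∀ K : Finset ℕ, ((K ∩ Finset.range (j + 1)).card : ℤ) =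
          (K ∩ Finset.range j).card + if j ∈ K then 1 else 0 := by
        intro K
        by_cases hj : j ∈ K
        · rw [Finset.range_add_one, Finset.inter_insert_of_mem hj, Finset.card_insert_of_notMem]
          · simp [hj]
          · simp
        · rw [Finset.range_add_one, Finset.inter_insert_of_notMem hj]
          simp [hj]
      rw [rowFlow, ih, this, this]
      ring
  have h1 := h.2
  rw [key, Finset.inter_eq_left.2 hJ, Finset.inter_eq_left.2 hJ'] at h1
  omega

/-- The product of the `x i`, `i < j`, that belong to `J`, in increasing order. -/
def orderedProd {R : Type*} [Monoid R] (x : ℕ → R) (J : Finset ℕ) : ℕ → R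
  | 0 => 1
  | j + 1 => orderedProd x J j * if j ∈ J then x j else 1

theorem orderedProd_congr {R : Type*} [Monoid R] {x y : ℕ → R} {J₁ J₂ : Finset ℕ} {j : ℕ}
    (h : ∀ i < j, (i ∈ J₁ ↔ i ∈ J₂)) (hx : ∀ i < j, x i = y i) :
    orderedProd x J₁ j = orderedProd y J₂ j := by
  induction j with
  | zero => rfl
  | succ j ih =>
    rw [orderedProd, orderedProd, ih (fun i hi => h i (by omega)) fun i hi => hx i (by omega),
      if_congr (h j (by omega)) (hx j (by omega)) rfl]

section Transfer

open Classical in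
/-- The sum over the sets of entry points of a row, weighted by the paths that reach position `j`. -/
noncomputable def rowSum {Λ : Type*} [Ring Λ] (ρ : Λ) (κ : ℕ → Λ)
    (J' : Finset ℕ) (j : ℕ) (a : ℤ) : Λ :=
  ∑ J ∈ (Finset.range j).powerset, ∑ s ∈ Finset.range 2,
    if RowOK s J J' j a then ρ ^ s * orderedProd κ J j else 0

variable {Λ : Type*} [Ring Λ] (ρ : Λ) (κ : ℕ → Λ) (J' : Finset ℕ)

open Classical in
-- At position `j` at most one path may be present. If an exit is prescribed there, the path
-- arriving along the row or from above must take it and none goes on; otherwise it goes on.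
-- Splitting the entry sets by whether they contain `j` gives the cases.
theorem rowSum_succ (j : ℕ) (a : ℤ) (ha : 0 ≤ a) (ha' : a ≤ 1) :
    rowSum ρ κ J' (j + 1) a =
      if j ∈ J' then
        if a = 0 then rowSum ρ κ J' j 1 + rowSum ρ κ J' j 0 * κ j else 0
      else
        if a = 0 then rowSum ρ κ J' j 0
        else rowSum ρ κ J' j 1 + rowSum ρ κ J' j 0 * κ j := by
  have h0 : rowSum ρ κ J' (j + 1) a =
      (∑ J ∈ (Finset.range j).powerset, ∑ s ∈ Finset.range 2,
        if RowOK s J J' (j + 1) a then ρ ^ s * orderedProd κ J j else 0) +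
      ∑ J ∈ (Finset.range j).powerset, ∑ s ∈ Finset.range 2,
        if RowOK s (insert j J) J' (j + 1) a then ρ ^ s * orderedProd κ J j * κ j else 0 := by
    rw [rowSum, Finset.range_add_one, Finset.sum_powerset_insert (by simp)]
    congr 1
    · refine Finset.sum_congr rfl fun J hJ => Finset.sum_congr rfl fun s _ => ?_
      have hj : j ∉ J := fun h => by simpa using Finset.mem_powerset.1 hJ h
      rw [orderedProd, if_neg hj, mul_one]
    · refine Finset.sum_congr rfl fun J hJ => Finset.sum_congr rfl fun s _ => ?_
      rw [orderedProd, if_pos (Finset.mem_insert_self _ _), ← mul_assoc,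
        orderedProd_congr (J₁ := insert j J) (J₂ := J) (y := κ) (fun i hi => by
          simp [hi.ne]) (fun _ _ => rfl)]
  have h1 : ∀ J ∈ (Finset.range j).powerset, ∀ s ∈ Finset.range 2,
      (RowOK s J J' (j + 1) a ↔ if j ∈ J' then a = 0 ∧ RowOK s J J' j 1 else RowOK s J J' j a) := by
    intro J hJ s hs
    have hj : j ∉ J := fun h => by simpa using Finset.mem_powerset.1 hJ h
    have hs' : (s : ℤ) ≤ 1 := by have := Finset.mem_range.1 hs; omega
    rw [rowOK_succ, if_neg hj]
    by_cases hj' : j ∈ J'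
    · simp only [hj', if_true]
      constructor
      · rintro ⟨b, hb, h1, h2, h3⟩
        obtain rfl : b = a + 1 := by omega
        obtain rfl : a = 0 := by omega
        exact ⟨rfl, hb⟩
      · rintro ⟨rfl, h⟩
        exact ⟨1, h, by omega, by omega, by omega⟩
    · simp only [hj', if_false]
      constructor
      · rintro ⟨b, hb, h1, h2, h3⟩
        obtain rfl : b = a := by omega
        exact hb
      · intro h
        exact ⟨a, h, by omega, by omega, by omega⟩
  have h2 : ∀ J ∈ (Finset.range j).powerset, ∀ s ∈ Finset.range 2,
      (RowOK s (insert j J) J' (j + 1) a ↔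
        if j ∈ J' then a = 0 ∧ RowOK s J J' j 0 else a = 1 ∧ RowOK s J J' j 0) := by
    intro J hJ s hs
    rw [rowOK_succ, if_pos (Finset.mem_insert_self _ _)]
    have hc : ∀ b, RowOK (s : ℤ) (insert j J) J' j b ↔ RowOK s J J' j b := fun b =>
      rowOK_congr fun i hi => by simp [hi.ne]
    by_cases hj' : j ∈ J'
    · simp only [hj', if_true]
      constructor
      · rintro ⟨b, hb, h1, h2, h3⟩
        obtain rfl : b = 0 := by omega
        exact ⟨by omega, (hc _).1 hb⟩
      · rintro ⟨rfl, h⟩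
        exact ⟨0, (hc _).2 h, by omega, by omega, by omega⟩
    · simp only [hj', if_false]
      constructor
      · rintro ⟨b, hb, h1, h2, h3⟩
        obtain rfl : b = 0 := by omega
        exact ⟨by omega, (hc _).1 hb⟩
      · rintro ⟨rfl, h⟩
        exact ⟨0, (hc _).2 h, by omega, by omega, by omega⟩
  rw [h0, Finset.sum_congr rfl fun J hJ => Finset.sum_congr rfl fun s hs =>
      if_congr (h1 J hJ s hs) rfl rfl,
    Finset.sum_congr rfl fun J hJ => Finset.sum_congr rfl fun s hs =>
      if_congr (h2 J hJ s hs) rfl rfl]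
  have hmul : rowSum ρ κ J' j 0 * κ j = ∑ J ∈ (Finset.range j).powerset,
      ∑ s ∈ Finset.range 2, if RowOK s J J' j 0 then ρ ^ s * orderedProd κ J j * κ j else 0 := by
    simp only [rowSum, Finset.sum_mul, ite_mul, zero_mul]
  rw [hmul]
  by_cases hj' : j ∈ J'
  · by_cases ha0 : a = 0
    · simp [hj', ha0, rowSum]
    · simp [hj', ha0]
  · by_cases ha0 : a = 0
    · simp [hj', ha0, rowSum]
    · obtain rfl : a = 1 := by omega
      simp [hj', rowSum]

/-- Columns that are partial sums of the vectors `ρ, κ 0, κ 1, …` expand into products of these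
vectors along the disjoint paths of a row. -/
theorem orderedProd_partialSum {L : Type*} [CommRing L] [Algebra L Λ] (v : ℕ → L) (R : ℕ → Λ) (hR0 : R 0 = ρ)
    (hR : ∀ j, R (j + 1) = R j + κ j) (hsq : ∀ j, R j * R j = 0) (j : ℕ) :
    orderedProd (fun j => v j • R (j + 1)) J' j =
        (∏ i ∈ Finset.range j with i ∈ J', v i) • rowSum ρ κ J' j 0 ∧
      orderedProd (fun j => v j • R (j + 1)) J' j * R j =
        (∏ i ∈ Finset.range j with i ∈ J', v i) • rowSum ρ κ J' j 1 := by
  induction j with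
  | zero => simp [orderedProd, rowSum, RowOK, rowFlow, hR0]
  | succ j ih =>
    obtain ⟨ih0, ih1⟩ := ih
    rw [rowSum_succ _ _ _ _ _ le_rfl zero_le_one, rowSum_succ _ _ _ _ _ zero_le_one le_rfl]
    have hf : (∏ i ∈ Finset.range (j + 1) with i ∈ J', v i) =
        (∏ i ∈ Finset.range j with i ∈ J', v i) * if j ∈ J' then v j else 1 := by
      rw [Finset.range_add_one, Finset.filter_insert]
      split_ifs
      · rw [Finset.prod_insert (by simp), mul_comm]
      · rw [mul_one]
    have hs : orderedProd (fun j => v j • R (j + 1)) J' j * R (j + 1) =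
        (∏ i ∈ Finset.range j with i ∈ J', v i) •
          (rowSum ρ κ J' j 1 + rowSum ρ κ J' j 0 * κ j) := by
      rw [hR, mul_add, ih1, smul_add, ih0, smul_mul_assoc]
    rw [hf, orderedProd]
    by_cases hj : j ∈ J'
    · simp only [hj, if_true, one_ne_zero, if_false, smul_zero]
      rw [mul_smul_comm, hs, smul_smul, mul_comm (v j)]
      refine ⟨rfl, ?_⟩
      -- Once the factor R (j + 1) has been used, a second one gives zero: a path that leaves at `j`
      -- does not also go on, and a second path cannot pass.
      rw [mul_smul, smul_comm, ← hs, smul_mul_assoc, mul_assoc, hsq, mul_zero, smul_zero]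
    · simp only [hj, if_true, if_false, mul_one, one_ne_zero]
      exact ⟨ih0, hs⟩

end Transfer

/-! ### Maximal minors of the network matrix as sums over path families -/

/-- The columns of the network matrix of the first rows of the grid: in row `i` a path from the source
`ε i` or from above at position `j` may leave the row at any position `b ≥ j`, with weight `v i b`. -/
def gridColumn {L W : Type*} [CommRing L] [AddCommGroup W] [Module L W] (v : ℕ → ℕ → L)
    (ε : ℕ → W) : ℕ → ℕ → W
  | 0, _ => 0
  | i + 1, b => v i b • (ε i - ∑ j ∈ Finset.range (b + 1), gridColumn v ε i j)

open Classical in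
/-- The sum over the disjoint path families in the first rows of the grid that start at the sources
outside `A` and leave the last of these rows at the given positions. -/
noncomputable def gridSum {L : Type*} [CommRing L] (v : ℕ → ℕ → L) (m : ℕ) (A : Finset ℕ) :
    ℕ → Finset ℕ → L
  | 0, J => if J = ∅ then 1 else 0
  | i + 1, J' => (∏ b ∈ J', v i b) * ∑ J ∈ (Finset.range m).powerset,
      if RowOK (if i ∈ A then 0 else 1) J J' m 0 then gridSum v m A i J else 0

/-- Exactly one path starts in each of the first `k` rows outside `A`, and each of them must leave
the last row; a wrong number of exits admits no family. -/
theorem gridSum_eq_zero {L : Type*} [CommRing L] {v : ℕ → ℕ → L} {m : ℕ} {A : Finset ℕ} {k : ℕ}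
    {J : Finset ℕ} (hJ : J ⊆ Finset.range m) (h : (A ∩ Finset.range k).card + J.card ≠ k) :
    gridSum v m A k J = 0 := by
  induction k generalizing J with
  | zero =>
    have : J ≠ ∅ := by rintro rfl; simp at h
    simp [gridSum, this]
  | succ k ih =>
    rw [gridSum]
    refine mul_eq_zero_of_right _ (Finset.sum_eq_zero fun J₀ hJ₀ => ?_)
    by_cases hr : RowOK (if k ∈ A then 0 else 1) J₀ J m 0
    · rw [if_pos hr]
      refine ih (Finset.mem_powerset.1 hJ₀) fun h' => h ?_
      have := rowOK_card (Finset.mem_powerset.1 hJ₀) hJ hr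
      rw [Finset.range_add_one]
      by_cases hA : k ∈ A
      · rw [if_pos hA] at this
        rw [Finset.inter_insert_of_mem hA, Finset.card_insert_of_notMem (by simp)]
        omega
      · rw [if_neg hA] at this
        rw [Finset.inter_insert_of_notMem hA]
        omega
    · rw [if_neg hr]

section Exterior

/-- The signs in the recursion are chosen for this: moving the new unit vector past the columns of
the previous rows costs one sign per column, and the negated columns supply exactly these signs. -/
theorem mul_orderedProd_neg {Λ : Type*} [Ring Λ] {ρ : Λ} {x : ℕ → Λ}
    (h : ∀ j, ρ * x j = -(x j * ρ)) (J : Finset ℕ) (j : ℕ) :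
    ρ * orderedProd (fun j => -x j) J j = orderedProd x J j * ρ := by
  induction j with
  | zero => simp [orderedProd]
  | succ j ih =>
    rw [orderedProd, orderedProd, ← mul_assoc, ih]
    split_ifs
    · rw [mul_assoc, mul_assoc, mul_neg, h, neg_neg]
    · simp

/-- The exponent is irrelevant: this is used only where the product turns out to be zero. -/
theorem exists_orderedProd_neg {Λ : Type*} [Ring Λ] (x : ℕ → Λ) (J : Finset ℕ) (j : ℕ) :
    ∃ e : ℕ, orderedProd (fun j => -x j) J j = orderedProd x J j * (-1) ^ e := by
  induction j with
  | zero => exact ⟨0, by simp [orderedProd]⟩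
  | succ j ih =>
    obtain ⟨e, he⟩ := ih
    rw [orderedProd, orderedProd, he]
    split_ifs
    · refine ⟨e + 1, ?_⟩
      rw [pow_succ, mul_assoc, mul_assoc, ← ((Commute.neg_one_left (-x j)).pow_left e).eq.symm]
      simp
    · exact ⟨e, by simp⟩

variable {L W : Type*} [CommRing L] [AddCommGroup W] [Module L W]

open Classical in
-- The Lindström–Gessel–Viennot expansion by induction on the rows. `orderedProd_partialSum` expands
-- the last row over its entry sets, and the induction hypothesis handles the rows above. The
-- hypothesis is an inequality, not an equality, because the induction also meets products with too
-- many factors; there both sides vanish by `gridSum_eq_zero`.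
theorem orderedProd_gridColumn (v : ℕ → ℕ → L) (ε : ℕ → W) (m : ℕ) (A : Finset ℕ) {k : ℕ}
    {J : Finset ℕ} (hJ : J ⊆ Finset.range m) (h : k ≤ (A ∩ Finset.range k).card + J.card) :
    orderedProd (fun i => ExteriorAlgebra.ι L (ε i)) A k *
        orderedProd (fun j => ExteriorAlgebra.ι L (gridColumn v ε k j)) J m =
      gridSum v m A k J • orderedProd (fun i => ExteriorAlgebra.ι L (ε i)) (Finset.range k) k := by
  induction k generalizing J with
  | zero =>
    have h0 : ∀ m, orderedProd (fun j => ExteriorAlgebra.ι L (gridColumn v ε 0 j)) J m =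
        if J ∩ Finset.range m = ∅ then 1 else 0 := by
      intro m
      induction m with
      | zero => simp [orderedProd]
      | succ m ih =>
        rw [orderedProd, ih, Finset.range_add_one]
        by_cases hm : m ∈ J
        · rw [Finset.inter_insert_of_mem hm]
          simp [hm, gridColumn]
        · rw [Finset.inter_insert_of_notMem hm]
          simp [hm]
    rw [h0, Finset.inter_eq_left.2 hJ]
    simp [orderedProd, gridSum]
  | succ k ih =>
    set E := fun i => ExteriorAlgebra.ι L (ε i) with hE
    set K := fun j => ExteriorAlgebra.ι L (gridColumn v ε k j) with hK
    have hanti : ∀ j, E k * K j = -(K j * E k) := fun j =>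
      eq_neg_of_add_eq_zero_left (ExteriorAlgebra.ι_add_mul_swap _ _)
    have hsq : E k * E k = 0 := ExteriorAlgebra.ι_sq_zero _
    have hcol := (orderedProd_partialSum (E k) (fun j => -K j) J (v k)
      (fun j => ExteriorAlgebra.ι L (ε k - ∑ i ∈ Finset.range j, gridColumn v ε k i)) (by simp [hE])
      (fun j => by simp only [Finset.sum_range_succ, hK, map_sub, map_add]; abel)
      (fun j => ExteriorAlgebra.ι_sq_zero _) m).1
    have hfil : (∏ i ∈ Finset.range m with i ∈ J, v k i) = ∏ b ∈ J, v k b := by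
      rw [Finset.filter_mem_eq_inter, Finset.inter_eq_right.2 hJ]
    have hlhs : (fun j => ExteriorAlgebra.ι L (gridColumn v ε (k + 1) j)) = fun j =>
        v k j • ExteriorAlgebra.ι L (ε k - ∑ i ∈ Finset.range (j + 1), gridColumn v ε k i) := by
      funext j
      rw [gridColumn, map_smul]
    rw [hlhs, hcol, hfil, mul_smul_comm, gridSum, mul_smul]
    congr 1
    rw [rowSum, Finset.mul_sum, Finset.sum_smul]
    refine Finset.sum_congr rfl fun J₀ hJ₀ => ?_
    have hJ₀' := Finset.mem_powerset.1 hJ₀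
    have hE1 : orderedProd E (Finset.range (k + 1)) (k + 1) =
        orderedProd E (Finset.range k) k * E k := by
      rw [orderedProd, if_pos (by simp)]
      congr 1
      exact orderedProd_congr (fun i hi => by simp; omega) fun _ _ => rfl
    rw [hE1, orderedProd, Finset.sum_range_succ, Finset.sum_range_one]
    simp only [Nat.cast_zero, Nat.cast_one, pow_zero, one_mul, pow_one]
    by_cases hA : k ∈ A
    · have hc : (A ∩ Finset.range (k + 1)).card = (A ∩ Finset.range k).card + 1 := by
        rw [Finset.range_add_one, Finset.inter_insert_of_mem hA,
          Finset.card_insert_of_notMem (by simp)]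
      simp only [hA, if_true]
      -- The source vector of row `k` is already a factor, so no path can start there.
      have h1 : (orderedProd E A k * E k) * (if RowOK 1 J₀ J m 0 then
          E k * orderedProd (fun j => -K j) J₀ m else 0) = 0 := by
        split_ifs
        · rw [mul_assoc, ← mul_assoc (E k), hsq, zero_mul, mul_zero]
        · rw [mul_zero]
      rw [mul_add, h1, add_zero]
      split_ifs with hr
      · have := rowOK_card hJ₀' hJ hr
        rw [mul_assoc, mul_orderedProd_neg hanti, ← mul_assoc, ih hJ₀' (by omega), smul_mul_assoc]
      · rw [mul_zero, zero_smul]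
    · have hc : (A ∩ Finset.range (k + 1)).card = (A ∩ Finset.range k).card := by
        rw [Finset.range_add_one, Finset.inter_insert_of_notMem hA]
      simp only [hA, if_false, mul_one]
      -- If no path started in row `k`, more than `k` vectors would have to fit into the first `k`
      -- rows.
      have h1 : orderedProd E A k * (if RowOK 0 J₀ J m 0 then
          orderedProd (fun j => -K j) J₀ m else 0) = 0 := by
        split_ifs with hr
        · have := rowOK_card hJ₀' hJ hr
          obtain ⟨e, he⟩ := exists_orderedProd_neg K J₀ m
          rw [he, ← mul_assoc, ih hJ₀' (by omega), gridSum_eq_zero hJ₀' (by omega), zero_smul,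
            zero_mul]
        · rw [mul_zero]
      rw [mul_add, h1, zero_add]
      split_ifs with hr
      · have := rowOK_card hJ₀' hJ hr
        rw [mul_orderedProd_neg hanti, ← mul_assoc, ih hJ₀' (by omega), smul_mul_assoc]
      · rw [mul_zero, zero_smul]

end Exterior

theorem orderedProd_eq_list_prod {R : Type*} [Monoid R] (x : ℕ → R) (J : Finset ℕ) (j : ℕ) :
    orderedProd x J j = (((List.range j).filter (· ∈ J)).map x).prod := by
  induction j with
  | zero => rfl
  | succ j ih =>
    rw [orderedProd, ih, List.range_succ, List.filter_append, List.map_append, List.prod_append]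
    congr 1
    by_cases h : j ∈ J <;> simp [h]

theorem orderedProd_add {R : Type*} [Monoid R] (x : ℕ → R) (S J : Finset ℕ) (k m : ℕ)
    (hJ : ∀ j < m, (j ∈ J ↔ k + j ∈ S)) :
    orderedProd x S (k + m) = orderedProd x S k * orderedProd (fun j => x (k + j)) J m := by
  induction m with
  | zero => simp [orderedProd]
  | succ m ih =>
    rw [← Nat.add_assoc, orderedProd, ih fun j hj => hJ j (by omega), orderedProd, mul_assoc,
      if_congr (hJ m (by omega)) rfl rfl]

/-- Translates the increasing enumeration of a column set, used for Plücker coordinates, into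
products over initial segments, which suit inductions on positions. -/
theorem list_ofFn_orderEmbOfFin_prod {R : Type*} [Monoid R] {n k : ℕ} (x : ℕ → R)
    (I : Finset (Fin n)) (hI : I.card = k) :
    (List.ofFn fun a => x (I.orderEmbOfFin hI a)).prod =
      orderedProd x (I.map Fin.valEmbedding) n := by
  rw [orderedProd_eq_list_prod]
  have h1 : (List.ofFn fun a => x (I.orderEmbOfFin hI a)) =
      (List.ofFn fun a => ((I.orderEmbOfFin hI a : Fin n) : ℕ)).map x := by
    rw [List.map_ofFn]; rfl
  rw [h1]
  congr 2
  refine List.SortedLT.eq_of_mem_iff ?_ ?_ fun i => ?_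
  · exact List.sortedLT_ofFn_iff.2 fun a b hab => (I.orderEmbOfFin hI).strictMono hab
  · exact ((List.pairwise_lt_range).filter _).sortedLT
  · simp only [List.mem_ofFn, List.mem_filter, List.mem_range, decide_eq_true_eq, Finset.mem_map,
      Fin.valEmbedding_apply]
    have hr := Finset.range_orderEmbOfFin I hI
    constructor
    · rintro ⟨a, rfl⟩
      exact ⟨(I.orderEmbOfFin hI a).2, _, Finset.orderEmbOfFin_mem I hI a, rfl⟩
    · rintro ⟨-, t, ht, rfl⟩
      have : t ∈ Set.range (I.orderEmbOfFin hI) := hr ▸ ht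
      obtain ⟨a, ha⟩ := this
      exact ⟨a, by rw [ha]⟩

/-- The maximal minors of a matrix whose columns are unit vectors and network columns. -/
theorem det_gridColumn {L : Type*} [CommRing L] {k n : ℕ} (hkn : k ≤ n) (v : ℕ → ℕ → L)
    (ε : ℕ → Fin k → L) (hε : ∀ i : Fin k, ε i = Pi.single i 1) (I : Finset (Fin n))
    (hI : I.card = k) (M : Matrix (Fin k) (Fin n) L)
    (hM : ∀ a t, M a t = if (t : ℕ) < k then ε t a else gridColumn v ε k (t - k) a) :
    pluckerTuple M (I.orderEmbOfFin hI) = gridSum v (n - k) (I.map Fin.valEmbedding) k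
      ({j ∈ Finset.range (n - k) | k + j ∈ I.map Fin.valEmbedding}) := by
  set S := I.map Fin.valEmbedding with hS
  set J := {j ∈ Finset.range (n - k) | k + j ∈ S} with hJ
  set col : ℕ → Fin k → L := fun t => if t < k then ε t else gridColumn v ε k (t - k) with hcol
  have hSn : ∀ t ∈ S, t < n := by
    intro t ht
    obtain ⟨t, -, rfl⟩ := Finset.mem_map.1 ht
    exact t.2
  have hcard : (S ∩ Finset.range k).card + J.card = k := by
    have h1 : S.card = k := by rw [hS, Finset.card_map, hI]
    have h2 : J.card = (S \ Finset.range k).card := by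
      refine Finset.card_bij (fun j _ => k + j) ?_ ?_ ?_
      · intro j hj
        simp only [hJ, Finset.mem_filter] at hj
        simp [hj.2]
      · intro j _ j' _ h
        omega
      · intro t ht
        simp only [Finset.mem_sdiff, Finset.mem_range, not_lt] at ht
        have := hSn t ht.1
        exact ⟨t - k, by simp [hJ, ht.2, ht.1]; omega, by omega⟩
    rw [h2, Finset.card_inter_add_card_sdiff, h1]
  have hε' : ∀ i < k, ε i = col i := fun i hi => by simp [hcol, hi]
  have key := orderedProd_gridColumn v ε (n - k) S (k := k) (J := J) (Finset.filter_subset _ _)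
    hcard.ge
  -- The determinant is an alternating form in degree `k`, extended by zero in the other degrees to
  -- a linear form on the whole exterior algebra. Applied to `key`, it turns the identity of
  -- products into one of minors.
  have hdet : ∀ f : Fin k → Fin k → L, ExteriorAlgebra.liftAlternating (R := L) (M := Fin k → L)
      (N := L) (fun i => if h : i = k then h ▸ Matrix.detRowAlternating else 0)
      (ExteriorAlgebra.ιMulti L k f) = Matrix.det (Matrix.of f) := by
    intro f
    rw [ExteriorAlgebra.liftAlternating_apply_ιMulti, dif_pos rfl]
    rfl
  have h1 : orderedProd (fun i => ExteriorAlgebra.ι L (ε i)) S k *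
      orderedProd (fun j => ExteriorAlgebra.ι L (gridColumn v ε k j)) J (n - k) =
      ExteriorAlgebra.ιMulti L k (fun a => col (I.orderEmbOfFin hI a)) := by
    rw [ExteriorAlgebra.ιMulti_apply,
      list_ofFn_orderEmbOfFin_prod (fun t => ExteriorAlgebra.ι L (col t)) I hI]
    have h2 := orderedProd_add (fun t => ExteriorAlgebra.ι L (col t)) S J k (n - k)
      (fun j hj => by simp [hJ, hj])
    rw [Nat.add_sub_cancel' hkn] at h2
    rw [h2]
    congr 1
    · exact orderedProd_congr (fun _ _ => Iff.rfl) fun i hi => by rw [hε' i hi]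
    · exact orderedProd_congr (fun _ _ => Iff.rfl) fun i hi => by simp [hcol]
  have h3 : orderedProd (fun i => ExteriorAlgebra.ι L (ε i)) (Finset.range k) k =
      ExteriorAlgebra.ιMulti L k (fun a => ε a) := by
    have := list_ofFn_orderEmbOfFin_prod (fun i => ExteriorAlgebra.ι L (ε i))
      (Finset.univ : Finset (Fin k)) (Finset.card_fin k)
    rw [ExteriorAlgebra.ιMulti_apply]
    have h4 : ∀ a : Fin k, (Finset.univ : Finset (Fin k)).orderEmbOfFin (Finset.card_fin k) a = a :=
      fun a => by
        rw [← Finset.orderEmbOfFin_unique (Finset.card_fin k) (f := id) (by simp) strictMono_id]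
        rfl
    simp only [h4] at this
    rw [this]
    exact orderedProd_congr (fun i hi => by simp [hi]) fun _ _ => rfl
  rw [h1, h3] at key
  have := congrArg (ExteriorAlgebra.liftAlternating (R := L) (M := Fin k → L)
      (N := L) (fun i => if h : i = k then h ▸ Matrix.detRowAlternating else 0)) key
  rw [map_smul, hdet, hdet] at this
  have h5 : Matrix.of (fun a : Fin k => ε a) = 1 := by
    ext a b
    rw [Matrix.of_apply, hε, Matrix.one_apply, Pi.single_apply]
    simp [eq_comm]
  rw [h5, Matrix.det_one, smul_eq_mul, mul_one] at this
  rw [← this, pluckerTuple, ← Matrix.det_transpose]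
  congr 1
  ext a b
  simp only [Matrix.transpose_apply, Matrix.submatrix_apply, id, hM, Matrix.of_apply, hcol]
  split_ifs <;> rfl

/-! ### Matchings and families of disjoint paths -/

/-- The positions at which vertical edges from a set `B` enter the row `i` from above. -/
def rowSlice (m : ℕ) (B : Finset (ℕ × ℕ)) : ℕ → Finset ℕ
  | 0 => ∅
  | i + 1 => {j ∈ Finset.range m | (i, j) ∈ B}

/-- The vertical edges of a family of disjoint paths in the grid that start at the sources outside
`A`. -/
def IsGridFlow (m : ℕ) (A : Finset ℕ) (k : ℕ) (B : Finset (ℕ × ℕ)) : Prop :=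
  ∀ i < k, RowOK (if i ∈ A then 0 else 1) (rowSlice m B i) (rowSlice m B (i + 1)) m 0

theorem rowSlice_subset (m : ℕ) (B : Finset (ℕ × ℕ)) (i : ℕ) :
    rowSlice m B i ⊆ Finset.range m := by
  cases i with
  | zero => exact Finset.empty_subset _
  | succ i => exact Finset.filter_subset _ _

theorem rowSlice_congr {m : ℕ} {B B' : Finset (ℕ × ℕ)} {k : ℕ}
    (h : ∀ i < k, ∀ j, (i, j) ∈ B ↔ (i, j) ∈ B') {i : ℕ} (hi : i ≤ k) :
    rowSlice m B i = rowSlice m B' i := by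
  cases i with
  | zero => rfl
  | succ i => exact Finset.filter_congr fun j _ => h i (by omega) j

theorem isGridFlow_congr {m : ℕ} {A : Finset ℕ} {B B' : Finset (ℕ × ℕ)} {k : ℕ}
    (h : ∀ i < k, ∀ j, (i, j) ∈ B ↔ (i, j) ∈ B') :
    IsGridFlow m A k B ↔ IsGridFlow m A k B' := by
  refine forall₂_congr fun i hi => ?_
  rw [rowSlice_congr h (i := i) (by omega), rowSlice_congr h (i := i + 1) (by omega)]

theorem isGridFlow_succ {m : ℕ} {A : Finset ℕ} {k : ℕ} {B : Finset (ℕ × ℕ)} :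
    IsGridFlow m A (k + 1) B ↔ IsGridFlow m A k B ∧
      RowOK (if k ∈ A then 0 else 1) (rowSlice m B k) (rowSlice m B (k + 1)) m 0 :=
  ⟨fun h => ⟨fun i hi => h i (by omega), h k (by omega)⟩, fun h i hi => by
    rcases Nat.lt_succ_iff_lt_or_eq.1 hi with hi | rfl
    · exact h.1 i hi
    · exact h.2⟩

open Classical in
-- A family is determined by its vertical edges. Removing those of the last row leaves a family in
-- the rows above, whose exits are the entries of the last row; this unfolds the recursion.
theorem gridSum_eq_sum {L : Type*} [CommRing L] (v : ℕ → ℕ → L) (m : ℕ) (A : Finset ℕ) (k : ℕ)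
    {J' : Finset ℕ} (hJ' : J' ⊆ Finset.range m) :
    gridSum v m A k J' = ∑ B ∈ (Finset.range k ×ˢ Finset.range m).powerset with
      IsGridFlow m A k B ∧ rowSlice m B k = J', ∏ p ∈ B, v p.1 p.2 := by
  induction k generalizing J' with
  | zero =>
    by_cases h : J' = ∅
    · simp [gridSum, h, IsGridFlow, rowSlice]
    · simp [gridSum, h, IsGridFlow, rowSlice, Ne.symm h]
  | succ k ih =>
    have h1 : gridSum v m A (k + 1) J' = (∏ b ∈ J', v k b) *
        ∑ B ∈ (Finset.range k ×ˢ Finset.range m).powerset with IsGridFlow m A k B ∧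
          RowOK (if k ∈ A then 0 else 1) (rowSlice m B k) J' m 0, ∏ p ∈ B, v p.1 p.2 := by
      rw [gridSum]
      congr 1
      have h2 : ∀ J ∈ (Finset.range m).powerset,
          (if RowOK (if k ∈ A then 0 else 1) J J' m 0 then gridSum v m A k J else 0) =
          ∑ B ∈ (Finset.range k ×ˢ Finset.range m).powerset, if rowSlice m B k = J then
            (if IsGridFlow m A k B ∧ RowOK (if k ∈ A then 0 else 1) (rowSlice m B k) J' m 0 then
              ∏ p ∈ B, v p.1 p.2 else 0) else 0 := by
        intro J hJ
        rw [ih (Finset.mem_powerset.1 hJ), Finset.sum_filter]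
        by_cases hp : RowOK (if k ∈ A then 0 else 1) J J' m 0
        · rw [if_pos hp]
          refine Finset.sum_congr rfl fun B _ => ?_
          by_cases h3 : rowSlice m B k = J
          · subst h3
            by_cases h4 : IsGridFlow m A k B <;> simp [h4, hp]
          · simp [h3]
        · rw [if_neg hp]
          refine (Finset.sum_eq_zero fun B _ => ?_).symm
          by_cases h3 : rowSlice m B k = J
          · subst h3
            simp [hp]
          · simp [h3]
      rw [Finset.sum_congr rfl h2, Finset.sum_comm, Finset.sum_filter]
      refine Finset.sum_congr rfl fun B _ => ?_
      rw [Finset.sum_ite_eq, if_pos (Finset.mem_powerset.2 (rowSlice_subset m B k))]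
    rw [h1, Finset.mul_sum]
    have hnot : ∀ B ∈ (Finset.range k ×ˢ Finset.range m).powerset, ∀ i j, (i, j) ∈ B →
        i < k ∧ j < m := fun B hB i j h => by
      simpa using Finset.mem_powerset.1 hB h
    have hlt : ∀ B : Finset (ℕ × ℕ), ∀ i < k, ∀ j,
        ((i, j) ∈ B ∪ J'.image (fun b => (k, b)) ↔ (i, j) ∈ B) := by
      intro B i hi j
      simp only [Finset.mem_union, Finset.mem_image, Prod.mk.injEq, or_iff_left_iff_imp]
      rintro ⟨b, -, h, -⟩
      omega
    have hsl : ∀ B ∈ (Finset.range k ×ˢ Finset.range m).powerset,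
        rowSlice m (B ∪ J'.image (fun b => (k, b))) (k + 1) = J' := by
      intro B hB
      ext j
      simp only [rowSlice, Finset.mem_filter, Finset.mem_range, Finset.mem_union, Finset.mem_image,
        Prod.mk.injEq, true_and, exists_eq_right]
      constructor
      · rintro ⟨-, h | h⟩
        · exact absurd (hnot B hB _ _ h).1 (lt_irrefl _)
        · exact h
      · intro h
        exact ⟨Finset.mem_range.1 (hJ' h), .inr h⟩
    refine Finset.sum_nbij' (fun B => B ∪ J'.image (fun b => (k, b)))
      (fun B => B.filter fun p => p.1 < k) ?_ ?_ ?_ ?_ ?_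
    · intro B hB
      rw [Finset.mem_filter] at hB ⊢
      refine ⟨Finset.mem_powerset.2 (Finset.union_subset ?_ ?_), ?_, hsl B hB.1⟩
      · exact (Finset.mem_powerset.1 hB.1).trans
          (Finset.product_subset_product_left (Finset.range_subset_range.2 (by omega)))
      · intro p hp
        obtain ⟨b, hb, rfl⟩ := Finset.mem_image.1 hp
        simpa using hJ' hb
      · rw [isGridFlow_succ, hsl B hB.1, isGridFlow_congr (hlt B), rowSlice_congr (hlt B) le_rfl]
        exact hB.2
    · intro B hB
      rw [Finset.mem_filter] at hB ⊢
      obtain ⟨hB, hflow, hlast⟩ := hB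
      have hlt' : ∀ i < k, ∀ j, ((i, j) ∈ B.filter (fun p => p.1 < k) ↔ (i, j) ∈ B) := by
        intro i hi j
        simp [hi]
      refine ⟨Finset.mem_powerset.2 fun p hp => ?_, ?_⟩
      · have := Finset.mem_powerset.1 hB (Finset.mem_filter.1 hp).1
        simp only [Finset.mem_product, Finset.mem_range] at this ⊢
        exact ⟨(Finset.mem_filter.1 hp).2, this.2⟩
      · rw [isGridFlow_congr hlt', rowSlice_congr hlt' le_rfl, ← hlast]
        exact isGridFlow_succ.1 hflow
    · intro B hB
      rw [Finset.mem_filter] at hB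
      ext ⟨i, j⟩
      simp only [Finset.mem_filter, Finset.mem_union, Finset.mem_image, Prod.mk.injEq]
      constructor
      · rintro ⟨h | ⟨b, -, h, -⟩, hi⟩
        · exact h
        · omega
      · intro h
        exact ⟨.inl h, (hnot B hB.1 _ _ h).1⟩
    · intro B hB
      rw [Finset.mem_filter] at hB
      obtain ⟨hB, hflow, hlast⟩ := hB
      ext ⟨i, j⟩
      simp only [Finset.mem_filter, Finset.mem_union, Finset.mem_image, Prod.mk.injEq, ← hlast,
        rowSlice, Finset.mem_range]
      constructor
      · rintro (h | ⟨b, h, rfl, rfl⟩)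
        · exact h.1
        · exact h.2
      · intro h
        have := Finset.mem_powerset.1 hB h
        simp only [Finset.mem_product, Finset.mem_range] at this
        by_cases hi : i < k
        · exact .inl ⟨h, hi⟩
        · obtain rfl : i = k := by omega
          exact .inr ⟨j, ⟨this.2, h⟩, rfl, rfl⟩
    · intro B hB
      rw [Finset.mem_filter] at hB
      rw [Finset.prod_union, Finset.prod_image (by simp), mul_comm]
      rw [Finset.disjoint_left]
      rintro ⟨i, j⟩ h h'
      obtain ⟨b, -, h2⟩ := Finset.mem_image.1 h'
      have := (hnot B hB.1 _ _ h).1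
      simp only [Prod.mk.injEq] at h2
      omega

namespace GridEdge

variable {k m : ℕ}

/-- The weights `v i j` on the vertical edges and `1` on all other edges. -/
def vertWeight {L : Type*} [One L] (v : ℕ → ℕ → L) : GridEdge k m → L
  | vert i j => v i j
  | _ => 1

open Classical in
/-- The positions of the vertical edges in a set of edges. -/
noncomputable def vertSet (M : Finset (GridEdge k m)) : Finset (ℕ × ℕ) :=
  {p ∈ Finset.range k ×ˢ Finset.range m | ∃ i j, vert i j ∈ M ∧ p = ((i : ℕ), (j : ℕ))}

theorem vertSet_subset (M : Finset (GridEdge k m)) :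
    vertSet M ⊆ Finset.range k ×ˢ Finset.range m :=
  Finset.filter_subset _ _

theorem mem_vertSet {M : Finset (GridEdge k m)} (i : Fin k) (j : Fin m) :
    ((i : ℕ), (j : ℕ)) ∈ vertSet M ↔ vert i j ∈ M := by
  simp only [vertSet, Finset.mem_filter, Finset.mem_product, Finset.mem_range, Fin.is_lt, and_self,
    true_and, Prod.mk.injEq, Fin.val_inj]
  constructor
  · rintro ⟨i', j', h, rfl, rfl⟩
    exact h
  · exact fun h => ⟨i, j, h, rfl, rfl⟩

theorem prod_vertWeight {L : Type*} [CommMonoid L] (v : ℕ → ℕ → L) (M : Finset (GridEdge k m)) :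
    ∏ e ∈ M, vertWeight v e = ∏ p ∈ vertSet M, v p.1 p.2 := by
  classical
  have h1 : ∏ e ∈ M, vertWeight v e = ∏ e ∈ M with (∃ i j, e = vert i j), vertWeight v e := by
    symm
    refine Finset.prod_filter_of_ne fun e _ h => ?_
    rcases e with i | ⟨i, j⟩ | ⟨i, j⟩ | ⟨i, j⟩
    · exact absurd rfl h
    · exact absurd rfl h
    · exact ⟨i, j, rfl⟩
    · exact absurd rfl h
  rw [h1]
  symm
  refine Finset.prod_bij (fun p hp => vert
      ⟨p.1, by simpa using (Finset.mem_product.1 (Finset.mem_filter.1 hp).1).1⟩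
      ⟨p.2, by simpa using (Finset.mem_product.1 (Finset.mem_filter.1 hp).1).2⟩) ?_ ?_ ?_ ?_
  · rintro ⟨i, j⟩ hp
    obtain ⟨h, i', j', h', h2⟩ := Finset.mem_filter.1 hp
    simp only [Prod.mk.injEq] at h2
    obtain ⟨rfl, rfl⟩ := h2
    exact Finset.mem_filter.2 ⟨h', _, _, rfl⟩
  · rintro ⟨i, j⟩ hp ⟨i', j'⟩ hp' h
    simpa using h
  · intro e he
    obtain ⟨h, i, j, rfl⟩ := Finset.mem_filter.1 he
    exact ⟨(i, j), (mem_vertSet i j).2 h, rfl⟩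
  · intro p hp
    rfl

theorem vertBit_eq (M : Finset (GridEdge k m)) {i : ℕ} (hi : i ≤ k) (j : Fin m) :
    vertBit M i j = if (j : ℕ) ∈ rowSlice m (vertSet M) i then 1 else 0 := by
  rcases i with _ | i
  · simp [vertBit, rowSlice]
  · rw [vertBit, dif_pos (by omega)]
    refine if_congr ?_ rfl rfl
    simp only [rowSlice, Finset.mem_filter, Finset.mem_range, Fin.is_lt, true_and]
    exact (mem_vertSet ⟨i, by omega⟩ j).symm

/-- Subtracting the conditions at the black and the white vertex of a crossing eliminates the
diagonal edge and leaves the conservation law that defines `rowFlow`. -/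
theorem rowFlow_eq_horizBit {M : Finset (GridEdge k m)} (hM : IsLocalMatching M) {A : Finset ℕ}
    (hA : ∀ i : Fin k, (i : ℕ) ∈ A ↔ source i ∈ M) (i : Fin k) {j : ℕ} (hj : j ≤ m) :
    rowFlow (if (i : ℕ) ∈ A then 0 else 1) (rowSlice m (vertSet M) i)
      (rowSlice m (vertSet M) (i + 1)) j = horizBit M i j := by
  induction j with
  | zero =>
    have := hM.extra i
    rw [rowFlow, if_congr (hA i) rfl rfl]
    split_ifs at this ⊢ <;> omega
  | succ j ih =>
    have h1 := hM.black i ⟨j, by omega⟩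
    have h2 := hM.white i ⟨j, by omega⟩
    rw [vertBit_eq M (by omega)] at h1 h2
    rw [rowFlow, ih (by omega)]
    simp only at h1 h2
    omega

theorem horizBit_nonneg (M : Finset (GridEdge k m)) (i : Fin k) (j : ℕ) : 0 ≤ horizBit M i j := by
  unfold horizBit
  split_ifs <;> simp

theorem isGridFlow_vertSet {M : Finset (GridEdge k m)} (hM : IsLocalMatching M) {A : Finset ℕ}
    (hA : ∀ i : Fin k, (i : ℕ) ∈ A ↔ source i ∈ M) : IsGridFlow m A k (vertSet M) := by
  intro i hi
  have key := fun {j} => rowFlow_eq_horizBit hM hA ⟨i, hi⟩ (j := j)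
  simp only at key
  refine ⟨fun j hj => ?_, ?_⟩
  · rw [key hj.le]
    have h1 := hM.black ⟨i, hi⟩ ⟨j, hj⟩
    rw [vertBit_eq M hi.le] at h1
    refine ⟨horizBit_nonneg _ _ _, ?_⟩
    simp only at h1
    split_ifs at h1 ⊢ <;> omega
  · rw [key le_rfl]
    exact dif_neg (lt_irrefl m)

/-- The edge sets of the matchings that belong to families of disjoint paths. -/
def FlowMem (A : Finset ℕ) (B : Finset (ℕ × ℕ)) : GridEdge k m → Prop
  | source i => (i : ℕ) ∈ A
  | horiz i j => rowFlow (if (i : ℕ) ∈ A then 0 else 1) (rowSlice m B i) (rowSlice m B (i + 1)) j = 1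
  | vert i j => ((i : ℕ), (j : ℕ)) ∈ B
  | diag i j => rowFlow (if (i : ℕ) ∈ A then 0 else 1) (rowSlice m B i) (rowSlice m B (i + 1)) j +
      (if (j : ℕ) ∈ rowSlice m B i then 1 else 0) = 0

open Classical in
/-- The matching that belongs to a family of disjoint paths. -/
noncomputable def flowMatching (k m : ℕ) (A : Finset ℕ) (B : Finset (ℕ × ℕ)) :
    Finset (GridEdge k m) :=
  Finset.univ.filter (FlowMem A B)

theorem mem_flowMatching {A : Finset ℕ} {B : Finset (ℕ × ℕ)} {e : GridEdge k m} :
    e ∈ flowMatching k m A B ↔ FlowMem A B e := by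
  simp [flowMatching]

theorem vertSet_flowMatching {A : Finset ℕ} {B : Finset (ℕ × ℕ)}
    (hB : B ⊆ Finset.range k ×ˢ Finset.range m) : vertSet (flowMatching k m A B) = B := by
  ext ⟨i, j⟩
  constructor
  · intro h
    obtain ⟨h, i', j', h', h2⟩ := Finset.mem_filter.1 h
    rw [h2]
    exact mem_flowMatching.1 h'
  · intro h
    have := hB h
    simp only [Finset.mem_product, Finset.mem_range] at this
    exact (mem_vertSet ⟨i, this.1⟩ ⟨j, this.2⟩).2 (mem_flowMatching.2 h)

theorem flowMatching_vertSet {M : Finset (GridEdge k m)} (hM : IsLocalMatching M) {A : Finset ℕ}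
    (hA : ∀ i : Fin k, (i : ℕ) ∈ A ↔ source i ∈ M) : flowMatching k m A (vertSet M) = M := by
  ext e
  rw [mem_flowMatching]
  rcases e with i | ⟨i, j⟩ | ⟨i, j⟩ | ⟨i, j⟩
  · exact hA i
  · rw [FlowMem, rowFlow_eq_horizBit hM hA i j.2.le, horizBit, dif_pos j.2]
    split_ifs with h <;> simp [h]
  · exact mem_vertSet i j
  · have h1 := hM.black i j
    rw [vertBit_eq M i.2.le] at h1
    rw [FlowMem, rowFlow_eq_horizBit hM hA i j.2.le]
    by_cases h : diag i j ∈ M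
    · simp only [h, if_true, iff_true] at h1 ⊢
      omega
    · simp only [h, if_false, iff_false] at h1 ⊢
      omega

/-- At each crossing either one path passes, using one edge at the black and one at the white
vertex, or none does and the diagonal edge covers both. -/
theorem isLocalMatching_flowMatching {A : Finset ℕ} {B : Finset (ℕ × ℕ)}
    (hB : B ⊆ Finset.range k ×ˢ Finset.range m) (hflow : IsGridFlow m A k B) :
    IsLocalMatching (flowMatching k m A B) := by
  classical
  have hv : ∀ {i : ℕ} (hi : i ≤ k) (j : Fin m), vertBit (flowMatching k m A B) i j =
      if (j : ℕ) ∈ rowSlice m B i then 1 else 0 := fun hi j => by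
    rw [vertBit_eq _ hi, vertSet_flowMatching hB]
  have hh : ∀ (i : Fin k) (j : ℕ), j ≤ m → horizBit (flowMatching k m A B) i j =
      rowFlow (if (i : ℕ) ∈ A then 0 else 1) (rowSlice m B i) (rowSlice m B (i + 1)) j := by
    intro i j hj
    rcases hj.lt_or_eq with hj | rfl
    · rw [horizBit, dif_pos hj]
      simp only [mem_flowMatching, FlowMem]
      have := (hflow i i.2).1 j hj
      split_ifs at this ⊢ <;> omega
    · rw [horizBit, dif_neg (lt_irrefl _)]
      exact (hflow i i.2).2.symm
  have hd : ∀ (i : Fin k) (j : Fin m), diag i j ∈ flowMatching k m A B ↔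
      rowFlow (if (i : ℕ) ∈ A then 0 else 1) (rowSlice m B i) (rowSlice m B (i + 1)) j +
        (if (j : ℕ) ∈ rowSlice m B i then 1 else 0) = 0 := fun i j => mem_flowMatching
  refine ⟨fun i j => ?_, fun i j => ?_, fun i => ?_⟩
  · rw [hv i.2.le, hh i j j.2.le, if_congr (hd i j) rfl rfl]
    have := (hflow i i.2).1 j j.2
    split_ifs at this ⊢ <;> omega
  · have h0 : rowFlow (if (i : ℕ) ∈ A then 0 else 1) (rowSlice m B i) (rowSlice m B (i + 1)) (j + 1)
        = rowFlow (if (i : ℕ) ∈ A then 0 else 1) (rowSlice m B i) (rowSlice m B (i + 1)) j +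
          (if (j : ℕ) ∈ rowSlice m B i then 1 else 0) -
          (if (j : ℕ) ∈ rowSlice m B (i + 1) then 1 else 0) := rfl
    -- Nonnegativity at the next position excludes an exit from a crossing that no path has entered;
    -- past the last column it follows from the final flow being zero.
    have h3 : 0 ≤ rowFlow (if (i : ℕ) ∈ A then 0 else 1) (rowSlice m B i) (rowSlice m B (i + 1))
        (j + 1) := by
      by_cases hj : (j : ℕ) + 1 < m
      · exact ((hflow i i.2).1 _ hj).1
      · rw [show (j : ℕ) + 1 = m by omega, (hflow i i.2).2]
    rw [hv i.2, hh i (j + 1) j.2, if_congr (hd i j) rfl rfl]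
    have := (hflow i i.2).1 j j.2
    rw [h0] at h3 ⊢
    generalize rowFlow _ _ _ _ = h at *
    split_ifs at * <;> omega
  · rw [hh i 0 (Nat.zero_le _), rowFlow]
    simp only [mem_flowMatching, FlowMem]
    split_ifs <;> simp

end GridEdge

open GridEdge in
-- A matching corresponds to the set of its vertical edges. A source edge in the matching means that
-- no path starts in that row, so `I` prescribes both the unused sources and the exits at the
-- bottom; only vertical edges carry weight.
theorem grid_boundaryMeasurement {L : Type*} [CommRing L] {k n : ℕ} (hk : 0 < k) (hkn : k ≤ n)
    (v : ℕ → ℕ → L) (I : Finset (Fin n)) :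
    (gridGraph k n hk).boundaryMeasurement (vertWeight (k := k) (m := n - k) v) I =
      gridSum v (n - k) (I.map Fin.valEmbedding) k
        ({j ∈ Finset.range (n - k) | k + j ∈ I.map Fin.valEmbedding}) := by
  classical
  set A := I.map Fin.valEmbedding with hA
  have hmem : ∀ {t : ℕ} (ht : t < n), t ∈ A ↔ (⟨t, ht⟩ : Fin n) ∈ I := by
    intro t ht
    simp only [hA, Finset.mem_map, Fin.valEmbedding_apply]
    constructor
    · rintro ⟨s, hs, rfl⟩
      exact hs
    · exact fun h => ⟨_, h, rfl⟩
  have hbd : ∀ M : Finset (GridEdge k (n - k)), (gridGraph k n hk).bdrySubset M = I ↔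
      (∀ i : Fin k, (i : ℕ) ∈ A ↔ source i ∈ M) ∧
        rowSlice (n - k) (vertSet M) k = {j ∈ Finset.range (n - k) | k + j ∈ A} := by
    intro M
    have hcol : ∀ (j : ℕ) (hj : j < n - k), j ∈ rowSlice (n - k) (vertSet M) k ↔
        vert ⟨k - 1, by omega⟩ ⟨j, hj⟩ ∈ M := by
      intro j hj
      rw [show rowSlice (n - k) (vertSet M) k = rowSlice (n - k) (vertSet M) (k - 1 + 1) by
        congr 1; omega]
      simp only [rowSlice, Finset.mem_filter, Finset.mem_range, hj, true_and]
      exact mem_vertSet ⟨k - 1, by omega⟩ ⟨j, hj⟩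
    constructor
    · rintro rfl
      refine ⟨fun i => ?_, ?_⟩
      · rw [hmem (by omega), mem_grid_bdrySubset_row hk M i.2]
      · ext j
        by_cases hj : j < n - k
        · rw [hcol j hj, Finset.mem_filter, hmem (by omega), mem_grid_bdrySubset_col hk M hj]
          simp [hj]
        · simp only [Finset.mem_filter, Finset.mem_range, hj, false_and, iff_false]
          exact fun h => hj (Finset.mem_range.1 (rowSlice_subset _ _ _ h))
    · rintro ⟨h1, h2⟩
      ext t
      induction t using bdryLabel_cases hkn with
      | hrow i hi => rw [mem_grid_bdrySubset_row hk M hi, ← h1 ⟨i, hi⟩, hmem]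
      | hcol j hj =>
        rw [mem_grid_bdrySubset_col hk M hj, ← hcol j hj, h2, Finset.mem_filter, hmem (by omega)]
        simp [hj]
  rw [gridSum_eq_sum v (n - k) A k (Finset.filter_subset _ _)]
  unfold DiskGraph.boundaryMeasurement
  refine Finset.sum_nbij' (fun M : Finset (GridEdge k (n - k)) => vertSet M)
    (fun B => flowMatching k (n - k) A B) ?_ ?_ ?_ ?_ ?_
  · intro M hM
    obtain ⟨h1, h2⟩ := (Finset.mem_filter.1 hM).2
    replace h1 := (grid_isAlmostPerfectMatching_iff hk hkn M).1 h1
    obtain ⟨h2, h3⟩ := (hbd M).1 h2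
    exact Finset.mem_filter.2 ⟨Finset.mem_powerset.2 (vertSet_subset M),
      isGridFlow_vertSet h1 h2, h3⟩
  · intro B hB
    obtain ⟨h0, h1, h2⟩ := Finset.mem_filter.1 hB
    rw [Finset.mem_powerset] at h0
    refine Finset.mem_filter.2 ⟨Finset.mem_univ _,
      (grid_isAlmostPerfectMatching_iff hk hkn _).2 (isLocalMatching_flowMatching h0 h1),
      (hbd _).2 ⟨fun i => (mem_flowMatching (e := source i)).symm, ?_⟩⟩
    rw [vertSet_flowMatching h0, h2]
  · intro M hM
    obtain ⟨h1, h2⟩ := (Finset.mem_filter.1 hM).2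
    replace h1 := (grid_isAlmostPerfectMatching_iff hk hkn M).1 h1
    exact flowMatching_vertSet h1 ((hbd M).1 h2).1
  · intro B hB
    exact vertSet_flowMatching (Finset.mem_powerset.1 (Finset.mem_filter.1 hB).1)
  · intro M hM
    exact prod_vertWeight v M

/-! ### Gauge transformations and disconnected groves -/

namespace SimpleGraph

variable {V : Type*} {H : SimpleGraph V}

/-- The sum of a function of directed edges along a walk. -/
def Walk.dartSum {A : Type*} [AddCommGroup A] (f : V → V → A) : ∀ {u v : V}, H.Walk u v → A
  | _, _, .nil => 0
  | u, _, .cons (v := w) _ p => f u w + p.dartSum f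

/-- In a forest, either the path from `b` begins with the step to `a`, which the step from `a` to
`b` cancels by antisymmetry, or prepending that step gives the path from `a`. -/
theorem IsAcyclic.dartSum_eq_of_adj {A : Type*} [AddCommGroup A] {f : V → V → A}
    (hf : ∀ u v, f v u = -f u v) (hH : H.IsAcyclic) {a b t : V} (hab : H.Adj a b)
    {p : H.Walk a t} {q : H.Walk b t} (hp : p.IsPath) (hq : q.IsPath) :
    p.dartSum f = f a b + q.dartSum f := by
  by_cases ha : a ∈ q.support
  · cases q with
    | nil =>
      simp only [Walk.support_nil, List.mem_singleton] at ha
      exact absurd hab (by rw [ha]; exact H.irrefl)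
    | cons h q =>
      have hs := hH.eq_snd_of_adj_start hq hab.symm ha
      simp only [Walk.snd_cons] at hs
      subst hs
      have := congrArg Subtype.val ((hH.subsingleton_path _ _).elim ⟨p, hp⟩ ⟨q, hq.of_cons⟩)
      simp only at this
      rw [this, Walk.dartSum, hf a b, add_neg_cancel_left]
  · have := congrArg Subtype.val ((hH.subsingleton_path _ _).elim ⟨p, hp⟩ ⟨.cons hab q, hq.cons ha⟩)
    simp only at this
    rw [this, Walk.dartSum]

/-- On a forest with one root in each component, antisymmetric functions are gradients of functions
that vanish at the roots. -/
theorem IsAcyclic.exists_potential {ι A : Type*} [AddCommGroup A] {f : V → V → A}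
    (hf : ∀ u v, f v u = -f u v) (hH : H.IsAcyclic) {r : ι → V}
    (hr : ∀ v, ∃! i, H.Reachable v (r i)) :
    ∃ δ : V → A, (∀ i, δ (r i) = 0) ∧ ∀ a b, H.Adj a b → δ a = f a b + δ b := by
  choose i hi hu using hr
  choose p hp using fun v => (hi v).exists_isPath
  have key : ∀ v j (q : H.Walk v (r j)), q.IsPath → (p v).dartSum f = q.dartSum f := by
    intro v j q hq
    obtain rfl : j = i v := hu v j q.reachable
    have := congrArg Subtype.val ((hH.subsingleton_path _ _).elim ⟨p v, hp v⟩ ⟨q, hq⟩)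
    simp only at this
    rw [this]
  refine ⟨fun v => (p v).dartSum f, fun j => ?_, fun a b hab => ?_⟩
  · exact key (r j) j .nil .nil
  · have hj : i b = i a := (hu a (i b) (hab.reachable.trans (hi b)))
    obtain ⟨q, hq⟩ : ∃ q : H.Walk a (r (i b)), q.IsPath := by
      rw [hj]
      exact ⟨p a, hp a⟩
    change (p a).dartSum f = f a b + (p b).dartSum f
    rw [key a _ q hq]
    exact hH.dartSum_eq_of_adj hf hab hq (hp b)

end SimpleGraph

namespace DiskGraph

variable {n : ℕ} (G : DiskGraph n)

/-- The colour of a vertex. -/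
def vertexColor : G.Vertex → Color :=
  Quot.lift Prod.fst (by rintro _ _ rfl; rfl)

@[simp] theorem vertexColor_endpt (c : Color) (e : G.Edge) : G.vertexColor (G.endpt c e) = c := rfl

instance : Finite G.Vertex := Quot.finite _

/-- A matching contributes the factor of each interior vertex once. Boundary vertices may be used or
not, but their factor is 1. -/
theorem prod_endpt_of_isAlmostPerfectMatching {R : Type*} [CommMonoid R] [Fintype G.Vertex]
    {M : Finset G.Edge} (hM : G.IsAlmostPerfectMatching M) {γ : G.Vertex → R}
    (hγ : ∀ i, γ (G.bdryVertex i) = 1) :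
    ∏ e ∈ M, (γ (G.endpt .black e) * γ (G.endpt .white e)) = ∏ v, γ v := by
  classical
  have h1 : ∏ e ∈ M, (γ (G.endpt .black e) * γ (G.endpt .white e)) =
      ∏ x ∈ M ×ˢ (Finset.univ : Finset Color), γ (G.endpt x.2 x.1) := by
    rw [Finset.prod_product]
    refine Finset.prod_congr rfl fun e _ => ?_
    rw [show (Finset.univ : Finset Color) = {.black, .white} from rfl,
      Finset.prod_pair (by simp)]
  rw [h1, ← Finset.prod_fiberwise _ (fun x => G.endpt x.2 x.1)]
  refine Finset.prod_congr rfl fun v _ => ?_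
  rw [Finset.prod_congr rfl fun x hx => by rw [(Finset.mem_filter.1 hx).2]]
  by_cases hv : G.IsInterior v
  · obtain ⟨e, ⟨he, c, hc⟩, hu⟩ := hM v hv
    have : {x ∈ M ×ˢ (Finset.univ : Finset Color) | G.endpt x.2 x.1 = v} = {(e, c)} := by
      ext ⟨e', c'⟩
      simp only [Finset.mem_filter, Finset.mem_product, Finset.mem_univ, and_true,
        Finset.mem_singleton, Prod.mk.injEq]
      constructor
      · rintro ⟨h2, h3⟩
        refine ⟨hu e' ⟨h2, c', h3⟩, ?_⟩
        rw [← G.vertexColor_endpt c' e', h3, ← hc, vertexColor_endpt]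
      · rintro ⟨rfl, rfl⟩
        exact ⟨he, hc⟩
    rw [this, Finset.prod_singleton]
  · simp only [IsInterior, not_forall, not_not] at hv
    obtain ⟨i, rfl⟩ := hv
    rw [hγ, Finset.prod_const_one]

/-- Gauge transformations at interior vertices multiply all boundary measurements by a constant. -/
theorem boundaryMeasurement_gauge {R : Type*} [CommRing R] [Fintype G.Vertex] {γ : G.Vertex → R}
    (hγ : ∀ i, γ (G.bdryVertex i) = 1) (wt : G.Edge → R) (I : Finset (Fin n)) :
    G.boundaryMeasurement (fun e => γ (G.endpt .black e) * γ (G.endpt .white e) * wt e) I =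
      (∏ v, γ v) * G.boundaryMeasurement wt I := by
  classical
  unfold boundaryMeasurement
  rw [Finset.mul_sum]
  refine Finset.sum_congr rfl fun M hM => ?_
  rw [Finset.prod_mul_distrib,
    G.prod_endpt_of_isAlmostPerfectMatching (Finset.mem_filter.1 hM).2.1 hγ]

variable {G} {F F' : Finset G.Edge}

theorem edgeGraph_adj {a b : G.Vertex} : (G.edgeGraph F).Adj a b ↔ a ≠ b ∧
    ((∃ e ∈ F, G.endpt .black e = a ∧ G.endpt .white e = b) ∨
      ∃ e ∈ F, G.endpt .black e = b ∧ G.endpt .white e = a) :=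
  SimpleGraph.fromRel_adj _ _ _

/-- Every weight can be moved away from a disconnected grove by a gauge transformation. -/
theorem IsDisconnectedGrove.exists_gauge (hF : G.IsDisconnectedGrove F) {A : Type*}
    [AddCommGroup A] (g : G.Edge → A) :
    ∃ γ : G.Vertex → A, (∀ i, γ (G.bdryVertex i) = 0) ∧
      ∀ e ∈ F, γ (G.endpt .black e) + γ (G.endpt .white e) + g e = 0 := by
  classical
  set P : G.Vertex → G.Vertex → Prop := fun a b =>
    ∃ e ∈ F, G.endpt .black e = a ∧ G.endpt .white e = b with hP
  -- The weight of the edge between two vertices; as the grove has no parallel edges, the choice of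
  -- the edge is harmless.
  set f₀ : G.Vertex → G.Vertex → A := fun a b => if h : P a b then g h.choose else 0 with hf₀
  have hf₀e : ∀ e ∈ F, f₀ (G.endpt .black e) (G.endpt .white e) = g e := by
    intro e he
    have h : P (G.endpt .black e) (G.endpt .white e) := ⟨e, he, rfl, rfl⟩
    rw [hf₀]
    simp only [dif_pos h]
    congr 1
    obtain ⟨h1, h2, h3⟩ := h.choose_spec
    refine hF.no_parallel _ h1 _ he ?_
    rintro (_ | _)
    · exact h2
    · exact h3
  have hne : ∀ e e', G.endpt .white e ≠ G.endpt .black e' := fun e e' h => by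
    simpa using congrArg G.vertexColor h
  have hf₀w : ∀ e, f₀ (G.endpt .white e) (G.endpt .black e) = 0 := by
    intro e
    refine dif_neg ?_
    rintro ⟨e', -, h, -⟩
    exact hne e e' h.symm
  obtain ⟨δ, hδ, hδ'⟩ := hF.acyclic.exists_potential (f := fun a b => f₀ b a - f₀ a b)
    (fun u v => by abel) hF.component
  -- The gauge condition involves the sum over the two ends, a potential their difference; changing
  -- the sign at white vertices converts one into the other.
  refine ⟨fun v => if G.vertexColor v = .black then δ v else -δ v, fun i => ?_, fun e he => ?_⟩
  · simp only [hδ, neg_zero, ite_self]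
  · have hadj : (G.edgeGraph F).Adj (G.endpt .black e) (G.endpt .white e) :=
      edgeGraph_adj.2 ⟨(hne e e).symm, .inl ⟨e, he, rfl, rfl⟩⟩
    have := hδ' _ _ hadj
    rw [hf₀w, hf₀e e he] at this
    simp only [vertexColor_endpt, if_true, reduceCtorEq, if_false, this]
    abel

theorem eq_zero_of_walk {A : Type*} [AddCommGroup A] {γ : G.Vertex → A}
    (h : ∀ e ∈ F, γ (G.endpt .black e) + γ (G.endpt .white e) = 0) {u w : G.Vertex}
    (p : (G.edgeGraph F).Walk u w) (hw : γ w = 0) : γ u = 0 := by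
  induction p with
  | nil => exact hw
  | cons hab _ ih =>
    have h0 := ih hw
    obtain ⟨-, ⟨e, he, rfl, rfl⟩ | ⟨e, he, rfl, rfl⟩⟩ := edgeGraph_adj.1 hab
    · simpa [h0] using h e he
    · simpa [h0] using h e he

theorem IsDisconnectedGrove.eq_zero_of_gauge (hF : G.IsDisconnectedGrove F) {A : Type*}
    [AddCommGroup A] {γ : G.Vertex → A} (h0 : ∀ i, γ (G.bdryVertex i) = 0)
    (h : ∀ e ∈ F, γ (G.endpt .black e) + γ (G.endpt .white e) = 0) (v : G.Vertex) : γ v = 0 := by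
  obtain ⟨i, ⟨p⟩, -⟩ := hF.component v
  exact eq_zero_of_walk h p (h0 i)

/-- The gauge transformation that moves the unit weight of the edge `e` away from a disconnected
grove, in exponential notation. -/
noncomputable def IsDisconnectedGrove.gauge (hF : G.IsDisconnectedGrove F) (e : G.Edge) :
    G.Vertex → ℤ :=
  (hF.exists_gauge (Pi.single e (1 : ℤ))).choose

theorem IsDisconnectedGrove.gauge_bdryVertex (hF : G.IsDisconnectedGrove F) (e : G.Edge)
    (i : Fin n) : hF.gauge e (G.bdryVertex i) = 0 :=
  (hF.exists_gauge (Pi.single e (1 : ℤ))).choose_spec.1 i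

/-- The exponents of the gauge-fixed weights in terms of the original weights. -/
noncomputable def IsDisconnectedGrove.gaugeFix (hF : G.IsDisconnectedGrove F) (e e' : G.Edge) : ℤ :=
  hF.gauge e (G.endpt .black e') + hF.gauge e (G.endpt .white e') + if e' = e then 1 else 0

theorem IsDisconnectedGrove.gaugeFix_of_mem (hF : G.IsDisconnectedGrove F) (e : G.Edge)
    {e' : G.Edge} (he' : e' ∈ F) : hF.gaugeFix e e' = 0 := by
  have := (hF.exists_gauge (Pi.single e (1 : ℤ))).choose_spec.2 e' he'
  rw [Pi.single_apply] at this
  exact this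

/-- Gauge fixing along `F'` and then along `F` is a single gauge transformation of the unit weight
at `e`. As `e` is not in `F`, the weights on `F` are trivial before and after, so that gauge is
trivial by uniqueness. With the roles exchanged this makes the two exponent matrices inverse to each
other. -/
theorem IsDisconnectedGrove.sum_gaugeFix_mul (hF : G.IsDisconnectedGrove F)
    (hF' : G.IsDisconnectedGrove F') {e : G.Edge} (he : e ∉ F) (e' : G.Edge) :
    ∑ f ∈ F'ᶜ, hF'.gaugeFix e f * hF.gaugeFix f e' = if e' = e then 1 else 0 := by
  have hsum : ∀ e' : G.Edge, ∑ f ∈ F'ᶜ, hF'.gaugeFix e f * hF.gaugeFix f e' =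
      ∑ f ∈ F'ᶜ, hF'.gaugeFix e f * hF.gauge f (G.endpt .black e') +
      ∑ f ∈ F'ᶜ, hF'.gaugeFix e f * hF.gauge f (G.endpt .white e') + hF'.gaugeFix e e' := by
    intro e'
    have h1 : hF'.gaugeFix e e' = ∑ f ∈ F'ᶜ, hF'.gaugeFix e f * if e' = f then 1 else 0 := by
      simp only [mul_ite, mul_one, mul_zero, Finset.sum_ite_eq, Finset.mem_compl]
      split_ifs with h
      · exact hF'.gaugeFix_of_mem e h
      · rfl
    rw [h1]
    rw [← Finset.sum_add_distrib, ← Finset.sum_add_distrib]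
    refine Finset.sum_congr rfl fun f _ => ?_
    rw [gaugeFix.eq_1 hF f]
    ring
  have h0 := hF.eq_zero_of_gauge
    (γ := fun v => hF'.gauge e v + ∑ f ∈ F'ᶜ, hF'.gaugeFix e f * hF.gauge f v) (fun i => by
      simp [gauge_bdryVertex]) (fun e₁ he₁ => by
      have h2 := hsum e₁
      have h3 := gaugeFix.eq_1 hF' e e₁
      rw [if_neg (by rintro rfl; exact he he₁)] at h3
      simp only [hF.gaugeFix_of_mem _ he₁, mul_zero, Finset.sum_const_zero] at h2
      linarith)
  have h2 := hsum e'
  have h3 := gaugeFix.eq_1 hF' e e'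
  have h4 := h0 (G.endpt .black e')
  have h5 := h0 (G.endpt .white e')
  linarith

end DiskGraph

/-! ### The rows of the grid as a disconnected grove -/

/-- A graph in which every vertex has at most one lower neighbour is a forest. -/
theorem SimpleGraph.isAcyclic_of_parent {V : Type*} {H : SimpleGraph V} (ht : V → ℕ) (par : V → V)
    (h : ∀ a b, H.Adj a b → (ht b < ht a ∧ b = par a) ∨ ht a < ht b) : H.IsAcyclic := by
  classical
  intro u c hc
  -- At a highest vertex of a cycle both neighbours on the cycle would be its parent, but they are
  -- different.
  obtain ⟨v, hv, hmax⟩ := c.support.toFinset.exists_max_image ht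
    ⟨u, List.mem_toFinset.2 c.start_mem_support⟩
  have hv' : v ∈ c.support := List.mem_toFinset.1 hv
  have hr := hc.rotate hv'
  have key : ∀ w, w ∈ (c.rotate v hv').support → H.Adj v w → w = par v := by
    intro w hw hadj
    have hw' : w ∈ c.support := (c.mem_support_rotate_iff v hv').1 hw
    rcases h v w hadj with h1 | h1
    · exact h1.2
    · exact absurd (hmax w (List.mem_toFinset.2 hw')) (not_le.2 h1)
  refine hr.snd_ne_penultimate ?_
  exact (key _ (SimpleGraph.Walk.getVert_mem_support _ _)
    (SimpleGraph.Walk.adj_snd hr.not_nil)).trans (key _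
      (SimpleGraph.Walk.getVert_mem_support _ _)
      (SimpleGraph.Walk.adj_penultimate hr.not_nil).symm).symm

namespace GridVertex

variable {k m : ℕ}

/-- The distance from the right end of the row. -/
def height : GridVertex k m → ℕ
  | black _ j => 2 * j + 2
  | white _ j => 2 * j + 3
  | extra _ => 1
  | rowEnd _ => 0
  | colEnd _ => 0

/-- The neighbour to the right in the row. -/
def parent : GridVertex k m → GridVertex k m
  | black i j => if (j : ℕ) = 0 then extra i else white i ⟨j - 1, by omega⟩
  | white i j => black i j
  | extra i => rowEnd i
  | rowEnd i => rowEnd i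
  | colEnd j => colEnd j

/-- The label of the boundary vertex in the same row. -/
def root : GridVertex k m → ℕ
  | black i _ => i
  | white i _ => i
  | extra i => i
  | rowEnd i => i
  | colEnd j => k + j

end GridVertex

/-- The vertical edges of the grid. -/
def gridVertEdges (k m : ℕ) : Finset (GridEdge k m) :=
  Finset.univ.image fun p : Fin k × Fin m => GridEdge.vert p.1 p.2

namespace GridEdge

variable {k m : ℕ}

theorem mem_compl_gridVertEdges {e : GridEdge k m} :
    e ∈ (gridVertEdges k m)ᶜ ↔ ∀ i j, e ≠ vert i j := by
  simp [gridVertEdges, eq_comm]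

theorem parent_or_parent {e : GridEdge k m} (he : e ∈ (gridVertEdges k m)ᶜ) :
    ((vertexAt .white e).height < (vertexAt .black e).height ∧
      vertexAt .white e = (vertexAt .black e).parent) ∨
    ((vertexAt .black e).height < (vertexAt .white e).height ∧
      vertexAt .black e = (vertexAt .white e).parent) := by
  rw [mem_compl_gridVertEdges] at he
  rcases e with i | ⟨i, j⟩ | ⟨i, j⟩ | ⟨i, j⟩
  · right; simp [vertexAt, GridVertex.height, GridVertex.parent]
  · left
    by_cases hj : (j : ℕ) = 0
    · simp [vertexAt, GridVertex.height, GridVertex.parent, hj]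
    · simp [vertexAt, GridVertex.height, GridVertex.parent, hj]
      omega
  · exact absurd rfl (he i j)
  · right; simp [vertexAt, GridVertex.height, GridVertex.parent]

theorem root_eq {e : GridEdge k m} (he : e ∈ (gridVertEdges k m)ᶜ) :
    (vertexAt .black e).root = (vertexAt .white e).root := by
  rw [mem_compl_gridVertEdges] at he
  rcases e with i | ⟨i, j⟩ | ⟨i, j⟩ | ⟨i, j⟩
  · rfl
  · by_cases hj : (j : ℕ) = 0 <;> simp [vertexAt, GridVertex.root, hj]
  · exact absurd rfl (he i j)
  · rfl

theorem eq_of_vertexAt_eq {e e' : GridEdge k m} (he : e ∈ (gridVertEdges k m)ᶜ)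
    (he' : e' ∈ (gridVertEdges k m)ᶜ) (h : ∀ c, vertexAt c e = vertexAt c e') : e = e' := by
  rw [mem_compl_gridVertEdges] at he he'
  have hb := h .black
  have hw := h .white
  rcases e with i | ⟨i, j⟩ | ⟨i, j⟩ | ⟨i, j⟩ <;> rcases e' with i' | ⟨i', j'⟩ | ⟨i', j'⟩ | ⟨i', j'⟩ <;>
    first
    | exact absurd rfl (he _ _)
    | exact absurd rfl (he' _ _)
    | simp [vertexAt] at hb; done
    | simpa [vertexAt] using hb
    | (exfalso
       simp only [vertexAt, GridVertex.black.injEq] at hb hw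
       obtain ⟨rfl, rfl⟩ := hb
       split_ifs at hw
       simp [Fin.ext_iff] at hw
       omega)

end GridEdge

section Grid

variable {k n : ℕ} (hk : 0 < k)

theorem grid_edgeGraph_adj {F : Finset (GridEdge k (n - k))} {a b : (gridGraph k n hk).Vertex}
    (h : ((gridGraph k n hk).edgeGraph F).Adj a b) : ∃ e ∈ F,
      (gridVertexEquiv hk a = GridEdge.vertexAt .black e ∧
        gridVertexEquiv hk b = GridEdge.vertexAt .white e) ∨
      (gridVertexEquiv hk a = GridEdge.vertexAt .white e ∧
        gridVertexEquiv hk b = GridEdge.vertexAt .black e) := by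
  obtain ⟨-, ⟨e, he, rfl, rfl⟩ | ⟨e, he, rfl, rfl⟩⟩ := DiskGraph.edgeGraph_adj.1 h
  · exact ⟨e, he, .inl ⟨rfl, rfl⟩⟩
  · exact ⟨e, he, .inr ⟨rfl, rfl⟩⟩

theorem grid_root_eq_of_reachable {a b : (gridGraph k n hk).Vertex}
    (h : ((gridGraph k n hk).edgeGraph (gridVertEdges k (n - k))ᶜ).Reachable a b) :
    (gridVertexEquiv hk a).root = (gridVertexEquiv hk b).root := by
  obtain ⟨p⟩ := h
  induction p with
  | nil => rfl
  | cons hab _ ih =>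
    rw [← ih]
    obtain ⟨e, he, ⟨h1, h2⟩ | ⟨h1, h2⟩⟩ := grid_edgeGraph_adj hk hab
    · rw [h1, h2, GridEdge.root_eq he]
    · rw [h1, h2, GridEdge.root_eq he]

theorem grid_reachable_rowEnd (i : Fin k) (j : ℕ) :
    (((gridGraph k n hk).edgeGraph (gridVertEdges k (n - k))ᶜ).Reachable
      ((gridVertexEquiv hk).symm (.extra i)) ((gridVertexEquiv hk).symm (.rowEnd i))) ∧
    ∀ hj : j < n - k,
      ((gridGraph k n hk).edgeGraph (gridVertEdges k (n - k))ᶜ).Reachable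
        ((gridVertexEquiv hk).symm (.black i ⟨j, hj⟩))
        ((gridVertexEquiv hk).symm (.rowEnd i)) ∧
      ((gridGraph k n hk).edgeGraph (gridVertEdges k (n - k))ᶜ).Reachable
        ((gridVertexEquiv hk).symm (.white i ⟨j, hj⟩))
        ((gridVertexEquiv hk).symm (.rowEnd i)) := by
  have hmem : ∀ e : GridEdge k (n - k), (∀ i j, e ≠ .vert i j) → e ∈ (gridVertEdges k (n - k))ᶜ :=
    fun e he => GridEdge.mem_compl_gridVertEdges.2 he
  have h0 := (grid_reachable_edge hk (hmem (.source i) (by simp))).symm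
  refine ⟨h0, ?_⟩
  induction j with
  | zero =>
    intro hj
    have h1 := (grid_reachable_edge hk (hmem (.horiz i ⟨0, hj⟩) (by simp)))
    have h2 := (grid_reachable_edge hk (hmem (.diag i ⟨0, hj⟩) (by simp)))
    simp only [GridEdge.vertexAt, if_true] at h0 h1 h2
    exact ⟨h1.trans h0, h2.symm.trans (h1.trans h0)⟩
  | succ j ih =>
    intro hj
    obtain ⟨-, ih⟩ := ih (by omega)
    have h1 := (grid_reachable_edge hk (hmem (.horiz i ⟨j + 1, hj⟩) (by simp)))
    have h2 := (grid_reachable_edge hk (hmem (.diag i ⟨j + 1, hj⟩) (by simp)))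
    simp only [GridEdge.vertexAt, Nat.add_one_ne_zero, if_false, Nat.add_sub_cancel] at h1 h2
    exact ⟨h1.trans ih, h2.symm.trans (h1.trans ih)⟩

theorem root_bdryVertex (t : Fin n) :
    (gridVertexEquiv hk ((gridGraph k n hk).bdryVertex t)).root = t := by
  rw [gridVertexEquiv_bdryVertex]
  split_ifs with h
  · rfl
  · simp only [GridVertex.root]; omega

/-- The rows of the grid form a disconnected grove. -/
theorem grid_isDisconnectedGrove (hkn : k ≤ n) :
    (gridGraph k n hk).IsDisconnectedGrove (gridVertEdges k (n - k))ᶜ where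
  acyclic := by
    refine SimpleGraph.isAcyclic_of_parent (fun v => (gridVertexEquiv hk v).height)
      (fun v => (gridVertexEquiv hk).symm (gridVertexEquiv hk v).parent) fun a b hab => ?_
    obtain ⟨e, he, ⟨h1, h2⟩ | ⟨h1, h2⟩⟩ := grid_edgeGraph_adj hk hab
    · rw [(gridVertexEquiv hk).eq_symm_apply, h1, h2]
      exact (GridEdge.parent_or_parent he).imp_right And.left
    · rw [(gridVertexEquiv hk).eq_symm_apply, h1, h2]
      exact (GridEdge.parent_or_parent he).symm.imp_right And.left
  no_parallel e he e' he' h :=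
    GridEdge.eq_of_vertexAt_eq he he' fun c => (grid_endpt_eq_iff hk).1 (h c)
  component v := by
    have hu : ∀ s t, ((gridGraph k n hk).edgeGraph (gridVertEdges k (n - k))ᶜ).Reachable v
        ((gridGraph k n hk).bdryVertex s) →
        ((gridGraph k n hk).edgeGraph (gridVertEdges k (n - k))ᶜ).Reachable v
        ((gridGraph k n hk).bdryVertex t) → s = t := by
      intro s t hs ht
      have := grid_root_eq_of_reachable hk (hs.symm.trans ht)
      rw [root_bdryVertex, root_bdryVertex] at this
      exact Fin.ext this
    refine existsUnique_of_exists_of_unique ?_ hu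
    have hrow : ∀ i : Fin k, (gridVertexEquiv hk).symm (.rowEnd i) =
        (gridGraph k n hk).bdryVertex ⟨i, by omega⟩ := fun i => by
      rw [Equiv.symm_apply_eq, gridVertexEquiv_bdryVertex]
      simp
    obtain ⟨w, rfl⟩ := (gridVertexEquiv hk).symm.surjective v
    rcases w with ⟨i, j⟩ | ⟨i, j⟩ | i | i | j
    · exact ⟨_, hrow i ▸ ((grid_reachable_rowEnd hk i j).2 j.2).1⟩
    · exact ⟨_, hrow i ▸ ((grid_reachable_rowEnd hk i j).2 j.2).2⟩
    · exact ⟨_, hrow i ▸ (grid_reachable_rowEnd hk i 0).1⟩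
    · exact ⟨⟨i, by omega⟩, by rw [hrow i]⟩
    · refine ⟨⟨k + j, by omega⟩, ?_⟩
      rw [show (gridVertexEquiv hk).symm (.colEnd j) =
        (gridGraph k n hk).bdryVertex ⟨k + j, by omega⟩ by
          rw [Equiv.symm_apply_eq, gridVertexEquiv_bdryVertex]
          simp]

end Grid

/-! ### Isomorphisms of rational function fields -/

namespace RatFun

theorem eq_top_of_var_mem {τ : Type} {K : IntermediateField ℂ (RatFun τ)}
    (h : ∀ s, (var s : RatFun τ) ∈ K) : K = ⊤ := by
  have hp : ∀ p : MvPolynomial τ ℂ, algebraMap (MvPolynomial τ ℂ) (RatFun τ) p ∈ K := by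
    intro p
    induction p using MvPolynomial.induction_on with
    | C a =>
      have := K.algebraMap_mem a
      rwa [IsScalarTower.algebraMap_apply ℂ (MvPolynomial τ ℂ) (RatFun τ)] at this
    | add p q hp hq => rw [map_add]; exact add_mem hp hq
    | mul_X p s hp => rw [map_mul]; exact mul_mem hp (h s)
  refine eq_top_iff.2 fun x _ => ?_
  obtain ⟨p, q, -, rfl⟩ := IsFractionRing.div_surjective (A := MvPolynomial τ ℂ) x
  exact div_mem (hp p) (hp q)

theorem algebraicIndependent_var (τ : Type) :
    AlgebraicIndependent ℂ (var : τ → RatFun τ) := by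
  have := (MvPolynomial.algebraicIndependent_X τ ℂ).map' (A' := RatFun τ)
    (f := IsScalarTower.toAlgHom ℂ (MvPolynomial τ ℂ) (RatFun τ))
    (IsFractionRing.injective (MvPolynomial τ ℂ) (RatFun τ))
  exact this

theorem isAlgebraic_of_adjoin_eq_top {σ τ : Type} {f : σ → RatFun τ}
    (hf : IntermediateField.adjoin ℂ (Set.range f) = ⊤) :
    Algebra.IsAlgebraic (Algebra.adjoin ℂ (Set.range f)) (RatFun τ) := by
  refine ⟨fun x => ?_⟩
  have hx : x ∈ IntermediateField.adjoin ℂ (Set.range f) := by rw [hf]; trivial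
  obtain ⟨r, hr, s, hs, rfl⟩ := IntermediateField.mem_adjoin_iff_div.1 hx
  exact (isAlgebraic_algebraMap (⟨r, hr⟩ : Algebra.adjoin ℂ (Set.range f))).mul
    (isAlgebraic_algebraMap (⟨s, hs⟩ : Algebra.adjoin ℂ (Set.range f))).inv

/-- As many rational functions as there are variables are the images of the variables under an
isomorphism when they generate the field. -/
theorem exists_algEquiv {σ τ : Type} [Finite σ] [Finite τ] (hcard : Nat.card σ = Nat.card τ)
    {f : σ → RatFun τ} (hf : IntermediateField.adjoin ℂ (Set.range f) = ⊤) :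
    ∃ ψ : RatFun σ ≃ₐ[ℂ] RatFun τ, ∀ s, ψ (var s) = f s := by
  have halg := isAlgebraic_of_adjoin_eq_top hf
  -- A family over which the field is algebraic, with no more members than the transcendence degree,
  -- is a transcendence basis; so generation already implies independence.
  have hle : Cardinal.mk σ ≤ Algebra.trdeg ℂ (RatFun τ) := by
    rw [← Nat.cast_card, hcard, Nat.cast_card]
    exact (algebraicIndependent_var τ).cardinalMk_le_trdeg
  have hind := (Algebra.IsAlgebraic.isTranscendenceBasis_of_le_trdeg_of_finite ℂ f hle).1
  have hinj : Function.Injective (MvPolynomial.aeval f : MvPolynomial σ ℂ →ₐ[ℂ] RatFun τ) := hind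
  set φ : RatFun σ →ₐ[ℂ] RatFun τ := IsFractionRing.liftAlgHom hinj with hφ
  have hvar : ∀ s, φ (var s) = f s := fun s => by
    rw [hφ, IsFractionRing.liftAlgHom_apply]
    erw [IsFractionRing.lift_algebraMap]
    exact MvPolynomial.aeval_X _ _
  have hsurj : Function.Surjective φ := by
    rw [← AlgHom.fieldRange_eq_top, eq_top_iff, ← hf, IntermediateField.adjoin_le_iff]
    rintro _ ⟨s, rfl⟩
    exact ⟨var s, hvar s⟩
  exact ⟨AlgEquiv.ofBijective φ ⟨φ.toRingHom.injective, hsurj⟩, hvar⟩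

end RatFun

/-! ### Recovering the weights from the matrix -/

/-- The entries of the network matrix of the first `i` rows of the grid. -/
def gridEntry {L : Type*} [CommRing L] (v : ℕ → ℕ → L) : ℕ → ℕ → ℕ → L
  | 0, _, _ => 0
  | i + 1, a, b => v i b * ((if a = i then 1 else 0) - ∑ j ∈ Finset.range (b + 1), gridEntry v i a j)

section GridEntry

variable {L : Type*} [CommRing L] (v : ℕ → ℕ → L)

theorem gridEntry_succ (i a b : ℕ) : gridEntry v (i + 1) a b =
    v i b * ((if a = i then 1 else 0) - ∑ j ∈ Finset.range (b + 1), gridEntry v i a j) := rfl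

theorem gridEntry_eq_zero {i a : ℕ} (h : i ≤ a) (b : ℕ) : gridEntry v i a b = 0 := by
  induction i generalizing b with
  | zero => rfl
  | succ i ih =>
    rw [gridEntry_succ, if_neg (by omega), Finset.sum_eq_zero fun j _ => ih (by omega) j]
    simp

theorem gridEntry_succ_self (i b : ℕ) : gridEntry v (i + 1) i b = v i b := by
  rw [gridEntry_succ, Finset.sum_eq_zero fun j _ => gridEntry_eq_zero v le_rfl j]
  simp

theorem map_gridEntry {L' : Type*} [CommRing L'] (φ : L →+* L') (i a b : ℕ) :
    φ (gridEntry v i a b) = gridEntry (fun i b => φ (v i b)) i a b := by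
  induction i generalizing b with
  | zero => exact map_zero φ
  | succ i ih =>
    rw [gridEntry_succ, gridEntry_succ, map_mul, map_sub, map_sum, Finset.sum_congr rfl fun j _ =>
      ih j, apply_ite φ, map_one, map_zero]

theorem gridColumn_apply_eq_gridEntry {k : ℕ} (i b : ℕ) (a : Fin k) :
    (gridColumn v (fun t (a : Fin k) => if t = a then 1 else 0) i b : Fin k → L) a =
      gridEntry v i a b := by
  induction i generalizing b with
  | zero => rfl
  | succ i ih =>
    rw [gridColumn, gridEntry_succ, Pi.smul_apply, Pi.sub_apply, Finset.sum_apply,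
      Finset.sum_congr rfl fun j _ => ih j, smul_eq_mul]
    simp only [eq_comm]

/-- The weights are rational functions of the entries of the network matrix. -/
theorem mem_of_gridEntry_mem {C K : Type*} [Field C] [Field K] [Algebra C K]
    {S : IntermediateField C K} {v : ℕ → ℕ → K} {k m : ℕ} (hv : ∀ i b, v i b ≠ 0)
    (h : ∀ a < k, ∀ b < m, gridEntry v k a b ∈ S) : ∀ i < k, ∀ b < m, v i b ∈ S := by
  -- The recursion is run backwards, from `k` rows to `i` rows; the last row of the matrix of `i +
  -- 1` rows consists of the weights `v i b` themselves.
  have key : ∀ d i, i + d = k → ∀ a, a < k → ∀ b < m, gridEntry v i a b ∈ S := by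
    intro d
    induction d with
    | zero => rintro i rfl; exact h
    | succ d ih =>
      intro i hi a ha b hb
      have hs : ∀ b < m, ∑ j ∈ Finset.range (b + 1), gridEntry v i a j ∈ S := by
        intro b hb
        have h1 := ih (i + 1) (by omega) a ha b hb
        have h2 := ih (i + 1) (by omega) i (by omega) b hb
        rw [gridEntry_succ_self] at h2
        -- Division by the recovered weight gives the partial sums of the previous matrix, and their
        -- differences are its entries.
        have h3 : ∑ j ∈ Finset.range (b + 1), gridEntry v i a j =
            (if a = i then 1 else 0) - gridEntry v (i + 1) a b / v i b := by
          rw [gridEntry_succ, mul_div_cancel_left₀ _ (hv i b), sub_sub_cancel]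
        rw [h3]
        refine sub_mem ?_ (div_mem h1 h2)
        split_ifs
        exacts [one_mem _, zero_mem _]
      rcases b with _ | b
      · simpa using hs 0 hb
      · have := sub_mem (hs (b + 1) hb) (hs b (by omega))
        rwa [Finset.sum_range_succ, add_sub_cancel_left] at this
  intro i hi b hb
  have := key (k - (i + 1)) (i + 1) (by omega) i hi b hb
  rwa [gridEntry_succ_self] at this

end GridEntry

/-! ### The generic network in vertical weights -/

theorem prod_zpow_prod_zpow {ι κ κ' K : Type*} [Fintype ι] [Fintype κ] [Field K]
    {t : ι → K} (ht : ∀ e, t e ≠ 0) (B : Matrix ι κ ℤ) (A : Matrix κ κ' ℤ) (g : κ') :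
    ∏ f, (∏ e, t e ^ B e f) ^ A f g = ∏ e, t e ^ (B * A) e g := by
  simp only [← Finset.prod_zpow, ← zpow_mul]
  rw [Finset.prod_comm]
  refine Finset.prod_congr rfl fun e _ => ?_
  rw [Matrix.mul_apply]
  generalize (Finset.univ : Finset κ) = s
  classical
  induction s using Finset.induction_on with
  | empty => simp
  | insert a s ha ih => rw [Finset.prod_insert ha, Finset.sum_insert ha, zpow_add₀ (ht e), ih]

theorem prod_zpow_one {ι K : Type*} [Fintype ι] [DecidableEq ι] [Field K] (t : ι → K) (g : ι) :
    ∏ e, t e ^ (1 : Matrix ι ι ℤ) e g = t g := by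
  rw [Finset.prod_eq_single g]
  · simp
  · intro e _ he
    simp [Matrix.one_apply_ne he]
  · simp

theorem RatFun.var_ne_zero {σ : Type} (s : σ) : (var s : RatFun σ) ≠ 0 := by
  unfold var
  rw [Ne, IsFractionRing.to_map_eq_zero_iff]
  exact MvPolynomial.X_ne_zero s

theorem DiskGraph.genericWeight_eq_prod {n : ℕ} (G : DiskGraph n) (E' : Finset G.Edge)
    (e : G.Edge) : G.genericWeight E' e =
      ∏ e' : {e // e ∈ E'}, RatFun.var e' ^ (if e = e' then 1 else 0 : ℤ) := by
  unfold genericWeight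
  split_ifs with h
  · rw [Finset.prod_eq_single ⟨e, h⟩]
    · simp
    · intro e' _ he'
      rw [if_neg (fun h' => he' (Subtype.ext h'.symm)), zpow_zero]
    · simp
  · symm
    refine Finset.prod_eq_one fun e' _ => ?_
    rw [if_neg (fun h' => h (by rw [h']; exact e'.2)), zpow_zero]

section Grid

variable {k n : ℕ} (hk : 0 < k) (hkn : k ≤ n)

theorem sum_compl_compl_gridVertEdges {A : Type*} [AddCommMonoid A] {m : ℕ}
    (g : GridEdge k m → A) :
    ∑ f ∈ (gridVertEdges k m)ᶜᶜ, g f = ∑ p : Fin k × Fin m, g (.vert p.1 p.2) := by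
  rw [compl_compl, gridVertEdges, Finset.sum_image]
  rintro ⟨i, j⟩ - ⟨i', j'⟩ - h
  simpa using h

include hkn in
/-- Up to a common factor, the boundary measurements only depend on the gauge-fixed weights. -/
theorem hasPluckerCoords_boundaryMeasurement {L : Type*} [Field L]
    {v : ℕ → ℕ → L} {wt : GridEdge k (n - k) → L} {γ : (gridGraph k n hk).Vertex → L}
    (hγ : ∀ v, γ v ≠ 0) (hγ' : ∀ i, γ ((gridGraph k n hk).bdryVertex i) = 1)
    (h : ∀ e, GridEdge.vertWeight v e = γ ((gridGraph k n hk).endpt .black e) *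
      γ ((gridGraph k n hk).endpt .white e) * wt e) :
    HasPluckerCoords (chartMatrix fun ab : Fin k × Fin (n - k) => gridEntry v k ab.1 ab.2)
      ((gridGraph k n hk).boundaryMeasurement wt) := by
  classical
  have : Fintype (gridGraph k n hk).Vertex := Fintype.ofFinite _
  refine ⟨∏ v, γ v, Finset.prod_ne_zero_iff.2 fun v _ => hγ v, fun I hI => ?_⟩
  rw [← DiskGraph.boundaryMeasurement_gauge _ hγ' wt I]
  have h1 := grid_boundaryMeasurement hk hkn v I
  rw [← det_gridColumn hkn v (fun t (a : Fin k) => if t = a then 1 else 0) (fun i => by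
    ext a; simp [Pi.single_apply, Fin.ext_iff, eq_comm]) I hI
    (chartMatrix fun ab : Fin k × Fin (n - k) => gridEntry v k ab.1 ab.2) (fun a t => by
      simp only [chartMatrix, Matrix.of_apply, gridColumn_apply_eq_gridEntry, dite_eq_ite])] at h1
  rw [← h1]
  congr 1
  funext e
  exact h e

include hkn in
/-- The generic point of the Grassmannian as a network on the grid: the coordinates and the edge
weights are expressed by the gauge-fixed weights on the vertical edges. -/
theorem grid_exists_isPullback {E' : Finset (gridGraph k n hk).Edge}
    (hE' : (gridGraph k n hk).IsDisconnectedGrove E'ᶜ) :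
    ∃ (ψ : GrField k n ≃ₐ[ℂ] RatFun {e // e ∈ E'}) (v : ℕ → ℕ → GrField k n)
      (B : Matrix {e // e ∈ E'} (Fin k × Fin (n - k)) ℤ)
      (A : Matrix (Fin k × Fin (n - k)) {e // e ∈ E'} ℤ),
      (gridGraph k n hk).IsPullback k E' ψ ∧ (∀ i b, v i b ≠ 0) ∧
      (∀ ab : Fin k × Fin (n - k), RatFun.var ab = gridEntry v k ab.1 ab.2) ∧
      B * A = 1 ∧ A * B = 1 ∧ ∀ e, ψ.symm (RatFun.var e) = ∏ f, v f.1 f.2 ^ A f e := by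
  classical
  have hF := grid_isDisconnectedGrove hk hkn
  set B : Matrix {e // e ∈ E'} (Fin k × Fin (n - k)) ℤ :=
    fun e f => hF.gaugeFix e (GridEdge.vert f.1 f.2) with hB
  set A : Matrix (Fin k × Fin (n - k)) {e // e ∈ E'} ℤ :=
    fun f e => hE'.gaugeFix (GridEdge.vert f.1 f.2) e with hA
  have hBA : B * A = 1 := by
    ext e e'
    rw [Matrix.mul_apply, Matrix.one_apply]
    have := hE'.sum_gaugeFix_mul hF (e := e) (by simp) e'
    erw [sum_compl_compl_gridVertEdges] at this
    rw [hB, hA, this]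
    simp only [Subtype.ext_iff, eq_comm]
  have hAB : A * B = 1 := by
    ext f f'
    rw [Matrix.mul_apply, Matrix.one_apply]
    have := hF.sum_gaugeFix_mul hE' (e := GridEdge.vert f.1 f.2)
      (fun h => GridEdge.mem_compl_gridVertEdges.1 h _ _ rfl) (GridEdge.vert f'.1 f'.2)
    rw [compl_compl, ← Finset.sum_coe_sort] at this
    rw [hB, hA, this]
    have hff : (GridEdge.vert f'.1 f'.2 : GridEdge k (n - k)) = .vert f.1 f.2 ↔ f = f' := by
      rw [GridEdge.vert.injEq, eq_comm, eq_comm (a := f'.2), Prod.ext_iff]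
    by_cases h : f = f'
    · exact (if_pos (hff.2 h)).trans (if_pos h).symm
    · exact (if_neg fun h' => h (hff.1 h')).trans (if_neg h).symm
  set t : {e // e ∈ E'} → RatFun {e // e ∈ E'} := RatFun.var with ht
  have ht0 : ∀ e, t e ≠ 0 := RatFun.var_ne_zero
  -- The gauge-fixed weight of a vertical edge as a monomial in the given variables; the value 1
  -- outside the grid only keeps `V` nowhere zero.
  set V : ℕ → ℕ → RatFun {e // e ∈ E'} := fun i b =>
    if h : i < k ∧ b < n - k then ∏ e, t e ^ B e (⟨i, h.1⟩, ⟨b, h.2⟩) else 1 with hV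
  have hV0 : ∀ i b, V i b ≠ 0 := by
    intro i b
    simp only [hV]
    split_ifs
    · exact Finset.prod_ne_zero_iff.2 fun e _ => zpow_ne_zero _ (ht0 e)
    · exact one_ne_zero
  have hVf : ∀ f : Fin k × Fin (n - k), V f.1 f.2 = ∏ e, t e ^ B e f := fun f => by
    simp [hV]
  have htV : ∀ e, t e = ∏ f : Fin k × Fin (n - k), V f.1 f.2 ^ A f e := fun e => by
    simp only [hVf]
    rw [prod_zpow_prod_zpow ht0, hBA, prod_zpow_one]
  -- No counting of edges is needed: integer matrices that are inverse to each other on both sides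
  -- have to be square.
  have hcard : Nat.card (Fin k × Fin (n - k)) = Nat.card {e // e ∈ E'} := by
    rw [Nat.card_eq_fintype_card, Nat.card_eq_fintype_card]
    exact Matrix.square_of_invertible A B hAB hBA
  have hgen : IntermediateField.adjoin ℂ (Set.range fun ab : Fin k × Fin (n - k) =>
      gridEntry V k ab.1 ab.2) = ⊤ := by
    refine RatFun.eq_top_of_var_mem fun e => ?_
    change t e ∈ _
    have hmem := mem_of_gridEntry_mem (S := IntermediateField.adjoin ℂ
      (Set.range fun ab : Fin k × Fin (n - k) => gridEntry V k ab.1 ab.2)) (k := k) (m := n - k) hV0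
      (fun a ha b hb => IntermediateField.subset_adjoin _ _ ⟨(⟨a, ha⟩, ⟨b, hb⟩), rfl⟩)
    rw [htV e]
    exact prod_mem fun f _ => zpow_mem (hmem _ f.1.2 _ f.2.2) _
  obtain ⟨ψ, hψ⟩ := RatFun.exists_algEquiv hcard hgen
  refine ⟨ψ, fun i b => ψ.symm (V i b), B, A, ?_, fun i b => by simp [hV0], fun ab => ?_, hBA, hAB,
    fun e => ?_⟩
  · unfold DiskGraph.IsPullback
    simp only [hψ]
    refine hasPluckerCoords_boundaryMeasurement hk hkn
      (γ := fun v => ∏ e : {e // e ∈ E'}, t e ^ hF.gauge e v)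
      (fun v => Finset.prod_ne_zero_iff.2 fun e _ => zpow_ne_zero _ (ht0 e))
      (fun i => by simp [hF.gauge_bdryVertex]) fun e => ?_
    have h1 := (gridGraph k n hk).genericWeight_eq_prod E' e
    have h2 : GridEdge.vertWeight V e = ∏ e' : {e // e ∈ E'}, t e' ^ hF.gaugeFix e' e := by
      by_cases he : ∃ i j, e = .vert i j
      · obtain ⟨i, j, rfl⟩ := he
        exact hVf (i, j)
      · have hz : ∀ e' : {e // e ∈ E'}, hF.gaugeFix e' e = 0 := fun e' =>
          hF.gaugeFix_of_mem _ (GridEdge.mem_compl_gridVertEdges.2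
            fun i j h => he ⟨i, j, h⟩)
        simp only [hz, zpow_zero, Finset.prod_const_one]
        rcases e with i | ⟨i, j⟩ | ⟨i, j⟩ | ⟨i, j⟩
        · rfl
        · rfl
        · exact absurd ⟨i, j, rfl⟩ he
        · rfl
    rw [h1, h2, ← Finset.prod_mul_distrib, ← Finset.prod_mul_distrib]
    refine Finset.prod_congr rfl fun e' _ => ?_
    rw [← zpow_add₀ (ht0 e'), ← zpow_add₀ (ht0 e')]
    rfl
  · have := map_gridEntry V (ψ.symm : RatFun {e // e ∈ E'} →+* GrField k n) k ab.1 ab.2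
    refine Eq.trans ?_ this
    change _ = ψ.symm _
    rw [← hψ ab, ψ.symm_apply_apply]
  · change ψ.symm (t e) = _
    rw [htV e, map_prod]
    simp only [map_zpow₀]

end Grid

/-! ### Minors in cyclically consecutive columns -/

section CyclicMinors

variable {K : Type*} [CommRing K] (v : ℕ → ℕ → K) (m p : ℕ)

/-- The entries of the matrix that is obtained from the cyclically consecutive columns that start at
the position `p` by a permutation of the columns. -/
def cyclicEntry (i a a' : ℕ) : K :=
  if a' < p ∧ p ≤ a' + m then gridEntry v i a (p - 1 - a') else if a = a' then 1 else 0

theorem cyclicEntry_self_of_lt {i a' : ℕ} (h : a' < i) : cyclicEntry v m p i i a' = 0 := by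
  unfold cyclicEntry
  split_ifs with h1 h2
  · exact gridEntry_eq_zero v le_rfl _
  · omega
  · rfl

/-- Splits a partial sum into the part common to all replaced columns and the terms that are
themselves columns at the positions from `a'` up to `l`. -/
theorem sum_filter_gridEntry (i a : ℕ) {a' l : ℕ} (hl : a' ≤ l) :
    ∑ x ∈ Finset.range l, (if a' ≤ x ∧ x < p then gridEntry v i a (p - 1 - x) else 0) +
      ∑ j ∈ Finset.range (p - l), gridEntry v i a j =
    ∑ j ∈ Finset.range (p - a'), gridEntry v i a j := by
  induction l, hl using Nat.le_induction with
  | base =>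
    rw [Finset.sum_eq_zero, zero_add]
    intro x hx
    rw [if_neg]
    have := Finset.mem_range.1 hx
    omega
  | succ l hl ih =>
    rw [← ih, Finset.sum_range_succ]
    by_cases h : l < p
    · rw [if_pos ⟨hl, h⟩, show p - l = p - 1 - l + 1 by omega, Finset.sum_range_succ,
        show p - (l + 1) = p - 1 - l by omega]
      ring
    · rw [if_neg (by omega), show p - (l + 1) = p - l by omega, add_zero]

/-- A replaced column of the larger matrix is a weight times the new unit vector minus a partial sum
of old columns. Since the windows are consecutive, these partial sums differ only by old columns
from the same window. The larger matrix is therefore N T with its columns scaled by the weights,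
where T is triangular with diagonal entries ±1, and N has the smaller matrix as a block, its last
row being zero off the diagonal. -/
theorem det_cyclicEntry_succ (i : ℕ) : ∃ s : K, s ^ 2 = 1 ∧
    (Matrix.of fun a a' : Fin (i + 1) => cyclicEntry v m p (i + 1) a a').det =
      s * (∏ a' ∈ Finset.range (i + 1), if a' < p ∧ p ≤ a' + m then v i (p - 1 - a') else 1) *
        (Matrix.of fun a a' : Fin i => cyclicEntry v m p i a a').det := by
  -- Here no unit vector among the first i + 1 has been replaced and both matrices are identities.
  -- The factorization below would fail, because its column `i` starts from a nonempty partial sum.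
  by_cases hi : i + m < p
  · have hid : ∀ l ≤ i + 1,
        (Matrix.of fun a a' : Fin l => cyclicEntry v m p l a a').det = 1 := by
      intro l hl
      rw [← Matrix.det_one (n := Fin l)]
      congr 1
      ext a a'
      have := a'.2
      rw [Matrix.of_apply, cyclicEntry, if_neg (by omega), Matrix.one_apply]
      simp only [Fin.ext_iff]
    refine ⟨1, one_pow 2, ?_⟩
    rw [hid _ le_rfl, hid _ (by omega), Finset.prod_eq_one fun a' ha' => ?_]
    · simp
    · have := Finset.mem_range.1 ha'
      rw [if_neg (by omega)]
  · set N : Matrix (Fin (i + 1)) (Fin (i + 1)) K := Matrix.of fun a a' =>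
      if (a' : ℕ) = i then
        (if (a : ℕ) = i then 1 else 0) - ∑ j ∈ Finset.range (p - i), gridEntry v i a j
      else cyclicEntry v m p i a a' with hN
    -- Column a' of T takes column `i` of N, which carries the common partial sum, and subtracts the
    -- old replaced columns at the positions from a' to i - 1.
    set T : Matrix (Fin (i + 1)) (Fin (i + 1)) K := Matrix.of fun a a' =>
      if (a' : ℕ) < p ∧ p ≤ a' + m ∧ (a' : ℕ) < i then
        if (a : ℕ) = i then 1 else if (a' : ℕ) ≤ a ∧ (a : ℕ) < p then -1 else 0
      else if a = a' then 1 else 0 with hT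
    have hTdet : T.det ^ 2 = 1 := by
      rw [Matrix.det_of_isLowerTriangular, ← Finset.prod_pow]
      · refine Finset.prod_eq_one fun a _ => ?_
        rw [hT, Matrix.of_apply]
        split_ifs <;> simp_all
      · intro a a' h
        have h' : (a : ℕ) < a' := h
        have := a'.2
        rw [hT, Matrix.of_apply]
        split_ifs with h1 h2 h3 h4
        · omega
        · omega
        · rfl
        · exact absurd (congrArg Fin.val h4) h'.ne
        · rfl
    have hNdet : N.det = (Matrix.of fun a a' : Fin i => cyclicEntry v m p i a a').det := by
      rw [Matrix.det_succ_row N (Fin.last i), Fin.sum_univ_castSucc, Finset.sum_eq_zero, zero_add]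
      · have h1 : N (Fin.last i) (Fin.last i) = 1 := by
          simp [hN, gridEntry_eq_zero v le_rfl]
        have h2 : N.submatrix (Fin.last i).succAbove (Fin.last i).succAbove =
            Matrix.of fun a a' : Fin i => cyclicEntry v m p i a a' := by
          ext a a'
          simp [hN, a'.2.ne]
        rw [h1, h2, ← two_mul, pow_mul]
        simp
      · intro a _
        have h1 : N (Fin.last i) a.castSucc = 0 := by
          simp [hN, a.2.ne, cyclicEntry_self_of_lt]
        rw [h1]
        simp
    refine ⟨T.det, hTdet, ?_⟩
    have hfac : (Matrix.of fun a a' : Fin (i + 1) => cyclicEntry v m p (i + 1) a a') =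
        Matrix.of fun a a' : Fin (i + 1) =>
          (if (a' : ℕ) < p ∧ p ≤ a' + m then v i (p - 1 - a') else 1) * (N * T) a a' := by
      ext a a'
      rw [Matrix.of_apply, Matrix.of_apply, Matrix.mul_apply, Fin.sum_univ_castSucc]
      have hNl : N a (Fin.last i) = (if (a : ℕ) = i then 1 else 0) -
          ∑ j ∈ Finset.range (p - i), gridEntry v i a j := by
        simp [hN]
      by_cases hb : (a' : ℕ) < p ∧ p ≤ a' + m
      · have hent : cyclicEntry v m p (i + 1) a a' = v i (p - 1 - a') *
            ((if (a : ℕ) = i then 1 else 0) - ∑ j ∈ Finset.range (p - a'), gridEntry v i a j) := by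
          rw [cyclicEntry, if_pos hb, gridEntry_succ, show p - 1 - a' + 1 = p - a' by omega]
        rw [hent, if_pos hb]
        congr 1
        by_cases hai : (a' : ℕ) < i
        · have hTl : T (Fin.last i) a' = 1 := by
            rw [hT, Matrix.of_apply, if_pos ⟨hb.1, hb.2, hai⟩, if_pos (Fin.val_last i)]
          rw [hNl, hTl, ← sum_filter_gridEntry v p i a hai.le,
            ← Fin.sum_univ_eq_sum_range (fun x =>
              if (a' : ℕ) ≤ x ∧ x < p then gridEntry v i a (p - 1 - x) else 0) i]
          have : ∑ x : Fin i, N a x.castSucc * T x.castSucc a' = -∑ x : Fin i,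
              if (a' : ℕ) ≤ x ∧ (x : ℕ) < p then gridEntry v i a (p - 1 - x) else 0 := by
            rw [← Finset.sum_neg_distrib]
            refine Finset.sum_congr rfl fun x _ => ?_
            have hx := x.2
            rw [hT, Matrix.of_apply, if_pos ⟨hb.1, hb.2, hai⟩,
              if_neg (by simp only [Fin.val_castSucc]; omega)]
            simp only [Fin.val_castSucc]
            by_cases hc : (a' : ℕ) ≤ x ∧ (x : ℕ) < p
            · rw [if_pos hc, if_pos hc, hN, Matrix.of_apply, if_neg (by
                simp only [Fin.val_castSucc]; omega), cyclicEntry,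
                if_pos (by simp only [Fin.val_castSucc]; omega)]
              simp only [Fin.val_castSucc]
              ring
            · rw [if_neg hc, if_neg hc]
              simp
          rw [this]
          ring
        · have hai' : (a' : ℕ) = i := by omega
          have hT0 : ∀ x, T x a' = if x = a' then 1 else 0 := fun x => by
            rw [hT, Matrix.of_apply, if_neg (by omega)]
          have h0 : ∑ x : Fin i, N a x.castSucc * T x.castSucc a' = 0 := by
            refine Finset.sum_eq_zero fun x _ => ?_
            rw [hT0, if_neg (fun h => by
              have := congrArg Fin.val h
              simp only [Fin.val_castSucc] at this
              omega), mul_zero]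
          rw [h0, hT0, if_pos (Fin.ext (by simp [hai'])), hNl, hai']
          ring
      · have hT0 : ∀ x, T x a' = if x = a' then 1 else 0 := fun x => by
          rw [hT, Matrix.of_apply, if_neg (by tauto)]
        rw [← Fin.sum_univ_castSucc (fun x => N a x * T x a')]
        simp only [hT0, mul_ite, mul_one, mul_zero, Finset.sum_ite_eq', Finset.mem_univ, if_true]
        rw [if_neg hb, one_mul, cyclicEntry, if_neg hb, hN, Matrix.of_apply]
        by_cases h1 : (a' : ℕ) = i
        · rw [if_pos h1, h1, show p - i = 0 by omega]
          simp
        · rw [if_neg h1, cyclicEntry, if_neg hb]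
    rw [hfac, Matrix.det_mul_row (fun a' : Fin (i + 1) =>
      if (a' : ℕ) < p ∧ p ≤ a' + m then v i (p - 1 - a') else 1), Matrix.det_mul, hNdet,
      Fin.prod_univ_eq_prod_range (fun a' =>
        if a' < p ∧ p ≤ a' + m then v i (p - 1 - a') else 1) (i + 1)]
    ring

theorem det_cyclicEntry_sq (k : ℕ) :
    (Matrix.of fun a a' : Fin k => cyclicEntry v m p k a a').det ^ 2 =
      (∏ i ∈ Finset.range k, ∏ a ∈ Finset.range (i + 1),
        if a < p ∧ p ≤ a + m then v i (p - 1 - a) else 1) ^ 2 := by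
  induction k with
  | zero => simp
  | succ k ih =>
    obtain ⟨s, hs, h⟩ := det_cyclicEntry_succ v m p k
    rw [Finset.prod_range_succ (fun i => ∏ a ∈ Finset.range (i + 1),
      if a < p ∧ p ≤ a + m then v i (p - 1 - a) else 1) k, h, mul_pow, mul_pow, hs, ih]
    ring

/-- Unit columns in the window are put at their own positions; a missing unit column a' is replaced
by the network column p - 1 - a'. This permutation of the columns costs a sign, which squaring
removes. -/
theorem pluckerTuple_cyclicColumns_sq {k n : ℕ} (hkn : k ≤ n) (p : Fin n) :
    pluckerTuple (chartMatrix fun ab : Fin k × Fin (n - k) => gridEntry v k ab.1 ab.2)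
      (cyclicColumns k p) ^ 2 =
    (∏ i ∈ Finset.range k, ∏ a ∈ Finset.range (i + 1),
      if a < (p : ℕ) ∧ p ≤ a + (n - k) then v i (p - 1 - a) else 1) ^ 2 := by
  rw [← det_cyclicEntry_sq]
  have hp := p.2
  -- The place in the window from which the position `a` is filled: a network column, a unit column
  -- reached before the first network column, or a unit column reached after passing `n`.
  set f : Fin k → Fin k := fun a =>
    if h : (a : ℕ) < p ∧ (p : ℕ) ≤ a + (n - k) then ⟨k - 1 - a, by omega⟩
    else if h' : (p : ℕ) ≤ a then ⟨a - p, by omega⟩ else ⟨a + n - p, by omega⟩ with hf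
  have hinj : Function.Injective f := by
    intro a b hab
    have ha := a.2
    have hb := b.2
    simp only [hf] at hab
    split_ifs at hab <;> simp only [Fin.mk.injEq] at hab <;> ext <;> omega
  set σ : Equiv.Perm (Fin k) := Equiv.ofBijective f hinj.bijective_of_finite with hσ
  have key : (Matrix.of fun a a' : Fin k => cyclicEntry v (n - k) p k a a') =
      ((chartMatrix fun ab : Fin k × Fin (n - k) => gridEntry v k ab.1 ab.2).submatrix id
        (cyclicColumns k p)).submatrix id σ := by
    ext a a'
    have ha' := a'.2
    have hσa : σ a' = f a' := rfl
    rw [Matrix.submatrix_apply, Matrix.submatrix_apply, Matrix.of_apply, hσa, chartMatrix,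
      Matrix.of_apply, cyclicEntry]
    by_cases hb : (a' : ℕ) < p ∧ (p : ℕ) ≤ a' + (n - k)
    · have hcol : (cyclicColumns k p (f a') : ℕ) = k + (p - 1 - a') := by
        simp only [hf, hb, cyclicColumns]
        simp only [and_self, dite_true]
        rw [Nat.mod_eq_of_lt (by omega)]
        omega
      rw [if_pos hb, dif_neg (by omega)]
      simp [hcol]
    · have hcol : (cyclicColumns k p (f a') : ℕ) = a' := by
        simp only [hf, hb, cyclicColumns, dite_false]
        split_ifs with h'
        · simp only
          rw [Nat.mod_eq_of_lt (by omega)]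
          omega
        · simp only
          rw [show (p : ℕ) + (a' + n - p) = a' + n by omega, Nat.add_mod_right,
            Nat.mod_eq_of_lt (by omega)]
      rw [if_neg hb, dif_pos (by omega), hcol]
      simp [eq_comm]
  rw [key, Matrix.det_permute', mul_pow]
  simp only [pluckerTuple]
  rcases Int.units_eq_one_or (Equiv.Perm.sign σ) with h | h <;> simp [h]

/-- For a fixed position a ≤ i, each weight of row `i` occurs in exactly one of the `n` minors; the
i + 1 possible positions give the exponent. -/
theorem prod_pluckerTuple_cyclicColumns_sq {k n : ℕ} (hkn : k ≤ n) :
    (∏ p : Fin n, pluckerTuple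
      (chartMatrix fun ab : Fin k × Fin (n - k) => gridEntry v k ab.1 ab.2)
      (cyclicColumns k p)) ^ 2 =
    (∏ i ∈ Finset.range k, ∏ b ∈ Finset.range (n - k), v i b ^ (i + 1)) ^ 2 := by
  rw [← Finset.prod_pow, Finset.prod_congr rfl fun p _ => pluckerTuple_cyclicColumns_sq v hkn p,
    Finset.prod_pow, Fin.prod_univ_eq_prod_range (fun p => ∏ i ∈ Finset.range k,
      ∏ a ∈ Finset.range (i + 1), if a < p ∧ p ≤ a + (n - k) then v i (p - 1 - a) else 1) n,
    Finset.prod_comm]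
  congr 1
  refine Finset.prod_congr rfl fun i hi => ?_
  rw [Finset.prod_comm]
  have hi' := Finset.mem_range.1 hi
  have h : ∀ a ∈ Finset.range (i + 1), ∏ p ∈ Finset.range n,
      (if a < p ∧ p ≤ a + (n - k) then v i (p - 1 - a) else 1) =
      ∏ b ∈ Finset.range (n - k), v i b := by
    intro a ha
    have ha' := Finset.mem_range.1 ha
    rw [← Finset.prod_filter]
    refine Finset.prod_nbij' (fun p => p - 1 - a) (fun b => a + b + 1) ?_ ?_ ?_ ?_ ?_
    · intro p hp
      simp only [Finset.mem_filter, Finset.mem_range] at hp ⊢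
      omega
    · intro b hb
      simp only [Finset.mem_filter, Finset.mem_range] at hb ⊢
      omega
    · intro p hp
      simp only [Finset.mem_filter, Finset.mem_range] at hp ⊢
      omega
    · intro b _
      omega
    · intro p _
      rfl
  rw [Finset.prod_congr rfl h, Finset.prod_const, Finset.card_range, Finset.prod_pow]

end CyclicMinors

/-! ### Wedge products and logarithmic differentials -/

/-- An alternating map takes up the determinant of a linear substitution. -/
theorem AlternatingMap.map_sum_smul {R M W ι : Type*} [CommRing R] [AddCommGroup M] [Module R M]
    [AddCommGroup W] [Module R W] [Fintype ι] [DecidableEq ι] (f : M [⋀^ι]→ₗ[R] W)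
    (C : Matrix ι ι R) (v : ι → M) : f (fun i => ∑ j, C i j • v j) = C.det • f v := by
  -- Both sides are alternating in the rows of `C`, so it suffices to compare them on the standard
  -- basis.
  have key : f.compLinearMap (Fintype.linearCombination R v) =
      (Matrix.detRowAlternating (R := R) (n := ι)).smulRight (f v) := by
    refine Module.Basis.ext_alternating (Pi.basisFun R ι) fun i hi => ?_
    let σ : Equiv.Perm ι := Equiv.ofBijective i (Finite.injective_iff_bijective.1 hi)
    change f.compLinearMap _ (Pi.basisFun R ι ∘ σ) =
      ((Matrix.detRowAlternating (R := R) (n := ι)).smulRight (f v)) (Pi.basisFun R ι ∘ σ)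
    rw [AlternatingMap.map_perm, AlternatingMap.map_perm]
    congr 1
    have h1 : f.compLinearMap (Fintype.linearCombination R v) (Pi.basisFun R ι) = f v := by
      rw [AlternatingMap.compLinearMap_apply]
      congr 1
      funext j
      simp [Pi.basisFun_apply, Fintype.linearCombination_apply, Pi.single_apply]
    have h2 : Matrix.detRowAlternating (R := R) (n := ι) (Pi.basisFun R ι) = 1 := by
      rw [← Matrix.det_one (n := ι)]
      change Matrix.det _ = _
      congr 1
      ext i j
      simp [Matrix.one_apply, Pi.single_apply, eq_comm]
    rw [h1]
    change _ = Matrix.detRowAlternating (R := R) (n := ι) (Pi.basisFun R ι) • f v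
    rw [h2, one_smul]
  exact DFunLike.congr_fun key C

section WedgeProd

variable {K : Type} [Field K] [Algebra ℂ K] {ι ι' : Type} [Fintype ι] [Fintype ι']

/-- The enumeration depends on the index type only, not on the vectors, so that two wedge products
can be compared as values of one alternating map. -/
theorem exists_wedgeProd_eq_ιMulti (ι : Type) [Fintype ι] :
    ∃ (N : ℕ) (σ : Fin N ≃ ι), ∀ v : ι → Ω[K⁄ℂ],
      wedgeProd v = ExteriorAlgebra.ιMulti K N (v ∘ σ) := by
  classical
  refine ⟨_, (Finset.univ : Finset ι).nodup_toList.getEquivOfForallMemList _ (by simp),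
    fun v => ?_⟩
  rw [ExteriorAlgebra.ιMulti_apply, wedgeProd]
  congr 1
  refine List.ext_getElem (by simp) fun i h1 h2 => ?_
  simp

theorem wedgeProd_linear [DecidableEq ι] (C : Matrix ι ι K) {u v : ι → Ω[K⁄ℂ]}
    (h : ∀ i, u i = ∑ j, C i j • v j) : wedgeProd u = C.det • wedgeProd v := by
  obtain ⟨N, σ, hσ⟩ := exists_wedgeProd_eq_ιMulti (K := K) ι
  rw [hσ, hσ, ← Matrix.det_submatrix_equiv_self σ C, ← AlternatingMap.map_sum_smul]
  congr 1
  funext i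
  rw [Function.comp_apply, h, ← Equiv.sum_comp σ]
  rfl

theorem wedgeProd_comp_equiv (e : ι ≃ ι') (v : ι' → Ω[K⁄ℂ]) :
    wedgeProd (v ∘ e) = wedgeProd v ∨ wedgeProd (v ∘ e) = -wedgeProd v := by
  obtain ⟨N, σ, hσ⟩ := exists_wedgeProd_eq_ιMulti (K := K) ι
  obtain ⟨N', σ', hσ'⟩ := exists_wedgeProd_eq_ιMulti (K := K) ι'
  obtain rfl : N = N' := by
    have := Fintype.card_congr ((σ.trans e).trans σ'.symm)
    rwa [Fintype.card_fin, Fintype.card_fin] at this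
  rw [hσ, hσ']
  have h : (v ∘ e) ∘ σ = (v ∘ σ') ∘ ((σ.trans e).trans σ'.symm) := by
    funext i
    simp
  rw [h, AlternatingMap.map_perm]
  rcases Int.units_eq_one_or (Equiv.Perm.sign ((σ.trans e).trans σ'.symm)) with h | h <;> simp [h]

/-- A unimodular substitution changes the wedge product at most by a sign. -/
theorem wedgeProd_unimodular [DecidableEq ι] [DecidableEq ι'] {A : Matrix ι' ι ℤ}
    {B : Matrix ι ι' ℤ} (hAB : A * B = 1) (hBA : B * A = 1) {u : ι → Ω[K⁄ℂ]} {v : ι' → Ω[K⁄ℂ]}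
    (h : ∀ i, u i = ∑ j, A j i • v j) : wedgeProd u = wedgeProd v ∨ wedgeProd u = -wedgeProd v := by
  have e : ι ≃ ι' := Fintype.equivOfCardEq (Matrix.square_of_invertible B A hBA hAB)
  have hu : wedgeProd u =
      (((A.submatrix e id).transpose).map (Int.cast : ℤ → K)).det • wedgeProd (v ∘ e) := by
    refine wedgeProd_linear _ fun i => ?_
    rw [h, ← Equiv.sum_comp e]
    refine Finset.sum_congr rfl fun j _ => ?_
    simp only [Matrix.map_apply, Matrix.transpose_apply, Matrix.submatrix_apply, id,
      Function.comp_apply]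
    rw [Int.cast_smul_eq_zsmul]
  -- The determinants are integers with product 1, hence ±1.
  have hdet : (A.submatrix e id).det * (B.submatrix id e).det = 1 := by
    have : A.submatrix e id * B.submatrix id e = (A * B).submatrix e e := by
      ext i j
      simp [Matrix.mul_apply]
    rw [← Matrix.det_mul, this, hAB, Matrix.submatrix_one_equiv, Matrix.det_one]
  rw [hu, show (Int.cast : ℤ → K) = Int.castRingHom K from rfl, ← RingHom.mapMatrix_apply,
    ← RingHom.map_det, Matrix.det_transpose]
  rcases Int.eq_one_or_neg_one_of_mul_eq_one hdet with h1 | h1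
  · rw [h1, map_one, one_smul]
    exact wedgeProd_comp_equiv e v
  · rw [h1, map_neg, map_one, neg_smul, one_smul]
    rcases wedgeProd_comp_equiv e v with h2 | h2 <;> rw [h2]
    · exact .inr rfl
    · exact .inl (neg_neg _)

theorem dlog_mul {x y : K} (hx : x ≠ 0) (hy : y ≠ 0) : dlog (x * y) = dlog x + dlog y := by
  unfold dlog
  rw [Derivation.leibniz, smul_add, smul_smul, smul_smul, add_comm, mul_inv]
  congr 2
  · field_simp
  · field_simp

theorem dlog_zpow {x : K} (hx : x ≠ 0) (a : ℤ) : dlog (x ^ a) = a • dlog x := by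
  unfold dlog
  rw [Derivation.leibniz_zpow, smul_comm, smul_smul, ← zpow_neg, ← zpow_add₀ hx,
    show -a + (a - 1) = -1 by ring, zpow_neg_one]

theorem dlog_prod_zpow {ι : Type} (s : Finset ι) {x : ι → K} (hx : ∀ i, x i ≠ 0) (a : ι → ℤ) :
    dlog (∏ i ∈ s, x i ^ a i) = ∑ i ∈ s, a i • dlog (x i) := by
  classical
  induction s using Finset.induction_on with
  | empty => simp [dlog]
  | insert i s hi ih =>
    rw [Finset.prod_insert hi, Finset.sum_insert hi, ← ih, ← dlog_zpow (hx i), dlog_mul]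
    · exact zpow_ne_zero _ (hx i)
    · exact Finset.prod_ne_zero_iff.2 fun j _ => zpow_ne_zero _ (hx j)

theorem smul_dlog {x : K} (hx : x ≠ 0) : x • dlog x = KaehlerDifferential.D ℂ K x := by
  rw [dlog, smul_smul, mul_inv_cancel₀ hx, one_smul]

end WedgeProd

/-! ### The Jacobian of the network matrix, row by row -/

section RowForms

variable {K : Type} [Field K] [Algebra ℂ K] {v : ℕ → ℕ → K}

/-- The differentials of the entries of the network matrix of the first `i` rows, together with the
logarithmic differentials of the weights in the other rows. -/
noncomputable def rowForm (v : ℕ → ℕ → K) (i a b : ℕ) : Ω[K⁄ℂ] :=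
  if a < i then KaehlerDifferential.D ℂ K (gridEntry v i a b) else dlog (v a b)

/-- The coefficients of the forms `rowForm v (i + 1)` in terms of the forms `rowForm v i`. -/
def rowFormCoeff (v : ℕ → ℕ → K) (i : ℕ) {k m : ℕ} :
    Matrix (Fin k × Fin m) (Fin k × Fin m) K := fun x y =>
  if (x.1 : ℕ) < i then
    (if y.1 = x.1 then if (y.2 : ℕ) ≤ x.2 then -v i x.2 else 0 else 0) +
      if (y.1 : ℕ) = i then if y.2 = x.2 then gridEntry v (i + 1) x.1 x.2 else 0 else 0
  else if y = x then if (x.1 : ℕ) = i then v i x.2 else 1 else 0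

theorem sum_fin_ite_le {A : Type*} [AddCommMonoid A] {m b : ℕ} (hb : b < m) (f : ℕ → A) :
    ∑ d : Fin m, (if (d : ℕ) ≤ b then f d else 0) = ∑ j ∈ Finset.range (b + 1), f j := by
  rw [Fin.sum_univ_eq_sum_range (fun d => if d ≤ b then f d else 0) m, ← Finset.sum_filter]
  congr 1
  ext j
  simp only [Finset.mem_filter, Finset.mem_range]
  omega

/-- The Leibniz rule applied to the recursion: for a < i the weight multiplies minus a partial sum,
for a = i the entry is the weight itself, and the later rows are not touched. -/
theorem rowForm_succ (hv : ∀ i b, v i b ≠ 0) {i k m : ℕ} (hi : i < k) (x : Fin k × Fin m) :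
    rowForm v (i + 1) x.1 x.2 = ∑ y, rowFormCoeff v i x y • rowForm v i y.1 y.2 := by
  obtain ⟨a, b⟩ := x
  rcases lt_trichotomy (a : ℕ) i with h | h | h
  · have hx : gridEntry v (i + 1) a b =
        v i b * -∑ j ∈ Finset.range (b + 1), gridEntry v i a j := by
      rw [gridEntry_succ, if_neg h.ne, zero_sub]
    have h1 : ∑ y : Fin k × Fin m, (if y.1 = a then if (y.2 : ℕ) ≤ b then -v i b else 0 else 0) •
        rowForm v i y.1 y.2 =
        -(v i b • ∑ j ∈ Finset.range (b + 1), KaehlerDifferential.D ℂ K (gridEntry v i a j)) := by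
      rw [Fintype.sum_prod_type, Finset.sum_eq_single a]
      · rw [← sum_fin_ite_le b.2, Finset.smul_sum, ← Finset.sum_neg_distrib]
        refine Finset.sum_congr rfl fun d _ => ?_
        rw [if_pos rfl, rowForm, if_pos h]
        split_ifs <;> simp
      · intro c _ hc
        simp [hc]
      · simp
    have h2 : ∑ y : Fin k × Fin m, (if (y.1 : ℕ) = i then
        if y.2 = b then gridEntry v (i + 1) a b else 0 else 0) • rowForm v i y.1 y.2 =
        gridEntry v (i + 1) a b • dlog (v i b) := by
      rw [Finset.sum_eq_single (⟨i, hi⟩, b)]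
      · simp [rowForm]
      · rintro ⟨c, d⟩ - hcd
        have : ¬((c : ℕ) = i ∧ d = b) := fun hh => hcd (by
          ext
          · exact hh.1
          · rw [hh.2])
        rw [← ite_and, if_neg this, zero_smul]
      · simp
    simp only [rowFormCoeff, if_pos h, add_smul, Finset.sum_add_distrib]
    rw [h1, h2, rowForm, if_pos (by omega), hx, Derivation.leibniz, map_neg, map_sum, mul_comm,
      mul_smul, smul_dlog (hv i b), smul_neg]
  · rw [Finset.sum_eq_single (a, b)]
    · simp [rowFormCoeff, rowForm, h, gridEntry_succ_self, smul_dlog (hv i b)]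
    · intro y _ hy
      simp [rowFormCoeff, h, hy]
    · simp
  · rw [Finset.sum_eq_single (a, b)]
    · simp [rowFormCoeff, rowForm, h.not_gt, h.ne', show ¬(a : ℕ) < i + 1 by omega]
    · intro y _ hy
      simp [rowFormCoeff, h.not_gt, hy]
    · simp

omit [Algebra ℂ K] in
-- With the rows in reverse order and positions increasing within a row, the coefficients are lower
-- triangular: an entry involves its own row up to the same position, and row `i`, which comes
-- earlier in this order.
theorem rowFormCoeff_eq_zero {i k m : ℕ} {x y : Fin k × Fin m}
    (h : finProdFinEquiv (x.1.rev, x.2) < finProdFinEquiv (y.1.rev, y.2)) :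
    rowFormCoeff v i x y = 0 := by
  obtain ⟨a, b⟩ := x
  obtain ⟨c, d⟩ := y
  rw [Fin.lt_def, finProdFinEquiv_apply_val, finProdFinEquiv_apply_val] at h
  simp only [Fin.val_rev] at h
  simp only [rowFormCoeff]
  have hca : ¬((c : ℕ) = a ∧ (d : ℕ) ≤ b) := by
    rintro ⟨h1, h2⟩
    rw [h1] at h
    omega
  have hci : (a : ℕ) < i → ¬((c : ℕ) = i ∧ d = b) := by
    rintro hai ⟨h1, rfl⟩
    have : m * (k - (c + 1)) ≤ m * (k - (a + 1)) := Nat.mul_le_mul_left _ (by omega)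
    omega
  split_ifs with h1 h2 h3 h4 h5 h6 h7 <;> simp_all

omit [Algebra ℂ K] in
-- The diagonal entry at position `b` is -v i b in the rows before `i`, v i b in row `i` and 1
-- afterwards, which gives i + 1 factors up to sign.
theorem det_rowFormCoeff_sq {i k m : ℕ} (hi : i < k) :
    (rowFormCoeff v i : Matrix (Fin k × Fin m) (Fin k × Fin m) K).det ^ 2 =
      (∏ b ∈ Finset.range m, v i b ^ (i + 1)) ^ 2 := by
  set σ : Fin k × Fin m ≃ Fin (k * m) :=
    (Fin.revPerm.prodCongr (Equiv.refl _)).trans finProdFinEquiv with hσ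
  have hdet : (rowFormCoeff v i : Matrix (Fin k × Fin m) (Fin k × Fin m) K).det =
      ∏ x : Fin k × Fin m, rowFormCoeff v i x x := by
    rw [← Matrix.det_submatrix_equiv_self σ.symm, Matrix.det_of_isLowerTriangular,
      ← Equiv.prod_comp σ]
    · simp
    · intro s t hst
      rw [Matrix.submatrix_apply]
      refine rowFormCoeff_eq_zero ?_
      have h : ∀ s, finProdFinEquiv ((σ.symm s).1.rev, (σ.symm s).2) = s := fun s =>
        σ.apply_symm_apply s
      rw [h, h]
      exact hst
  have hdiag : ∀ a : Fin k, ∏ b : Fin m, (rowFormCoeff v i (a, b) (a, b)) ^ 2 =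
      if (a : ℕ) ≤ i then ∏ b ∈ Finset.range m, v i b ^ 2 else 1 := by
    intro a
    rw [← Fin.prod_univ_eq_prod_range (fun b => v i b ^ 2) m]
    split_ifs with h
    · refine Finset.prod_congr rfl fun b _ => ?_
      rcases h.lt_or_eq with h | h
      · simp [rowFormCoeff, h, h.ne]
      · simp [rowFormCoeff, h]
    · refine Finset.prod_eq_one fun b _ => ?_
      simp [rowFormCoeff, show ¬(a : ℕ) < i by omega, show (a : ℕ) ≠ i by omega]
  rw [hdet, ← Finset.prod_pow, Fintype.prod_prod_type, Finset.prod_congr rfl fun a _ => hdiag a,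
    Fin.prod_univ_eq_prod_range
      (fun a => if a ≤ i then ∏ b ∈ Finset.range m, v i b ^ 2 else 1) k, ← Finset.prod_filter,
    show {a ∈ Finset.range k | a ≤ i} = Finset.range (i + 1) by
      ext a
      simp only [Finset.mem_filter, Finset.mem_range]
      omega, Finset.prod_const, Finset.card_range, Finset.prod_pow, Finset.prod_pow, ← pow_mul,
    ← pow_mul, mul_comm]

theorem exists_wedgeProd_rowForm (hv : ∀ i b, v i b ≠ 0) {i k m : ℕ} (hi : i ≤ k) : ∃ s : K,
    s ^ 2 = (∏ i ∈ Finset.range i, ∏ b ∈ Finset.range m, v i b ^ (i + 1)) ^ 2 ∧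
      (wedgeProd fun x : Fin k × Fin m => rowForm v i x.1 x.2) =
        s • wedgeProd fun x : Fin k × Fin m => dlog (v x.1 x.2) := by
  induction i with
  | zero => exact ⟨1, by simp, by simp [rowForm]⟩
  | succ i ih =>
    obtain ⟨s, hs, h⟩ := ih (by omega)
    refine ⟨(rowFormCoeff v i : Matrix (Fin k × Fin m) (Fin k × Fin m) K).det * s, ?_, ?_⟩
    · rw [mul_pow, hs, det_rowFormCoeff_sq (by omega), Finset.prod_range_succ]
      ring
    · rw [wedgeProd_linear (rowFormCoeff v i) (rowForm_succ hv (by omega)), h, smul_smul]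

end RowForms

/-! ### Comparison of the two forms -/

theorem inv_neg_mul_self {K : Type*} [Field K] {s : K} (hs : s ≠ 0) : (-s)⁻¹ * s = -1 := by
  rw [inv_neg, neg_mul, inv_mul_cancel₀ hs]

/-- The form on the top cell is, up to sign, the product of the logarithmic differentials of the
gauge-fixed weights. -/
theorem grassmannianForm_eq_or_eq_neg {k n : ℕ} (hkn : k ≤ n) {v : ℕ → ℕ → GrField k n}
    (hv : ∀ i b, v i b ≠ 0)
    (hx : ∀ ab : Fin k × Fin (n - k), RatFun.var ab = gridEntry v k ab.1 ab.2) :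
    (grassmannianForm k n = wedgeProd fun ab : Fin k × Fin (n - k) => dlog (v ab.1 ab.2)) ∨
      grassmannianForm k n = -wedgeProd fun ab : Fin k × Fin (n - k) => dlog (v ab.1 ab.2) := by
  obtain ⟨s, hs, h⟩ := exists_wedgeProd_rowForm (m := n - k) hv (le_refl k)
  have hP := prod_pluckerTuple_cyclicColumns_sq v hkn
  have hvar : (RatFun.var : _ → GrField k n) = fun ab => gridEntry v k ab.1 ab.2 := funext hx
  have hd : (fun ab : Fin k × Fin (n - k) => KaehlerDifferential.D ℂ (GrField k n)
      (RatFun.var ab)) = fun ab => rowForm v k ab.1 ab.2 := by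
    funext ab
    rw [rowForm, if_pos ab.1.2, hx]
  rw [grassmannianForm, hd, h, hvar, smul_smul]
  rw [← hs] at hP
  have hs0 : s ≠ 0 := by
    intro h0
    rw [h0, zero_pow two_ne_zero] at hs
    exact pow_ne_zero 2 (Finset.prod_ne_zero_iff.2 fun i _ => Finset.prod_ne_zero_iff.2 fun b _ =>
      pow_ne_zero _ (hv i b)) hs.symm
  -- The denominator and the Jacobian have equal squares, so their quotient is ±1.
  rcases sq_eq_sq_iff_eq_or_eq_neg.1 hP with h1 | h1
  · left
    rw [h1, inv_mul_cancel₀ hs0, one_smul]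
  · right
    rw [h1, inv_neg_mul_self hs0, neg_smul, one_smul]

theorem grid_hasCanonicalForm {k n : ℕ} (hk : 0 < k) (hkn : k ≤ n) :
    (gridGraph k n hk).HasCanonicalForm k (grassmannianForm k n) := by
  classical
  refine ⟨⟨_, grid_isDisconnectedGrove hk hkn⟩, fun E' hE' => ?_⟩
  obtain ⟨ψ, v, B, A, hψ, hv, hx, hBA, hAB, ht⟩ := grid_exists_isPullback hk hkn hE'
  refine ⟨ψ, hψ, ?_⟩
  have h1 := grassmannianForm_eq_or_eq_neg hkn hv hx
  have h2 := wedgeProd_unimodular hAB hBA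
    (u := fun e : {e // e ∈ E'} => dlog (ψ.symm (RatFun.var e)))
    (v := fun f : Fin k × Fin (n - k) => dlog (v f.1 f.2)) (fun e => by
      rw [ht e]
      exact dlog_prod_zpow _ (fun f => hv _ _) _)
  rcases h1 with h1 | h1 <;> rcases h2 with h2 | h2 <;> rw [h1, h2]
  · exact .inl rfl
  · exact .inr (neg_neg _).symm
  · exact .inr rfl
  · exact .inl rfl

theorem mainTheorem7 (k n : ℕ) (hk : 0 < k) (hkn : k ≤ n) :
    (gridGraph k n hk).IsPlanar ∧
    (gridGraph k n hk).IsReduced ∧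
    (gridGraph k n hk).HasBoundedAffinePerm (fun a => a + k) ∧
    (gridGraph k n hk).HasCanonicalForm k (grassmannianForm k n) :=
  ⟨grid_isPlanar hk hkn, grid_isReduced hk hkn, grid_hasBoundedAffinePerm hk hkn,
    grid_hasCanonicalForm hk hkn⟩
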